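/- Let $k$ be an algebraically closed field of characteristic $0$, complete with respect to a non-trivial non-archimedean absolute value. Let $\varphi\colon D_2\to D_1$ be a finite étale morphism of strict open discs over $k$ (open discs whose radius lies in $|k^*|$). Radii of subdiscs of $D_1$ and $D_2$ are normalised so that each of these discs has radius $1$; $D(x,s^-)$ is the open subdisc of normalised radius $s$ around a rational point $x$, and for $z\in D_2(k)$ and $\rho\in[0,1)$, $z_\rho$ is the Shilov point of the closed disc $D(z,\rho)$. Assume that $\varphi$ is radial with profile function $f$, that is, for all $z\in D_2(k)$ the function $\rho\mapsto r(\varphi(z_\rho))$ on $[0,1)$, extended by $1\mapsto 1$, is the same function $f\colon[0,1]\to[0,1]$, where $r$ is the (normalised) radius function of $D_1$, $r(p)=\inf_{a\in k}|(T-a)(p)|$ for a normalised coordinate $T$ on $D_1$. For a differential equation $(\mathcal G,\nabla)$ of rank $q$ on a strict open disc $D$ (a locally free sheaf of rank $q$ with a connection) and $x\in D(k)$, the multiradius of convergence $\mathcal{MR}(x,(\mathcal G,\nabla))$ is the non-decreasing family $(\mathcal R_1,\dots,\mathcal R_q)$ with $$\mathcal R_i=\sup\{s\in(0,1)\mid \dim_k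 H^0(D(x,s^-),(\mathcal G,\nabla))\ge q-i+1\},$$ where $H^0$ denotes the space of horizontal sections. Let $(\mathcal E,\nabla)$ be a differential equation of rank $r$ on $D_2$ and let $x\in D_1(k)$. For $s\in(0,1]$ let $N_x(s)$ be the number of connected components of $\varphi^{-1}(D(x,s^-))$ (as a Berkovich space). The breaks of $N_x$, i.e. its points of discontinuity in $(0,1)$ together with $0$ and $1$, are finite in number; write them as $0=s_0<s_1<\dots<s_n=1$, and put $n_{x,i}=N_x(s_i)$ for $1\le i\le n$. Suppose that there are $R_1\le\dots\le R_r$ such that $\mathcal{MR}(y,(\mathcal E,\nabla))=(R_1,\dots,R_r)$ for every $y\in\varphi^{-1}(x)$. Then for each $i\in\{1,\dots,r\}$ there is a unique $m_i\in\{0,\dots,n-1\}$ with $s_{m_i}<f(R_i)\le s_{m_i+1}$. Let $$F_i=(s_1,\dots,s_1,\ \dots,\ s_{m_i},\dots,s_{m_i},\ f(R_i),\dots,f(R_i)),$$ where $s_j$ appears $n_{x,j}-n_{x,j+1}$ times for $j=1,\dots,m_i$, and $f(R_i)$ appears $n_{x,m_i+1}$ times. Then $\mathcal{MR}(x,\varphi_*(\mathcal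 E,\nabla))$ is the family obtained by concatenating $F_1,\dots,F_r$ and reordering the result in non-decreasing order. -/

import Mathlib

open scoped TensorProduct

universe u v

noncomputable section

namespace PadicDisc

/-- An open disc `D(c, ρ⁻)` of the affine line over `k`, with centre `c ∈ k` and radius `ρ > 0`. -/
structure OpenDisc (k : Type u) [NontriviallyNormedField k] where
  center : k
  radius : ℝ
  radius_pos : 0 < radius

/-! ### Rational points and analytic functions -/

section Algebra

lemma isUnit_of_formallyUnramified {A B : Type*} [CommRing A] [CommRing B] [Algebra A B]
    [Algebra.FormallyUnramified A B] (d : B →+ B) (hd : ∀ a b, d (a * b) = a * d b + b * d a)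
    (u t : B) (hu : ∀ a : A, d (algebraMap A B a) ∈ Ideal.span {u}) (ht : d t = 1) :
    IsUnit u := by
  let I : Ideal B := Ideal.span {u}
  let δ : Derivation A B (B ⧸ I) := Derivation.mk'
    { toFun := fun b => Ideal.Quotient.mk I (d b)
      map_add' := fun a b => by rw [map_add, map_add]
      map_smul' := fun a b => by
        have h0 : Ideal.Quotient.mk I (b * d (algebraMap A B a)) = 0 := by
          rw [Ideal.Quotient.eq_zero_iff_mem]
          exact I.mul_mem_left _ (hu a)
        rw [Algebra.smul_def, hd, map_add, h0, add_zero, map_mul, RingHom.id_apply,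
          Algebra.smul_def]
        rfl }
    (fun a b => by
      change Ideal.Quotient.mk I (d (a * b)) = _
      rw [hd, map_add, map_mul, map_mul]
      rfl)
  have : Subsingleton (Derivation A B (B ⧸ I)) :=
    (KaehlerDifferential.linearMapEquivDerivation A B).symm.injective.subsingleton
  have h0 : δ t = 0 := by rw [Subsingleton.elim δ 0]; rfl
  have h2 : (1 : B) ∈ I := by
    rw [← Ideal.Quotient.eq_zero_iff_mem, ← ht]
    exact h0
  rwa [← Ideal.eq_top_iff_one, Ideal.span_singleton_eq_top] at h2

lemma projective_trans (A B M : Type*) [CommRing A] [CommRing B] [Algebra A B] [AddCommGroup M]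
    [Module A M] [Module B M] [IsScalarTower A B M] [Module.Projective A B]
    [Module.Projective B M] : Module.Projective A M := by
  classical
  obtain ⟨s, hs⟩ := Module.projective_lifting_property
    (Finsupp.linearCombination B (id : M → M)) LinearMap.id
    (Finsupp.linearCombination_id_surjective B M)
  have : Module.Projective A (M →₀ B) :=
    Module.Projective.of_equiv (finsuppLequivDFinsupp (ι := M) (M := B) A).symm
  exact Module.Projective.of_split (M := M →₀ B) (s.restrictScalars A)
    ((Finsupp.linearCombination B (id : M → M)).restrictScalars A)
    (LinearMap.ext fun e => LinearMap.congr_fun hs e)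

section BaseChange

variable {A B M : Type*} [CommRing A] [CommRing B] [Algebra A B] [AddCommGroup M] [Module A M]
  (dA : A → A) (dB : B →+ B) (hB : ∀ a b, dB (a * b) = a * dB b + b * dB a)
  (hAB : ∀ a, dB (algebraMap A B a) = algebraMap A B (dA a))
  (conn : M →+ M) (hc : ∀ (a : A) (m : M), conn (a • m) = dA a • m + a • conn m)

/-- The map `b ⊗ m ↦ db ⊗ m + b ⊗ ∇m` on `B ⊗ M`, for a map `∇` satisfying the Leibniz rule. -/
def baseChangeConn : B ⊗[A] M →+ B ⊗[A] M :=
  TensorProduct.liftAddHom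
    (AddMonoidHom.mk' (fun b => AddMonoidHom.mk' (fun m => dB b ⊗ₜ[A] m + b ⊗ₜ[A] conn m)
        (fun m n => by
          rw [map_add, TensorProduct.tmul_add, TensorProduct.tmul_add]; abel))
      (fun b b' => by
        ext m
        simp only [AddMonoidHom.mk'_apply, AddMonoidHom.add_apply, map_add,
          TensorProduct.add_tmul]
        abel))
    (fun a b m => by
      have h1 : dB (a • b) = dA a • b + a • dB b := by
        rw [Algebra.smul_def, Algebra.smul_def, Algebra.smul_def, hB, hAB]
        ring
      simp only [AddMonoidHom.mk'_apply]
      rw [h1, hc, TensorProduct.add_tmul, TensorProduct.tmul_add,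
        TensorProduct.smul_tmul, TensorProduct.smul_tmul, TensorProduct.smul_tmul]
      abel)

lemma baseChangeConn_tmul (b : B) (m : M) :
    baseChangeConn dA dB hB hAB conn hc (b ⊗ₜ[A] m) = dB b ⊗ₜ[A] m + b ⊗ₜ[A] conn m := rfl

lemma baseChangeConn_smul (b : B) (t : B ⊗[A] M) :
    baseChangeConn dA dB hB hAB conn hc (b • t) =
      dB b • t + b • baseChangeConn dA dB hB hAB conn hc t := by
  induction t using TensorProduct.induction_on with
  | zero => simp
  | add s t hs ht =>
    rw [smul_add, map_add, hs, ht, map_add, smul_add, smul_add]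
    abel
  | tmul b' m =>
    rw [TensorProduct.smul_tmul', baseChangeConn_tmul, baseChangeConn_tmul, smul_eq_mul, hB,
      TensorProduct.add_tmul, smul_add, TensorProduct.smul_tmul', TensorProduct.smul_tmul',
      TensorProduct.smul_tmul', smul_eq_mul, smul_eq_mul, smul_eq_mul, mul_comm b' (dB b)]
    abel

end BaseChange

end Algebra

section Functions

variable {k : Type u} [NontriviallyNormedField k]

/-- The set `D(k)` of rational points of an open disc. -/
def OpenDisc.pts (D : OpenDisc k) : Set k := Metric.ball D.center D.radius

lemma OpenDisc.mem_pts_iff [IsUltrametricDist k] {D : OpenDisc k} (x : D.pts) (w : k) :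
    w ∈ D.pts ↔ ‖w - x‖ < D.radius := by
  have h : Metric.ball D.center D.radius = Metric.ball (x : k) D.radius :=
    IsUltrametricDist.ball_eq_of_mem x.2
  change w ∈ Metric.ball D.center D.radius ↔ _
  rw [h, Metric.mem_ball, dist_eq_norm]

/-- The disc is strict: its radius lies in the value group of `k`. -/
def OpenDisc.IsStrict (D : OpenDisc k) : Prop := ∃ a : k, ‖a‖ = D.radius

/-- `f` is analytic on the disc `D`: around every rational point `x` of `D` it is given by a power
series which converges on all of `D` (over an ultrametric field every rational point of `D` is a
centre of `D`). -/
def OpenDisc.IsAnalytic (D : OpenDisc k) (f : D.pts → k) : Prop :=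
  ∀ x : D.pts, ∃ a : ℕ → k, ∀ z : D.pts, HasSum (fun n => a n * ((z : k) - x) ^ n) (f z)

/-- Extension by zero of a function on the rational points of `D`; it only serves to speak of
derivatives at points of `D`. -/
def OpenDisc.ext (D : OpenDisc k) (f : D.pts → k) : k → k := Function.extend Subtype.val f 0

lemma OpenDisc.ext_apply (D : OpenDisc k) (f : D.pts → k) (z : D.pts) : D.ext f z = f z :=
  Subtype.val_injective.extend_apply _ _ _

lemma OpenDisc.IsAnalytic.mul [IsUltrametricDist k] [CompleteSpace k] {D : OpenDisc k}
    {f g : D.pts → k} (hf : D.IsAnalytic f) (hg : D.IsAnalytic g) : D.IsAnalytic (f * g) := by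
  intro x
  obtain ⟨a, ha⟩ := hf x
  obtain ⟨b, hb⟩ := hg x
  refine ⟨fun n => ∑ ij ∈ Finset.HasAntidiagonal.antidiagonal n, a ij.1 * b ij.2, fun z => ?_⟩
  have : NonarchimedeanRing k :=
    { is_nonarchimedean := NonarchimedeanAddGroup.is_nonarchimedean }
  have h := (ha z).mul_of_nonarchimedean (hb z)
  have h' := (Finset.HasAntidiagonal.sigmaAntidiagonalEquivProd (A := ℕ)).hasSum_iff.mpr h
  have h'' := h'.sigma (g := fun n => (∑ ij ∈ Finset.HasAntidiagonal.antidiagonal n, a ij.1 * b ij.2) *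
    ((z : k) - x) ^ n) (fun n => by
      have := hasSum_fintype (fun c : Finset.HasAntidiagonal.antidiagonal n =>
        a c.1.1 * ((z : k) - x) ^ c.1.1 * (b c.1.2 * ((z : k) - x) ^ c.1.2))
      refine Eq.subst (motive := HasSum _) ?_ this
      symm
      rw [Finset.sum_mul, ← Finset.sum_attach]
      refine Finset.sum_congr rfl fun c _ => ?_
      have hc : n = c.1.1 + c.1.2 := (Finset.HasAntidiagonal.mem_antidiagonal.mp c.2).symm
      have hp : ((z : k) - x) ^ n = ((z : k) - x) ^ c.1.1 * ((z : k) - x) ^ c.1.2 :=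
        (congrArg _ hc).trans (pow_add _ _ _)
      rw [hp]
      ring)
  exact h''

/-- The `k`-algebra `𝒪(D)` of analytic functions on an open disc. -/
def OpenDisc.functions [IsUltrametricDist k] [CompleteSpace k] (D : OpenDisc k) :
    Subalgebra k (D.pts → k) where
  carrier := {f | D.IsAnalytic f}
  mul_mem' hf hg := hf.mul hg
  add_mem' := by
    intro f g hf hg x
    obtain ⟨a, ha⟩ := hf x
    obtain ⟨b, hb⟩ := hg x
    refine ⟨fun n => a n + b n, fun z => ?_⟩
    simpa [add_mul] using (ha z).add (hb z)
  algebraMap_mem' c x := by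
    refine ⟨fun n => if n = 0 then c else 0, fun z => ?_⟩
    convert hasSum_ite_eq (0 : ℕ) c using 2 with n
    · by_cases hn : n = 0 <;> simp [hn]
    · rfl

/-- `𝒪(D)` as a type. -/
def OpenDisc.Fun [IsUltrametricDist k] [CompleteSpace k] (D : OpenDisc k) : Type u :=
  D.functions

instance OpenDisc.commRing [IsUltrametricDist k] [CompleteSpace k] (D : OpenDisc k) :
    CommRing D.Fun :=
  inferInstanceAs (CommRing D.functions)

instance OpenDisc.algebra [IsUltrametricDist k] [CompleteSpace k] (D : OpenDisc k) :
    Algebra k D.Fun :=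
  inferInstanceAs (Algebra k D.functions)

/-- The coordinate function `T` on `D`. -/
def OpenDisc.coord [IsUltrametricDist k] [CompleteSpace k] (D : OpenDisc k) : D.Fun :=
  ⟨fun z => z, fun x => ⟨fun n => if n = 0 then (x : k) else if n = 1 then 1 else 0, fun z => by
    have h := hasSum_sum_of_ne_finset_zero (L := .unconditional ℕ) (s := Finset.range 2)
      (f := fun n : ℕ => (if n = 0 then (x : k) else if n = 1 then 1 else 0) * ((z : k) - x) ^ n)
      (fun n hn => by
        have : ¬ n < 2 := by simpa using hn
        have h0 : n ≠ 0 := by omega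
        have h1 : n ≠ 1 := by omega
        simp [h0, h1])
    convert h using 1
    simp [Finset.sum_range_succ]⟩⟩


lemma exists_norm_between [IsAlgClosed k] {t r : ℝ} (ht : 0 ≤ t) (htr : t < r) (w : k)
    (hw : ‖w‖ = t) : ∃ u : k, t < ‖u‖ ∧ ‖u‖ < r := by
  rcases ht.eq_or_lt with rfl | ht
  · obtain ⟨u, hu, hu'⟩ := NormedField.exists_norm_lt k htr
    exact ⟨u, hu, hu'⟩
  · obtain ⟨c, hc⟩ := NormedField.exists_one_lt_norm k
    have h1 : 1 < r / t := (one_lt_div ht).mpr htr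
    obtain ⟨n, hn⟩ := pow_unbounded_of_one_lt ‖c‖ h1
    have hn0 : n ≠ 0 := by
      rintro rfl
      simp at hn
      linarith
    obtain ⟨v, hv⟩ := IsAlgClosed.exists_pow_nat_eq c (Nat.pos_of_ne_zero hn0)
    have hvn : ‖v‖ ^ n = ‖c‖ := by rw [← norm_pow, hv]
    have hv1 : 1 < ‖v‖ := by
      by_contra hle
      have := pow_le_one₀ (norm_nonneg v) (not_lt.mp hle) (n := n)
      linarith
    have hv2 : ‖v‖ < r / t := by
      rw [← hvn] at hn
      exact lt_of_pow_lt_pow_left₀ n (by positivity) hn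
    refine ⟨v * w, ?_, ?_⟩
    · rw [norm_mul, hw]
      nlinarith
    · rw [norm_mul, hw]
      exact (lt_div_iff₀ ht).mp hv2

/-- On a smaller ball the expansion of an analytic function is a power series in the sense of
Mathlib. -/
lemma OpenDisc.hasFPowerSeriesOnBall (D : OpenDisc k) {f : D.pts → k} {x : D.pts} {a : ℕ → k}
    (ha : ∀ z : D.pts, HasSum (fun n => a n * ((z : k) - x) ^ n) (f z)) [IsUltrametricDist k]
    {u : k} (hu0 : 0 < ‖u‖) (hu : ‖u‖ < D.radius) :
    HasFPowerSeriesOnBall (D.ext f) (FormalMultilinearSeries.ofScalars k a) (x : k)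
      (‖u‖₊ : ENNReal) where
  r_le := by
    refine FormalMultilinearSeries.le_radius_of_tendsto (l := 0) _ ?_
    have hx : (x : k) + u ∈ D.pts := by
      rw [OpenDisc.mem_pts_iff x]
      simpa using hu
    have h := (ha ⟨_, hx⟩).summable.tendsto_atTop_zero.norm
    simpa [FormalMultilinearSeries.ofScalars_norm] using h
  r_pos := by simpa using hu0
  hasSum := by
    intro y hy
    have hx : (x : k) + y ∈ D.pts := by
      rw [OpenDisc.mem_pts_iff x]
      have : ‖y‖ < ‖u‖ := by simpa using hy
      simpa using this.trans hu
    have h := ha ⟨_, hx⟩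
    rw [← D.ext_apply f] at h
    simpa [FormalMultilinearSeries.ofScalars_apply_eq, mul_comm] using h

lemma OpenDisc.exists_radius (D : OpenDisc k) : ∃ u : k, 0 < ‖u‖ ∧ ‖u‖ < D.radius :=
  NormedField.exists_norm_lt k D.radius_pos

lemma OpenDisc.IsAnalytic.differentiableAt [IsUltrametricDist k] [CompleteSpace k]
    {D : OpenDisc k} {f : D.pts → k} (hf : D.IsAnalytic f) (z : D.pts) :
    DifferentiableAt k (D.ext f) z := by
  obtain ⟨a, ha⟩ := hf z
  obtain ⟨u, hu0, hu⟩ := D.exists_radius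
  exact (D.hasFPowerSeriesOnBall ha hu0 hu).analyticAt.differentiableAt

lemma OpenDisc.IsAnalytic.deriv [IsUltrametricDist k] [CompleteSpace k] [IsAlgClosed k]
    {D : OpenDisc k} {f : D.pts → k} (hf : D.IsAnalytic f) :
    D.IsAnalytic (fun z => deriv (D.ext f) z) := by
  intro x
  obtain ⟨a, ha⟩ := hf x
  refine ⟨fun n => (n + 1 : ℕ) * a (n + 1), fun z => ?_⟩
  have hz : ‖(z : k) - x‖ < D.radius := (OpenDisc.mem_pts_iff x z).mp z.2
  obtain ⟨u, hu, hu'⟩ := exists_norm_between (norm_nonneg _) hz _ rfl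
  have hp := (D.hasFPowerSeriesOnBall ha ((norm_nonneg _).trans_lt hu) hu').fderiv
  have hs := hp.hasSum (y := (z : k) - x) (by simpa using hu)
  have hs' := (ContinuousLinearMap.apply k k (1 : k)).hasSum hs
  have e : (x : k) + ((z : k) - x) = z := by ring
  rw [e] at hs'
  refine Eq.subst (motive := fun F => HasSum F _) (funext fun n => ?_) hs'
  have hc := (FormalMultilinearSeries.ofScalars k a).derivSeries_coeff_one n
  rw [FormalMultilinearSeries.coeff_ofScalars] at hc
  rw [FormalMultilinearSeries.apply_eq_pow_smul_coeff]
  simp [hc, mul_comm]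

/-- The derivation `d/dT` of `𝒪(D)`. -/
def OpenDisc.d [IsUltrametricDist k] [CompleteSpace k] [IsAlgClosed k] (D : OpenDisc k) :
    Derivation k D.Fun D.Fun where
  toFun f := ⟨fun z => deriv (D.ext f.1) z, OpenDisc.IsAnalytic.deriv f.2⟩
  map_add' f g := by
    refine Subtype.ext (funext fun z => ?_)
    have e : D.ext (f + g).1 = D.ext f.1 + D.ext g.1 := by
      funext w
      by_cases h : w ∈ D.pts
      · simpa using (D.ext_apply (f + g).1 ⟨w, h⟩).trans (congrArg₂ (· + ·)
          (D.ext_apply f.1 ⟨w, h⟩).symm (D.ext_apply g.1 ⟨w, h⟩).symm)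
      · have h' : ¬ ∃ a : D.pts, (a : k) = w := fun ⟨a, ha⟩ => h (ha ▸ a.2)
        simp [OpenDisc.ext, Function.extend_apply' _ _ _ h']
    have := (OpenDisc.IsAnalytic.differentiableAt f.2 z).hasDerivAt.add
      (OpenDisc.IsAnalytic.differentiableAt g.2 z).hasDerivAt
    change deriv (D.ext (f + g).1) z = _
    rw [e]
    exact this.deriv
  map_smul' c f := by
    refine Subtype.ext (funext fun z => ?_)
    have e : D.ext (c • f).1 = fun w => c * D.ext f.1 w := by
      funext w
      by_cases h : w ∈ D.pts
      · simpa using (D.ext_apply (c • f).1 ⟨w, h⟩).trans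
          (congrArg (c * ·) (D.ext_apply f.1 ⟨w, h⟩).symm)
      · have h' : ¬ ∃ a : D.pts, (a : k) = w := fun ⟨a, ha⟩ => h (ha ▸ a.2)
        simp [OpenDisc.ext, Function.extend_apply' _ _ _ h']
    have := (OpenDisc.IsAnalytic.differentiableAt f.2 z).hasDerivAt.const_mul c
    change deriv (D.ext (c • f).1) z = _
    rw [e]
    exact this.deriv
  map_one_eq_zero' := by
    refine Subtype.ext (funext fun z => ?_)
    change deriv (D.ext 1) z = 0
    have : D.ext 1 =ᶠ[nhds (z : k)] fun _ => 1 := by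
      filter_upwards [Metric.isOpen_ball.mem_nhds z.2] with w hw
      exact D.ext_apply 1 ⟨w, hw⟩
    rw [this.deriv_eq, deriv_const]
  leibniz' f g := by
    refine Subtype.ext (funext fun z => ?_)
    have e : D.ext (f * g).1 = fun w => D.ext f.1 w * D.ext g.1 w := by
      funext w
      by_cases h : w ∈ D.pts
      · simpa using (D.ext_apply (f * g).1 ⟨w, h⟩).trans (congrArg₂ (· * ·)
          (D.ext_apply f.1 ⟨w, h⟩).symm (D.ext_apply g.1 ⟨w, h⟩).symm)
      · have h' : ¬ ∃ a : D.pts, (a : k) = w := fun ⟨a, ha⟩ => h (ha ▸ a.2)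
        simp [OpenDisc.ext, Function.extend_apply' _ _ _ h']
    have := (OpenDisc.IsAnalytic.differentiableAt f.2 z).hasDerivAt.mul
      (OpenDisc.IsAnalytic.differentiableAt g.2 z).hasDerivAt
    change deriv (D.ext (f * g).1) z =
      f.1 z * deriv (D.ext g.1) z + g.1 z * deriv (D.ext f.1) z
    rw [e]
    refine this.deriv.trans ?_
    rw [D.ext_apply, D.ext_apply]
    ring

lemma OpenDisc.d_apply [IsUltrametricDist k] [CompleteSpace k] [IsAlgClosed k] (D : OpenDisc k)
    (f : D.Fun) (z : D.pts) : (D.d f).1 z = deriv (D.ext f.1) z := rfl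

lemma OpenDisc.hasDerivAt [IsUltrametricDist k] [CompleteSpace k] [IsAlgClosed k]
    (D : OpenDisc k) (f : D.Fun) (z : D.pts) : HasDerivAt (D.ext f.1) ((D.d f).1 z) z :=
  (OpenDisc.IsAnalytic.differentiableAt f.2 z).hasDerivAt

lemma OpenDisc.d_coord [IsUltrametricDist k] [CompleteSpace k] [IsAlgClosed k]
    (D : OpenDisc k) : D.d D.coord = 1 := by
  refine Subtype.ext (funext fun z => ?_)
  change deriv (D.ext _) z = 1
  have : D.ext D.coord.1 =ᶠ[nhds (z : k)] id := by
    filter_upwards [Metric.isOpen_ball.mem_nhds z.2] with w hw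
    exact D.ext_apply _ ⟨w, hw⟩
  rw [this.deriv_eq, deriv_id]

/-- Restriction `𝒪(D) → 𝒪(U)` of analytic functions to a disc `U ⊆ D`. -/
def OpenDisc.res [IsUltrametricDist k] [CompleteSpace k] {U D : OpenDisc k}
    (h : U.pts ⊆ D.pts) : D.Fun →ₐ[k] U.Fun where
  toFun f := ⟨fun z => f.1 ⟨z, h z.2⟩, fun x => by
    obtain ⟨a, ha⟩ := f.2 ⟨x, h x.2⟩
    exact ⟨a, fun z => ha ⟨z, h z.2⟩⟩⟩
  map_one' := rfl
  map_mul' _ _ := rfl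
  map_zero' := rfl
  map_add' _ _ := rfl
  commutes' _ := rfl

lemma OpenDisc.d_res [IsUltrametricDist k] [CompleteSpace k] [IsAlgClosed k] {U D : OpenDisc k}
    (h : U.pts ⊆ D.pts) (f : D.Fun) : U.d (OpenDisc.res h f) = OpenDisc.res h (D.d f) := by
  refine Subtype.ext (funext fun z => ?_)
  change deriv (U.ext _) z = deriv (D.ext f.1) z
  refine Filter.EventuallyEq.deriv_eq ?_
  filter_upwards [Metric.isOpen_ball.mem_nhds z.2] with w hw
  exact (U.ext_apply _ ⟨w, hw⟩).trans (D.ext_apply f.1 ⟨w, h hw⟩).symm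

/-- The subdisc `D(x, s⁻)` of `D`; the radius `s` is normalised so that `D(x, 1⁻) = D`. -/
def OpenDisc.sub (D : OpenDisc k) (x : D.pts) (s : ℝ) (hs : 0 < s) : OpenDisc k :=
  ⟨x, s * D.radius, mul_pos hs D.radius_pos⟩

lemma OpenDisc.sub_subset [IsUltrametricDist k] (D : OpenDisc k) (x : D.pts) (s : ℝ)
    (hs : 0 < s) (hs1 : s ≤ 1) : (D.sub x s hs).pts ⊆ D.pts := by
  intro z hz
  rw [OpenDisc.mem_pts_iff x]
  have h : ‖z - x‖ < s * D.radius := by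
    rw [← dist_eq_norm]
    exact hz
  have := D.radius_pos
  nlinarith

end Functions

/-! ### Differential equations on open discs -/

section Equations

variable {k : Type u} [NontriviallyNormedField k] [IsUltrametricDist k] [CompleteSpace k]
  [IsAlgClosed k]

/-- A differential equation `(ℰ, ∇)` on the open disc `D`. An open disc is a Stein space, so a
locally free sheaf `ℰ` of finite rank is the same as its module of global sections, a finitely
generated projective `𝒪(D)`-module. As `Ω¹` is free on `dT`, the connection is `∇ = conn ⊗ dT`.
(`k`-linearity of `conn` follows from the Leibniz rule.) -/
structure DiffEq (D : OpenDisc k) where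
  carrier : Type v
  [addCommGroup : AddCommGroup carrier]
  [module : Module D.Fun carrier]
  [finite : Module.Finite D.Fun carrier]
  [projective : Module.Projective D.Fun carrier]
  conn : carrier →+ carrier
  leibniz : ∀ (g : D.Fun) (e : carrier), conn (g • e) = D.d g • e + g • conn e

attribute [instance] DiffEq.addCommGroup DiffEq.module DiffEq.finite DiffEq.projective

namespace DiffEq

variable {D : OpenDisc k}

/-- The rank of `(ℰ, ∇)`. -/
def rank (E : DiffEq.{u, v} D) : ℕ := Module.finrank D.Fun E.carrier

/-- The sections of `ℰ` form a `k`-vector space. -/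
instance vectorSpace (E : DiffEq.{u, v} D) : Module k E.carrier :=
  Module.compHom E.carrier (algebraMap k D.Fun)

/-- The `k`-vector space `H⁰(D, (ℰ, ∇))` of global horizontal sections. -/
def H0 (E : DiffEq.{u, v} D) : Submodule k E.carrier where
  carrier := {e | E.conn e = 0}
  add_mem' := by
    intro a b ha hb
    change E.conn (a + b) = 0
    rw [map_add, show E.conn a = 0 from ha, show E.conn b = 0 from hb, add_zero]
  zero_mem' := map_zero E.conn
  smul_mem' := by
    intro c e he
    change E.conn (algebraMap k D.Fun c • e) = 0
    rw [E.leibniz, Derivation.map_algebraMap, show E.conn e = 0 from he, zero_smul, smul_zero,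
      add_zero]

/-- The restriction of `(ℰ, ∇)` to a disc `U ⊆ D`: the module `𝒪(U) ⊗ ℰ(D)` over `𝒪(D)`, with
`∇(g ⊗ e) = dg ⊗ e + g ⊗ ∇e`. -/
def restrict (E : DiffEq.{u, v} D) {U : OpenDisc k} (h : U.pts ⊆ D.pts) : DiffEq.{u, max u v} U :=
  letI : Algebra D.Fun U.Fun := (OpenDisc.res h).toRingHom.toAlgebra
  { carrier := U.Fun ⊗[D.Fun] E.carrier
    conn := baseChangeConn D.d (U.d : U.Fun →+ U.Fun) U.d.leibniz (OpenDisc.d_res h) E.conn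
      E.leibniz
    leibniz := baseChangeConn_smul D.d (U.d : U.Fun →+ U.Fun) U.d.leibniz (OpenDisc.d_res h)
      E.conn E.leibniz }

/-- `dim H⁰(D(x, s⁻), (ℰ, ∇))` for a rational point `x` of `D` and `s ∈ (0, 1]`, as a cardinal. -/
def dimH0 (E : DiffEq.{u, v} D) (x : D.pts) (s : ℝ) (hs : 0 < s) (hs1 : s ≤ 1) :
    Cardinal.{max u v} :=
  Module.rank k (E.restrict (D.sub_subset x s hs hs1)).H0

/-- The multiradius of convergence of `(ℰ, ∇)` at `x`. Indices start at `0`, so that the entry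
with index `i` is the supremum of the `s ∈ (0, 1)` with `dim H⁰(D(x, s⁻), (ℰ, ∇)) ≥ r - i`. -/
def multiradius (E : DiffEq.{u, v} D) (x : D.pts) (i : Fin E.rank) : ℝ :=
  sSup {s : ℝ | ∃ (hs : 0 < s) (hs1 : s < 1),
    ((E.rank - (i : ℕ) : ℕ) : Cardinal) ≤ E.dimH0 x s hs hs1.le}

end DiffEq

/-! ### Morphisms of open discs and pushforward -/

/-- A morphism of open discs: a map on rational points which pulls analytic functions back to
analytic functions. -/
structure Morphism (D₂ D₁ : OpenDisc k) where
  toFun : D₂.pts → D₁.pts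
  comp_analytic : ∀ g : D₁.Fun, D₂.IsAnalytic (fun z => g.1 (toFun z))

namespace Morphism

variable {D₂ D₁ : OpenDisc k} (φ : Morphism D₂ D₁)

/-- The pullback `φ^* : 𝒪(D₁) → 𝒪(D₂)`. -/
def pullback : D₁.Fun →ₐ[k] D₂.Fun where
  toFun g := ⟨fun z => g.1 (φ.toFun z), φ.comp_analytic g⟩
  map_one' := rfl
  map_mul' _ _ := rfl
  map_zero' := rfl
  map_add' _ _ := rfl
  commutes' _ := rfl

/-- `φ` is finite étale: it makes `𝒪(D₂)` a finite étale algebra over `𝒪(D₁)`. -/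
structure IsFiniteEtale : Prop where
  finite : φ.pullback.toRingHom.Finite
  etale : φ.pullback.toRingHom.Etale

/-- The derivative `φ'` of `φ` with respect to the coordinates of `D₂` and `D₁`. -/
def deriv : D₂.Fun := D₂.d (φ.pullback D₁.coord)

lemma chain_rule (g : D₁.Fun) : D₂.d (φ.pullback g) = φ.pullback (D₁.d g) * φ.deriv := by
  refine Subtype.ext (funext fun z => ?_)
  have h1 := D₂.hasDerivAt (φ.pullback D₁.coord) z
  have e : D₂.ext (φ.pullback D₁.coord).1 z = φ.toFun z := D₂.ext_apply _ z
  have h2 := D₁.hasDerivAt g (φ.toFun z)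
  rw [← e] at h2
  have h3 := h2.comp (z : k) h1
  have h4 : D₂.ext (φ.pullback g).1 =ᶠ[nhds (z : k)]
      D₁.ext g.1 ∘ D₂.ext (φ.pullback D₁.coord).1 := by
    filter_upwards [Metric.isOpen_ball.mem_nhds z.2] with w hw
    have e1 := D₂.ext_apply (φ.pullback g).1 ⟨w, hw⟩
    have e2 : D₂.ext (φ.pullback D₁.coord).1 w = φ.toFun ⟨w, hw⟩ := D₂.ext_apply _ ⟨w, hw⟩
    refine e1.trans ?_
    rw [Function.comp, e2, D₁.ext_apply]
    rfl
  exact (h3.congr_of_eventuallyEq h4).deriv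

/-- If `φ` is étale, then `φ^* Ω¹ → Ω¹` is an isomorphism, i.e. `φ'` is a unit. -/
lemma IsFiniteEtale.isUnit_deriv {φ : Morphism D₂ D₁} (hφ : φ.IsFiniteEtale) :
    IsUnit φ.deriv := by
  let _ : Algebra D₁.Fun D₂.Fun := φ.pullback.toRingHom.toAlgebra
  have : Algebra.Etale D₁.Fun D₂.Fun := hφ.etale
  refine isUnit_of_formallyUnramified (A := D₁.Fun) (D₂.d : D₂.Fun →+ D₂.Fun) D₂.d.leibniz
    φ.deriv D₂.coord (fun a => ?_) D₂.d_coord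
  have h : D₂.d (φ.pullback a) = φ.pullback (D₁.d a) * φ.deriv := φ.chain_rule a
  exact Ideal.mem_span_singleton'.mpr ⟨_, h.symm⟩

/-- The pushforward `φ_*(ℰ, ∇)` along a finite étale morphism: the sections of `ℰ` on `D₂`, viewed
as an `𝒪(D₁)`-module. In terms of the coordinate `S` of `D₁` the connection is
`∇_{d/dS} = φ'⁻¹ ∇_{d/dT}`, since `dS = φ' dT`. -/
def pushforward (hφ : φ.IsFiniteEtale) (E : DiffEq.{u, v} D₂) : DiffEq.{u, v} D₁ :=
  letI : Module D₁.Fun E.carrier := Module.compHom E.carrier φ.pullback.toRingHom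
  { carrier := E.carrier
    finite := by
      let _ : Algebra D₁.Fun D₂.Fun := φ.pullback.toRingHom.toAlgebra
      have : IsScalarTower D₁.Fun D₂.Fun E.carrier := ⟨fun a b c => mul_smul _ _ _⟩
      have : Module.Finite D₁.Fun D₂.Fun := hφ.finite
      exact Module.Finite.trans D₂.Fun E.carrier
    projective := by
      let _ : Algebra D₁.Fun D₂.Fun := φ.pullback.toRingHom.toAlgebra
      have : IsScalarTower D₁.Fun D₂.Fun E.carrier := ⟨fun a b c => mul_smul _ _ _⟩
      have : Module.Finite D₁.Fun D₂.Fun := hφ.finite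
      have : Algebra.Etale D₁.Fun D₂.Fun := hφ.etale
      have : Module.FinitePresentation D₁.Fun D₂.Fun :=
        Module.FinitePresentation.of_finite_of_finitePresentation _ _
      have : Module.Projective D₁.Fun D₂.Fun := Module.Flat.projective_of_finitePresentation
      exact projective_trans D₁.Fun D₂.Fun E.carrier
    conn := AddMonoidHom.mk' (fun e => (↑hφ.isUnit_deriv.unit⁻¹ : D₂.Fun) • E.conn e)
      (fun a b => by rw [map_add, smul_add])
    leibniz := fun g e => by
      change (↑hφ.isUnit_deriv.unit⁻¹ : D₂.Fun) • E.conn (φ.pullback g • e) =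
        φ.pullback (D₁.d g) • e +
          φ.pullback g • ((↑hφ.isUnit_deriv.unit⁻¹ : D₂.Fun) • E.conn e)
      rw [E.leibniz, chain_rule, smul_add, smul_smul, smul_smul, smul_smul,
        mul_comm (φ.pullback (D₁.d g)), ← mul_assoc, IsUnit.val_inv_mul, one_mul,
        mul_comm (φ.pullback g)] }

end Morphism

end Equations

/-! ### Berkovich points, the function `N`, and the profile -/

section Geometry

variable {k : Type u} [NontriviallyNormedField k] [IsUltrametricDist k] [CompleteSpace k]
  [IsAlgClosed k]

/-- A point of the Berkovich open disc `D`: a multiplicative seminorm on `𝒪(D)` which extends the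
norm of `k` and is bounded by the supremum norm of a closed disc of radius smaller than that
of `D`. -/
structure BerkPoint (D : OpenDisc k) extends MulRingSeminorm D.Fun where
  map_const : ∀ c : k, toFun (algebraMap k D.Fun c) = ‖c‖
  bounded : ∃ t < D.radius, ∀ (g : D.Fun) (C : ℝ),
    (∀ z : D.pts, ‖(z : k) - D.center‖ ≤ t → ‖g.1 z‖ ≤ C) → toFun g ≤ C

/-- The Berkovich topology: the coarsest one for which `x ↦ |g|ₓ` is continuous for all
`g ∈ 𝒪(D)`. -/
instance BerkPoint.topologicalSpace (D : OpenDisc k) : TopologicalSpace (BerkPoint D) :=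
  TopologicalSpace.induced (fun x (g : D.Fun) => x.toFun g) inferInstance

/-- The function `T - a` on `D`. -/
def OpenDisc.coordSub (D : OpenDisc k) (a : k) : D.Fun := D.coord - algebraMap k D.Fun a

/-- The seminorm `|·|_{z_t}` on `𝒪(D)` at the Shilov point `z_t` of the closed disc `D(z, t)`
(`t` normalised, `0 ≤ t < 1`), i.e. the supremum norm on that disc. -/
def OpenDisc.shilov (D : OpenDisc k) (z : D.pts) (t : ℝ) (g : D.Fun) : ℝ :=
  ⨆ w : {w : D.pts // ‖(w : k) - z‖ ≤ t * D.radius}, ‖g.1 w.1‖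

/-- The normalised radius `inf_{a ∈ k} |T - a|` of a seminorm on `𝒪(D)`. -/
def OpenDisc.radiusOf (D : OpenDisc k) (x : D.Fun → ℝ) : ℝ :=
  (⨅ a : k, x (D.coordSub a)) / D.radius

namespace Morphism

variable {D₂ D₁ : OpenDisc k} (φ : Morphism D₂ D₁)

/-- The preimage under `φ` of the open disc `D(x, s⁻)` (`s` normalised), as a subset of the
Berkovich open disc `D₂`: the set of the `y` with `|T - x|_{φ(y)} = |φ^*(T - x)|_y < s · ρ₁`. -/
def preimageDisc (x : D₁.pts) (s : ℝ) : Set (BerkPoint D₂) :=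
  {y | y.toFun (φ.pullback (D₁.coordSub x)) < s * D₁.radius}

/-- `N_{φ,x}(s)`: the number of connected components of `φ⁻¹(D(x, s⁻))`. -/
def N (x : D₁.pts) (s : ℝ) : ℕ := Nat.card (ConnectedComponents (φ.preimageDisc x s))

/-- `f_{φ,z}(t) = r(φ(z_t))` for `t < 1`, extended by `f_{φ,z}(1) = 1`. -/
def profileAt (z : D₂.pts) (t : ℝ) : ℝ :=
  if t < 1 then D₁.radiusOf (fun g => D₂.shilov z t (φ.pullback g)) else 1

/-- `φ` is radial with profile function `f : [0, 1] → [0, 1]`. -/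
def IsRadialWithProfile (f : ℝ → ℝ) : Prop :=
  ∀ z : D₂.pts, Set.EqOn (φ.profileAt z) f (Set.Icc 0 1)

end Morphism

/-- `0 = s₀ < s₁ < ⋯ < sₙ = 1` are the breaks of the function `N` on `(0, 1]`: its points of
discontinuity in `(0, 1)` together with the boundary points `0` and `1`. -/
def IsBreakSequence (N : ℝ → ℕ) (n : ℕ) (s : ℕ → ℝ) : Prop :=
  StrictMonoOn s (Set.Iic n) ∧ s 0 = 0 ∧ s n = 1 ∧
    s '' Set.Iic n = {0, 1} ∪ {t | t ∈ Set.Ioo (0 : ℝ) 1 ∧ ¬ ContinuousAt N t}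

/-- The family `(s₁, …, s₁, …, s_m, …, s_m, b, …, b)`, where `s_j` appears `N(s_j) - N(s_{j+1})`
times for `1 ≤ j ≤ m`, and `b` appears `N(s_{m+1})` times. -/
def breakFamily (N : ℝ → ℕ) (s : ℕ → ℝ) (m : ℕ) (b : ℝ) : Multiset ℝ :=
  (∑ j ∈ Finset.Icc 1 m, Multiset.replicate (N (s j) - N (s (j + 1))) (s j)) +
    Multiset.replicate (N (s (m + 1))) b

end Geometry

end PadicDisc

/-!
Multiradii are read off from the dimensions of the spaces of horizontal sections, and those of the
pushforward are computed by decomposing the preimages of the discs around `x`.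

*Geometry of the morphism.* A finite étale morphism has finite reduced fibres, so that
`φ^*(T - x)` is a unit times the product of the `T - y` over the points `y` of the fibre
(`Morphism.IsFiniteEtale.exists_factorization`), and units on a disc have constant absolute value.
Hence the profile function is `t ↦ ∏ max(t, |y - y'|)` up to normalisation, the product being over
the fibre; it is a continuous increasing bijection of `[0, 1]`
(`Morphism.IsFiniteEtale.profile_eqOn`). The same formula shows that the preimage of the disc with
centre `x` and radius `f(σ)` is the union of the discs of radius `σ` around the points of the fibre.
A Berkovich disc is connected because the Shilov points of closed discs are dense in it, and those
lie on paths that join each of them to its Shilov points of larger radius. So `N_x(f(σ))` counts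
the distinct discs of radius `σ` around the fibre (`Morphism.IsFiniteEtale.N_eq`). In particular
`N_x` is non-increasing and continuous from the left, and jumps only at the values of `f` at the
distances between points of the fibre.

*Horizontal sections.* If `σ` is none of these distances, the discs `V_y` of radius `σ` are at
distance larger than `σ` from each other (`Morphism.Splits`). Write `U` for the disc of which they
form the preimage. Then `𝒪(U) ⊗ 𝒪(D₂)` is the product of the `𝒪(V_y)`
(`Morphism.Splits.Compatible.mult_injective`, `Morphism.Splits.Compatible.exists_mult_eq_single`):
elements are determined by their values on the fibres through Lagrange interpolation, which also
shows that the image is closed, and the characteristic function of each `V_y` is a limit of rational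
functions without poles in the preimage of `U`. Since `φ_*ℰ` on `U` is `𝒪(U) ⊗ ℰ`, the dimension of
`H⁰(U, φ_*(ℰ, ∇))` is the sum of the dimensions of the `H⁰(V_y, (ℰ, ∇))`
(`Morphism.Splits.dimH0_pushforward`).

*Multiradii.* A horizontal section is determined by its value at a point
(`DiffEq.eq_zero_of_mem_H0`), so dimensions are at most the rank and decrease with the radius; by
the convergence of formal solutions they equal the rank on small discs
(`DiffEq.exists_rank_le_dimH0`). Therefore the dimension at radius `s` is the number of entries of
the multiradius larger than `s`, for all but finitely many `s` (`DiffEq.dimH0_eq`). So the multiradius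
of `φ_*(ℰ, ∇)` at `x` has `N_x(s) · #{i | s < f(R_i)}` entries larger than `s`, and summation by
parts shows that this is also true of the union of the families `F_i`
(`IsBreakSequence.countP_breakFamily`). A finite family of numbers is determined by these counts
(`multiset_eq_of_countP`).
-/

set_option linter.unusedSectionVars false

namespace PadicDisc

/-! ### Polynomials on discs over an algebraically closed field -/

section Polynomials

open Polynomial Filter Topology

variable {k : Type u} [NontriviallyNormedField k]

lemma exists_norm_mem_Ioo [IsAlgClosed k] {a b : ℝ} (ha : 0 ≤ a) (hab : a < b) :
    ∃ u : k, a < ‖u‖ ∧ ‖u‖ < b := by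
  rcases ha.eq_or_lt with rfl | ha
  · exact NormedField.exists_norm_lt k hab
  obtain ⟨c, hc⟩ := NormedField.exists_one_lt_norm k
  obtain ⟨n, hn⟩ := pow_unbounded_of_one_lt ‖c‖ ((one_lt_div ha).mpr hab)
  have hn0 : n ≠ 0 := by
    rintro rfl
    simp at hn
    linarith
  obtain ⟨v, hv⟩ := IsAlgClosed.exists_pow_nat_eq c (Nat.pos_of_ne_zero hn0)
  have hvn : ‖v‖ ^ n = ‖c‖ := by rw [← norm_pow, hv]
  have hv1 : 1 < ‖v‖ := by
    by_contra hle
    have := pow_le_one₀ (norm_nonneg v) (not_lt.mp hle) (n := n)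
    linarith
  have hv2 : ‖v‖ < b / a := by
    rw [← hvn] at hn
    exact lt_of_pow_lt_pow_left₀ n (div_nonneg (ha.le.trans hab.le) ha.le) hn
  -- the largest power of `v` of norm at most `a` is followed by one in `(a, b)`
  obtain ⟨m, hm1, hm2⟩ := exists_mem_Ico_zpow ha hv1
  refine ⟨v ^ (m + 1), ?_, ?_⟩
  · rwa [norm_zpow]
  · rw [norm_zpow, zpow_add_one₀ (zero_lt_one.trans hv1).ne']
    calc ‖v‖ ^ m * ‖v‖ ≤ a * ‖v‖ := by gcongr
      _ < a * (b / a) := by gcongr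
      _ = b := by field_simp

/-- A point of an annulus around `z` which is generic with respect to finitely many given points:
its distance to each of them is the largest possible. -/
lemma exists_generic [IsAlgClosed k] [IsUltrametricDist k] (z : k) (S : Finset k) {a b : ℝ}
    (ha : 0 ≤ a) (hab : a < b) :
    ∃ w : k, a < ‖w - z‖ ∧ ‖w - z‖ < b ∧ ∀ c ∈ S, ‖w - c‖ = max ‖w - z‖ ‖z - c‖ := by
  classical
  -- shrink the interval until it avoids the finitely many distances `‖z - c‖`
  have key : ∃ a', a ≤ a' ∧ a' < b ∧ ∀ c ∈ S, ‖z - c‖ ≤ a' ∨ b ≤ ‖z - c‖ := by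
    induction S using Finset.induction_on with
    | empty => exact ⟨a, le_rfl, hab, by simp⟩
    | insert c S _ ih =>
      obtain ⟨a', h1, h2, h3⟩ := ih
      by_cases h : ‖z - c‖ < b
      · refine ⟨max a' ‖z - c‖, h1.trans (le_max_left _ _), max_lt h2 h, ?_⟩
        intro d hd
        rcases Finset.mem_insert.mp hd with rfl | hd
        · exact Or.inl (le_max_right _ _)
        · exact (h3 d hd).imp_left fun h => h.trans (le_max_left _ _)
      · refine ⟨a', h1, h2, fun d hd => ?_⟩
        rcases Finset.mem_insert.mp hd with rfl | hd
        · exact Or.inr (not_lt.mp h)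
        · exact h3 d hd
  obtain ⟨a', h1, h2, h3⟩ := key
  obtain ⟨u, hu1, hu2⟩ := exists_norm_mem_Ioo (k := k) (ha.trans h1) h2
  refine ⟨z + u, by simpa using h1.trans_lt hu1, by simpa using hu2, fun c hc => ?_⟩
  have hne : ‖u‖ ≠ ‖z - c‖ := by
    rcases h3 c hc with h | h
    · exact (h.trans_lt hu1).ne'
    · exact (hu2.trans_le h).ne
  have := IsUltrametricDist.norm_add_eq_max_of_norm_ne_norm hne
  have e : z + u - c = u + (z - c) := by ring
  rw [e, this]
  simp

/-- The supremum norm of a polynomial on a disc with centre `z` and radius `τ`, as it is read off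
from the roots. -/
def rootNorm (z : k) (τ : ℝ) (P : k[X]) : ℝ :=
  ‖P.leadingCoeff‖ * (P.roots.map fun a => max τ ‖z - a‖).prod

lemma rootNorm_nonneg {z : k} {τ : ℝ} (hτ : 0 ≤ τ) (P : k[X]) : 0 ≤ rootNorm z τ P :=
  mul_nonneg (norm_nonneg _) (Multiset.prod_nonneg fun b hb => by
    obtain ⟨a, -, rfl⟩ := Multiset.mem_map.mp hb
    exact hτ.trans (le_max_left _ _))

lemma continuous_rootNorm (z : k) (P : k[X]) : Continuous fun τ => rootNorm z τ P := by
  have : ∀ s : Multiset k, Continuous fun τ : ℝ => (s.map fun a => max τ ‖z - a‖).prod := by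
    intro s
    induction s using Multiset.induction_on with
    | empty => simpa using continuous_const
    | cons a s ih =>
      simp only [Multiset.map_cons, Multiset.prod_cons]
      exact (continuous_id.max continuous_const).mul ih
  exact continuous_const.mul (this _)

lemma norm_eval_eq [IsAlgClosed k] (P : k[X]) (w : k) :
    ‖P.eval w‖ = ‖P.leadingCoeff‖ * (P.roots.map fun a => ‖w - a‖).prod := by
  rw [(IsAlgClosed.splits P).eval_eq_prod_roots, norm_mul]
  congr 1
  induction P.roots using Multiset.induction_on with
  | empty => simp
  | cons a s ih => simp [ih]

lemma multiset_prod_map_le {α : Type*} {s : Multiset α} {f g : α → ℝ} (hf : ∀ a, 0 ≤ f a)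
    (hfg : ∀ a, f a ≤ g a) : (s.map f).prod ≤ (s.map g).prod := by
  induction s using Multiset.induction_on with
  | empty => simp
  | cons a s ih =>
    simp only [Multiset.map_cons, Multiset.prod_cons]
    refine mul_le_mul (hfg a) ih ?_ ((hf a).trans (hfg a))
    exact Multiset.prod_nonneg fun b hb => by
      obtain ⟨a, -, rfl⟩ := Multiset.mem_map.mp hb
      exact hf a

lemma norm_eval_le_rootNorm [IsAlgClosed k] [IsUltrametricDist k] (P : k[X]) {z w : k} {τ : ℝ}
    (h : ‖w - z‖ ≤ τ) : ‖P.eval w‖ ≤ rootNorm z τ P := by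
  rw [norm_eval_eq, rootNorm]
  refine mul_le_mul_of_nonneg_left (multiset_prod_map_le (fun a => norm_nonneg _) fun a => ?_)
    (norm_nonneg _)
  have e : w - a = (w - z) + (z - a) := by ring
  rw [e]
  exact (IsUltrametricDist.norm_add_le_max _ _).trans (max_le_max_right _ h)

lemma norm_eval_eq_rootNorm [IsAlgClosed k] {P : k[X]} {z w : k}
    (h : ∀ a ∈ P.roots, ‖w - a‖ = max ‖w - z‖ ‖z - a‖) : ‖P.eval w‖ = rootNorm z ‖w - z‖ P := by
  rw [norm_eval_eq, rootNorm, Multiset.map_congr rfl h]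

/-- The maximum principle for several polynomials at once: on a disc of positive radius there are
points at which all of them are as close to their norm as desired. -/
lemma exists_norm_eval_gt [IsAlgClosed k] [IsUltrametricDist k] (z : k) (T : Finset k[X]) {τ ε : ℝ}
    (hτ : 0 < τ) (hε : 0 < ε) :
    ∃ w : k, ‖w - z‖ < τ ∧ ∀ P ∈ T, rootNorm z τ P - ε < ‖P.eval w‖ := by
  classical
  have h1 : ∀ P ∈ T, ∀ᶠ t in 𝓝 τ, rootNorm z τ P - ε < rootNorm z t P := fun P _ =>
    (continuous_rootNorm z P).continuousAt.eventually_const_lt (by linarith)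
  have h2 := (Filter.eventually_all_finset T).mpr h1
  obtain ⟨δ, hδ, h3⟩ := Metric.eventually_nhds_iff.mp h2
  obtain ⟨w, hw1, hw2, hw3⟩ := exists_generic z (T.biUnion fun P => P.roots.toFinset)
    (le_max_left 0 (τ - δ)) (max_lt hτ (by linarith : τ - δ < τ))
  refine ⟨w, hw2, fun P hP => ?_⟩
  rw [norm_eval_eq_rootNorm (z := z)]
  · refine h3 ?_ P hP
    rw [Real.dist_eq, abs_lt]
    have := (le_max_right 0 (τ - δ)).trans_lt hw1
    constructor <;> linarith
  · intro a ha
    exact hw3 a (Finset.mem_biUnion.mpr ⟨P, hP, Multiset.mem_toFinset.mpr ha⟩)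

lemma rootNorm_le [IsAlgClosed k] [IsUltrametricDist k] {z : k} {P : k[X]} {τ C : ℝ}
    (hτ : 0 < τ) (h : ∀ w, ‖w - z‖ < τ → ‖P.eval w‖ ≤ C) : rootNorm z τ P ≤ C := by
  refine le_of_forall_pos_le_add fun ε hε => ?_
  obtain ⟨w, hw, hw'⟩ := exists_norm_eval_gt z {P} hτ hε
  have := hw' P (Finset.mem_singleton_self P)
  linarith [h w hw]

lemma norm_coeff_prod_le [IsUltrametricDist k] (s : Multiset k) {τ : ℝ} (hτ : 0 ≤ τ) (n : ℕ) :
    ‖(s.map fun a => X - C a).prod.coeff n‖ * τ ^ n ≤ (s.map fun a => max τ ‖a‖).prod := by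
  induction s using Multiset.induction_on generalizing n with
  | empty =>
    simp only [Multiset.map_zero, Multiset.prod_zero, coeff_one]
    by_cases h : n = 0 <;> simp [h]
  | cons a s ih =>
    simp only [Multiset.map_cons, Multiset.prod_cons]
    set Q := (s.map fun a => X - C a).prod
    set G := (s.map fun a => max τ ‖a‖).prod
    have hG : 0 ≤ G := Multiset.prod_nonneg fun b hb => by
      obtain ⟨a, -, rfl⟩ := Multiset.mem_map.mp hb
      exact hτ.trans (le_max_left _ _)
    have h2 : ∀ m, ‖a * Q.coeff m‖ * τ ^ m ≤ max τ ‖a‖ * G := fun m => by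
      rw [norm_mul, mul_assoc]
      exact mul_le_mul (le_max_right _ _) (ih m) (by positivity) (hτ.trans (le_max_left _ _))
    cases n with
    | zero =>
      have e : ((X - C a) * Q).coeff 0 = -(a * Q.coeff 0) := by simp [sub_mul]
      rw [e, norm_neg]
      exact h2 0
    | succ n =>
      have e : ((X - C a) * Q).coeff (n + 1) = Q.coeff n - a * Q.coeff (n + 1) := by
        simp [sub_mul, coeff_X_mul]
      have h1 : ‖Q.coeff n‖ * τ ^ (n + 1) ≤ max τ ‖a‖ * G := by
        rw [pow_succ', mul_left_comm]
        exact mul_le_mul (le_max_left _ _) (ih n) (by positivity) (hτ.trans (le_max_left _ _))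
      rw [e, sub_eq_add_neg]
      refine (mul_le_mul_of_nonneg_right (IsUltrametricDist.norm_add_le_max _ _)
        (by positivity)).trans ?_
      rw [norm_neg, max_mul_of_nonneg _ _ (by positivity)]
      exact max_le h1 (h2 _)

/-- Cauchy's estimate for the Taylor coefficients of a polynomial. -/
lemma norm_taylor_coeff_le [IsAlgClosed k] [IsUltrametricDist k] (P : k[X]) (z : k) {τ : ℝ}
    (hτ : 0 ≤ τ) (n : ℕ) : ‖(taylor z P).coeff n‖ * τ ^ n ≤ rootNorm z τ P := by
  have e : taylor z P = C P.leadingCoeff * ((P.roots.map fun a => a - z).map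
      fun a => X - C a).prod := by
    conv_lhs => rw [(IsAlgClosed.splits P).eq_prod_roots]
    rw [taylor_mul, taylor_C]
    congr 1
    rw [← taylorAlgHom_apply, map_multiset_prod, Multiset.map_map, Multiset.map_map]
    congr 1
    refine Multiset.map_congr rfl fun a _ => ?_
    simp [taylor_X, taylor_C]
    ring
  rw [e, coeff_C_mul, norm_mul, mul_assoc, rootNorm]
  refine mul_le_mul_of_nonneg_left ((norm_coeff_prod_le _ hτ n).trans_eq ?_) (norm_nonneg _)
  rw [Multiset.map_map]
  congr 1
  refine Multiset.map_congr rfl fun a _ => ?_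
  simp [norm_sub_rev]

end Polynomials

/-! ### Analytic functions as limits of polynomials -/

section Analytic

open Polynomial Filter Topology

variable {k : Type u} [NontriviallyNormedField k] [IsUltrametricDist k] [CompleteSpace k]

namespace OpenDisc

variable {D : OpenDisc k}

lemma norm_sub_lt (z w : D.pts) : ‖(w : k) - z‖ < D.radius := (mem_pts_iff z (w : k)).mp w.2

lemma nonempty_pts (D : OpenDisc k) : Nonempty D.pts :=
  ⟨⟨D.center, Metric.mem_ball_self D.radius_pos⟩⟩

lemma norm_sub_le_max_of_le {a b c : k} {τ : ℝ} (h : ‖a - b‖ ≤ τ) : ‖a - c‖ ≤ max τ ‖b - c‖ := by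
  have e : a - c = (a - b) + (b - c) := by ring
  rw [e]
  exact (IsUltrametricDist.norm_add_le_max _ _).trans (max_le_max_right _ h)

lemma exists_poly_of_hasSum [IsAlgClosed k] {F : D.pts → k} {z : D.pts} {a : ℕ → k}
    (ha : ∀ w : D.pts, HasSum (fun n => a n * ((w : k) - z) ^ n) (F w)) {τ : ℝ}
    (hτ : τ < D.radius) {ε : ℝ} (hε : 0 < ε) :
    ∃ P : k[X], ∀ w : D.pts, ‖(w : k) - z‖ ≤ τ → ‖F w - P.eval (w : k)‖ ≤ ε := by
  obtain ⟨u, hu, hu'⟩ := exists_norm_mem_Ioo (k := k) (le_max_left 0 τ) (max_lt D.radius_pos hτ)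
  have hzu : (z : k) + u ∈ D.pts := by
    rw [mem_pts_iff z]
    simpa using hu'
  have h0 := (ha ⟨_, hzu⟩).summable.tendsto_atTop_zero
  obtain ⟨N, hN⟩ := Metric.tendsto_atTop.mp h0 ε hε
  refine ⟨∑ n ∈ Finset.range N, C (a n) * (X - C (z : k)) ^ n, fun w hw => ?_⟩
  have h1 : F w - (∑ n ∈ Finset.range N, C (a n) * (X - C (z : k)) ^ n).eval (w : k) =
      ∑' n, a (n + N) * ((w : k) - z) ^ (n + N) := by
    rw [← (ha w).tsum_eq, ← (ha w).summable.sum_add_tsum_nat_add N, eval_finsetSum]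
    simp
  rw [h1]
  refine IsUltrametricDist.norm_tsum_le_of_forall_le_of_nonneg hε.le fun n => ?_
  have h2 := hN (n + N) (Nat.le_add_left _ _)
  rw [dist_zero_right, add_sub_cancel_left, norm_mul, norm_pow] at h2
  rw [norm_mul, norm_pow]
  refine le_trans ?_ h2.le
  have : ‖(w : k) - z‖ ≤ ‖u‖ := hw.trans ((le_max_right _ _).trans hu.le)
  gcongr

/-- A function on a disc is analytic as soon as it can be approximated by polynomials, uniformly on
every smaller closed disc around one fixed centre. -/
lemma isAnalytic_of_approx [IsAlgClosed k] {F : D.pts → k} (z₀ : D.pts)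
    (h : ∀ τ < D.radius, ∀ ε > 0, ∃ P : k[X], ∀ w : D.pts, ‖(w : k) - z₀‖ ≤ τ →
      ‖F w - P.eval (w : k)‖ ≤ ε) : D.IsAnalytic F := by
  intro z
  have hρ := D.radius_pos
  have hrad : ∀ M : ℕ, max (D.radius - D.radius / (M + 1)) ‖(z : k) - z₀‖ < D.radius := fun M =>
    max_lt (by have : 0 < D.radius / ((M : ℝ) + 1) := by positivity
               linarith) (norm_sub_lt _ _)
  choose P hP using fun M : ℕ => h _ (hrad M) (1 / ((M : ℝ) + 1)) Nat.one_div_pos_of_nat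
  have hP' : ∀ (M : ℕ) (w : D.pts), ‖(w : k) - z‖ ≤ D.radius - D.radius / (M + 1) →
      ‖F w - (P M).eval (w : k)‖ ≤ 1 / ((M : ℝ) + 1) := fun M w hw =>
    hP M w (norm_sub_le_max_of_le hw)
  -- on each smaller disc the sequence `P M` is uniformly convergent
  have hlim : ∀ τ < D.radius, ∀ ε > 0, ∃ M₀ : ℕ, ∀ M ≥ M₀, ∀ w : D.pts, ‖(w : k) - z‖ ≤ τ →
      ‖F w - (P M).eval (w : k)‖ ≤ ε := by
    intro τ hτ ε hε
    have t0 := tendsto_one_div_add_atTop_nhds_zero_nat (𝕜 := ℝ)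
    have t1 := t0.const_mul D.radius
    rw [mul_zero] at t1
    have e1 := t1.eventually_lt_const (sub_pos.mpr hτ)
    have e0 := t0.eventually_lt_const hε
    obtain ⟨M₀, hM₀⟩ := Filter.eventually_atTop.mp (e1.and e0)
    refine ⟨M₀, fun M hM w hw => (hP' M w ?_).trans (hM₀ M hM).2.le⟩
    have := (hM₀ M hM).1
    rw [mul_one_div] at this
    linarith
  have hcoef : ∀ τ, 0 < τ → τ < D.radius → ∀ ε > 0, ∃ M₀ : ℕ, ∀ M ≥ M₀, ∀ M' ≥ M₀, ∀ n,
      ‖(taylor (z : k) (P M)).coeff n - (taylor (z : k) (P M')).coeff n‖ * τ ^ n ≤ ε := by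
    intro τ hτ0 hτ ε hε
    obtain ⟨M₀, hM₀⟩ := hlim τ hτ ε hε
    refine ⟨M₀, fun M hM M' hM' n => ?_⟩
    rw [← coeff_sub, ← map_sub]
    refine (norm_taylor_coeff_le _ _ hτ0.le n).trans (rootNorm_le hτ0 fun w hw => ?_)
    have hwD : w ∈ D.pts := by
      rw [mem_pts_iff z]
      exact hw.trans hτ
    have e : (P M - P M').eval w = (F ⟨w, hwD⟩ - (P M').eval w) - (F ⟨w, hwD⟩ - (P M).eval w) := by
      rw [eval_sub]
      ring
    rw [e, sub_eq_add_neg]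
    refine (IsUltrametricDist.norm_add_le_max _ _).trans (max_le ?_ ?_)
    · exact hM₀ M' hM' ⟨w, hwD⟩ hw.le
    · rw [norm_neg]
      exact hM₀ M hM ⟨w, hwD⟩ hw.le
  have hcauchy : ∀ n, CauchySeq fun M => (taylor (z : k) (P M)).coeff n := by
    intro n
    rw [Metric.cauchySeq_iff]
    intro ε hε
    have hτ : 0 < D.radius / 2 := by positivity
    obtain ⟨M₀, hM₀⟩ := hcoef (D.radius / 2) hτ (by linarith) (ε / 2 * (D.radius / 2) ^ n)
      (by positivity)
    refine ⟨M₀, fun M hM M' hM' => ?_⟩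
    have := le_of_mul_le_mul_right (hM₀ M hM M' hM' n) (by positivity)
    rw [dist_eq_norm]
    linarith
  choose a ha using fun n => cauchySeq_tendsto_of_complete (hcauchy n)
  have hac : ∀ τ, 0 < τ → τ < D.radius → ∀ ε > 0, ∃ M₀ : ℕ, ∀ M ≥ M₀, ∀ n,
      ‖a n - (taylor (z : k) (P M)).coeff n‖ * τ ^ n ≤ ε := by
    intro τ hτ0 hτ ε hε
    obtain ⟨M₀, hM₀⟩ := hcoef τ hτ0 hτ ε hε
    refine ⟨M₀, fun M hM n => ?_⟩
    refine le_of_tendsto (((ha n).sub_const _).norm.mul_const _)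
      (Filter.eventually_atTop.mpr ⟨M₀, fun M' hM' => hM₀ M' hM' M hM n⟩)
  refine ⟨a, fun w => ?_⟩
  obtain ⟨τ, hτ1, hτ2⟩ := exists_between (norm_sub_lt z w)
  have hτ0 : 0 < τ := (norm_nonneg _).trans_lt hτ1
  have hbd : ∀ ε > 0, ∃ M₀ : ℕ, ∀ M ≥ M₀,
      ∀ n, ‖(a n - (taylor (z : k) (P M)).coeff n) * ((w : k) - z) ^ n‖ ≤ ε := by
    intro ε hε
    obtain ⟨M₀, hM₀⟩ := hac τ hτ0 hτ2 ε hε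
    refine ⟨M₀, fun M hM n => le_trans ?_ (hM₀ M hM n)⟩
    rw [norm_mul, norm_pow]
    gcongr
  have hsum : Summable fun n => a n * ((w : k) - z) ^ n := by
    refine NonarchimedeanAddGroup.summable_of_tendsto_cofinite_zero ?_
    rw [Nat.cofinite_eq_atTop, Metric.tendsto_atTop]
    intro ε hε
    obtain ⟨M₀, hM₀⟩ := hbd (ε / 2) (by positivity)
    refine ⟨(taylor (z : k) (P M₀)).natDegree + 1, fun n hn => ?_⟩
    have := hM₀ M₀ le_rfl n
    rw [coeff_eq_zero_of_natDegree_lt (by omega : _ < n), sub_zero] at this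
    rw [dist_zero_right]
    linarith
  have hpoly : ∀ M, HasSum (fun n => (taylor (z : k) (P M)).coeff n * ((w : k) - z) ^ n)
      ((P M).eval (w : k)) := by
    intro M
    have h1 := hasSum_sum_of_ne_finset_zero (L := .unconditional ℕ)
      (f := fun n => (taylor (z : k) (P M)).coeff n * ((w : k) - z) ^ n)
      (s := Finset.range ((taylor (z : k) (P M)).natDegree + 1)) (fun n hn => by
        rw [Finset.mem_range, not_lt] at hn
        rw [coeff_eq_zero_of_natDegree_lt (by omega), zero_mul])
    rw [← eval_eq_sum_range, taylor_eval, sub_add_cancel] at h1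
    exact h1
  have hval : ∑' n, a n * ((w : k) - z) ^ n = F w := by
    rw [← sub_eq_zero, ← norm_le_zero_iff]
    refine le_of_forall_pos_le_add fun ε hε => ?_
    obtain ⟨M₀, hM₀⟩ := hbd ε hε
    obtain ⟨M₁, hM₁⟩ := hlim τ hτ2 ε hε
    have h1 : ∑' n, a n * ((w : k) - z) ^ n - F w =
        ∑' n, (a n - (taylor (z : k) (P (max M₀ M₁))).coeff n) * ((w : k) - z) ^ n +
          -(F w - (P (max M₀ M₁)).eval (w : k)) := by
      simp only [sub_mul]
      rw [hsum.tsum_sub (hpoly _).summable, (hpoly _).tsum_eq]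
      ring
    rw [h1, zero_add]
    refine (IsUltrametricDist.norm_add_le_max _ _).trans (max_le ?_ ?_)
    · exact IsUltrametricDist.norm_tsum_le_of_forall_le_of_nonneg hε.le
        (hM₀ _ (le_max_left _ _))
    · rw [norm_neg]
      exact hM₁ _ (le_max_right _ _) w hτ1.le
  exact hval ▸ hsum.hasSum

lemma isAnalytic_of_hasSum [IsAlgClosed k] {F : D.pts → k} {z : D.pts} {a : ℕ → k}
    (ha : ∀ w : D.pts, HasSum (fun n => a n * ((w : k) - z) ^ n) (F w)) : D.IsAnalytic F :=
  isAnalytic_of_approx z fun _ hτ _ hε => exists_poly_of_hasSum ha hτ hε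

lemma exists_poly_approx [IsAlgClosed k] {F : D.pts → k} (hF : D.IsAnalytic F) (z : D.pts) {τ : ℝ}
    (hτ : τ < D.radius) {ε : ℝ} (hε : 0 < ε) :
    ∃ P : k[X], ∀ w : D.pts, ‖(w : k) - z‖ ≤ τ → ‖F w - P.eval (w : k)‖ ≤ ε :=
  exists_poly_of_hasSum (hF z).choose_spec hτ hε

/-- A limit of analytic functions, uniform on every smaller closed disc, is analytic. -/
lemma isAnalytic_of_uniform_limit [IsAlgClosed k] {F : D.pts → k} (z : D.pts)
    (h : ∀ τ < D.radius, ∀ ε > 0, ∃ G : D.pts → k, D.IsAnalytic G ∧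
      ∀ w : D.pts, ‖(w : k) - z‖ ≤ τ → ‖F w - G w‖ ≤ ε) : D.IsAnalytic F := by
  refine isAnalytic_of_approx z fun τ hτ ε hε => ?_
  obtain ⟨G, hG, hFG⟩ := h τ hτ ε hε
  obtain ⟨P, hP⟩ := exists_poly_approx hG z hτ hε
  refine ⟨P, fun w hw => ?_⟩
  have e : F w - P.eval (w : k) = (F w - G w) + (G w - P.eval (w : k)) := by ring
  rw [e]
  exact (IsUltrametricDist.norm_add_le_max _ _).trans (max_le (hFG w hw) (hP w hw))

/-! ### Supremum norms -/

/-- The supremum norm on the rational points of the closed disc with centre `z` and (absolute)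
radius `τ`. -/
def supNorm (D : OpenDisc k) (z : D.pts) (τ : ℝ) (g : D.Fun) : ℝ :=
  ⨆ w : {w : D.pts // ‖(w : k) - z‖ ≤ τ}, ‖g.1 w.1‖

lemma shilov_eq_supNorm (z : D.pts) (t : ℝ) (g : D.Fun) :
    D.shilov z t g = D.supNorm z (t * D.radius) g := rfl

@[simp] lemma Fun.add_apply (f g : D.Fun) (w : D.pts) : (f + g).1 w = f.1 w + g.1 w := rfl
@[simp] lemma Fun.sub_apply (f g : D.Fun) (w : D.pts) : (f - g).1 w = f.1 w - g.1 w := rfl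
@[simp] lemma Fun.mul_apply (f g : D.Fun) (w : D.pts) : (f * g).1 w = f.1 w * g.1 w := rfl
@[simp] lemma Fun.zero_apply (w : D.pts) : (0 : D.Fun).1 w = 0 := rfl
@[simp] lemma Fun.one_apply (w : D.pts) : (1 : D.Fun).1 w = 1 := rfl
@[simp] lemma Fun.algebraMap_apply (c : k) (w : D.pts) : (algebraMap k D.Fun c).1 w = c := rfl

lemma coordSub_apply [IsAlgClosed k] (a : k) (w : D.pts) : (D.coordSub a).1 w = w - a := rfl

lemma Fun.ext {f g : D.Fun} (h : ∀ w, f.1 w = g.1 w) : f = g := Subtype.ext (funext h)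

/-- Evaluation at a rational point. -/
def evalHom (z : D.pts) : D.Fun →ₐ[k] k where
  toFun g := g.1 z
  map_one' := rfl
  map_mul' _ _ := rfl
  map_zero' := rfl
  map_add' _ _ := rfl
  commutes' _ := rfl

@[simp] lemma evalHom_apply (z : D.pts) (g : D.Fun) : evalHom z g = g.1 z := rfl

lemma aeval_coord_apply (P : k[X]) (w : D.pts) : (aeval D.coord P).1 w = P.eval (w : k) := by
  change evalHom w (aeval D.coord P) = _
  rw [← aeval_algHom_apply, coe_aeval_eq_eval]
  rfl

section

variable [IsAlgClosed k] {z : D.pts} {τ : ℝ}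

lemma bddAbove_norm (g : D.Fun) (hτ : τ < D.radius) :
    BddAbove (Set.range fun w : {w : D.pts // ‖(w : k) - z‖ ≤ τ} => ‖g.1 w.1‖) := by
  obtain ⟨P, hP⟩ := exists_poly_approx g.2 z hτ one_pos
  refine ⟨max 1 (rootNorm (z : k) τ P), ?_⟩
  rintro _ ⟨⟨w, hw⟩, rfl⟩
  have e : g.1 w = (g.1 w - P.eval (w : k)) + P.eval (w : k) := by ring
  change ‖g.1 w‖ ≤ _
  rw [e]
  exact (IsUltrametricDist.norm_add_le_max _ _).trans
    (max_le_max (hP w hw) (norm_eval_le_rootNorm P hw))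

lemma norm_le_supNorm (g : D.Fun) (hτ : τ < D.radius) {w : D.pts} (hw : ‖(w : k) - z‖ ≤ τ) :
    ‖g.1 w‖ ≤ D.supNorm z τ g :=
  le_ciSup (bddAbove_norm g hτ) (⟨w, hw⟩ : {w : D.pts // ‖(w : k) - z‖ ≤ τ})

lemma supNorm_le {g : D.Fun} (hτ : 0 ≤ τ) {C : ℝ}
    (h : ∀ w : D.pts, ‖(w : k) - z‖ ≤ τ → ‖g.1 w‖ ≤ C) : D.supNorm z τ g ≤ C := by
  have : Nonempty {w : D.pts // ‖(w : k) - z‖ ≤ τ} := ⟨⟨z, by simpa using hτ⟩⟩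
  exact ciSup_le fun w => h w.1 w.2

lemma supNorm_nonneg (g : D.Fun) : 0 ≤ D.supNorm z τ g := Real.iSup_nonneg fun _ => norm_nonneg _

lemma supNorm_mono (g : D.Fun) {τ' : ℝ} (hτ : 0 ≤ τ) (h : τ ≤ τ') (hτ' : τ' < D.radius) :
    D.supNorm z τ g ≤ D.supNorm z τ' g :=
  supNorm_le hτ fun _ hw => norm_le_supNorm g hτ' (hw.trans h)

lemma supNorm_aeval (P : k[X]) (hτ0 : 0 ≤ τ) (hτ : τ < D.radius) :
    D.supNorm z τ (aeval D.coord P) = rootNorm (z : k) τ P := by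
  refine le_antisymm (supNorm_le hτ0 fun w hw => ?_) ?_
  · rw [aeval_coord_apply]
    exact norm_eval_le_rootNorm P hw
  · rcases hτ0.eq_or_lt with rfl | hτ0
    · have h1 : ‖P.eval (z : k)‖ = rootNorm (z : k) ‖(z : k) - z‖ P :=
        norm_eval_eq_rootNorm fun a _ => by simp
      rw [sub_self, norm_zero] at h1
      rw [← h1, ← aeval_coord_apply P z]
      exact norm_le_supNorm _ hτ (by simp)
    · refine rootNorm_le hτ0 fun w hw => ?_
      have hwD : w ∈ D.pts := by
        rw [mem_pts_iff z]
        exact hw.trans hτ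
      have := norm_le_supNorm (aeval D.coord P) hτ (w := ⟨w, hwD⟩) hw.le
      rwa [aeval_coord_apply] at this

lemma supNorm_add_le (f g : D.Fun) (hτ0 : 0 ≤ τ) (hτ : τ < D.radius) :
    D.supNorm z τ (f + g) ≤ max (D.supNorm z τ f) (D.supNorm z τ g) :=
  supNorm_le hτ0 fun _ hw => (IsUltrametricDist.norm_add_le_max _ _).trans
    (max_le_max (norm_le_supNorm f hτ hw) (norm_le_supNorm g hτ hw))

lemma supNorm_le_add {f g : D.Fun} (hτ0 : 0 ≤ τ) (hτ : τ < D.radius) {ε : ℝ}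
    (h : ∀ w : D.pts, ‖(w : k) - z‖ ≤ τ → ‖f.1 w - g.1 w‖ ≤ ε) :
    D.supNorm z τ f ≤ D.supNorm z τ g + ε := by
  refine supNorm_le hτ0 fun w hw => ?_
  have e : f.1 w = g.1 w + (f.1 w - g.1 w) := by ring
  rw [e]
  exact (norm_add_le _ _).trans (add_le_add (norm_le_supNorm g hτ hw) (h w hw))

/-- Two analytic functions come close to their supremum norms at a common point. -/
lemma exists_norm_add_gt (f g : D.Fun) (hτ0 : 0 ≤ τ) (hτ : τ < D.radius) {ε : ℝ} (hε : 0 < ε) :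
    ∃ w : D.pts, ‖(w : k) - z‖ ≤ τ ∧ D.supNorm z τ f ≤ ‖f.1 w‖ + ε ∧
      D.supNorm z τ g ≤ ‖g.1 w‖ + ε := by
  classical
  rcases hτ0.eq_or_lt with rfl | hτp
  · have : ∀ f : D.Fun, D.supNorm z 0 f ≤ ‖f.1 z‖ + ε := fun f => supNorm_le le_rfl fun w hw => by
      have hwz : w = z := Subtype.ext (by simpa [sub_eq_zero] using hw)
      rw [hwz]
      linarith
    exact ⟨z, by simp, this f, this g⟩
  have hε' : 0 < ε / 3 := by positivity
  obtain ⟨P, hP⟩ := exists_poly_approx f.2 z hτ hε'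
  obtain ⟨Q, hQ⟩ := exists_poly_approx g.2 z hτ hε'
  obtain ⟨w, hw, hw'⟩ := exists_norm_eval_gt (z : k) {P, Q} hτp hε'
  have hwD : w ∈ D.pts := by
    rw [mem_pts_iff z]
    exact hw.trans hτ
  have key : ∀ (f : D.Fun) (P : k[X]), (∀ w : D.pts, ‖(w : k) - z‖ ≤ τ →
      ‖f.1 w - P.eval (w : k)‖ ≤ ε / 3) → rootNorm (z : k) τ P - ε / 3 < ‖P.eval w‖ →
      D.supNorm z τ f ≤ ‖f.1 ⟨w, hwD⟩‖ + ε := by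
    intro f P hP hw'
    have h1 := supNorm_le_add (f := f) (g := aeval D.coord P) hτ0 hτ (fun w hw => by
      rw [aeval_coord_apply]
      exact hP w hw)
    rw [supNorm_aeval P hτ0 hτ] at h1
    have h2 := hP ⟨w, hwD⟩ hw.le
    have h3 := norm_sub_norm_le (P.eval w) (f.1 ⟨w, hwD⟩)
    rw [norm_sub_rev] at h3
    change ‖f.1 ⟨w, hwD⟩ - P.eval w‖ ≤ _ at h2
    linarith
  exact ⟨⟨w, hwD⟩, hw.le, key f P hP (hw' P (by simp)), key g Q hQ (hw' Q (by simp))⟩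

/-- The supremum norm of a disc is multiplicative. -/
lemma supNorm_mul (f g : D.Fun) (hτ0 : 0 ≤ τ) (hτ : τ < D.radius) :
    D.supNorm z τ (f * g) = D.supNorm z τ f * D.supNorm z τ g := by
  refine le_antisymm (supNorm_le hτ0 fun w hw => ?_) ?_
  · rw [Fun.mul_apply, norm_mul]
    exact mul_le_mul (norm_le_supNorm f hτ hw) (norm_le_supNorm g hτ hw) (norm_nonneg _)
      (supNorm_nonneg _)
  · set F := D.supNorm z τ f
    set G := D.supNorm z τ g
    set M := D.supNorm z τ (f * g)
    have h1 : ∀ ε > 0, F * G ≤ M + ε * (F + G) + ε * ε := by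
      intro ε hε
      obtain ⟨w, hw, hf, hg⟩ := exists_norm_add_gt f g hτ0 hτ hε
      have h2 := norm_le_supNorm (f * g) hτ hw
      have h3 := norm_le_supNorm f hτ hw
      have h4 := norm_le_supNorm g hτ hw
      rw [Fun.mul_apply, norm_mul] at h2
      have h5 : F * G ≤ (‖f.1 w‖ + ε) * (‖g.1 w‖ + ε) :=
        mul_le_mul hf hg (supNorm_nonneg _) (by positivity)
      have h6 : ε * ‖f.1 w‖ ≤ ε * F := mul_le_mul_of_nonneg_left h3 hε.le
      have h7 : ε * ‖g.1 w‖ ≤ ε * G := mul_le_mul_of_nonneg_left h4 hε.le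
      change ‖f.1 w‖ * ‖g.1 w‖ ≤ M at h2
      nlinarith
    have h2 : Tendsto (fun ε : ℝ => M + ε * (F + G) + ε * ε) (𝓝[>] 0) (𝓝 M) := by
      have : Continuous fun ε : ℝ => M + ε * (F + G) + ε * ε := by fun_prop
      have h := this.tendsto 0
      simp only [zero_mul, add_zero] at h
      exact h.mono_left nhdsWithin_le_nhds
    exact ge_of_tendsto h2 (eventually_nhdsWithin_of_forall h1)

lemma supNorm_algebraMap (c : k) (hτ0 : 0 ≤ τ) : D.supNorm z τ (algebraMap k D.Fun c) = ‖c‖ := by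
  have : Nonempty {w : D.pts // ‖(w : k) - z‖ ≤ τ} := ⟨⟨z, by simpa using hτ0⟩⟩
  exact ciSup_const (ι := {w : D.pts // ‖(w : k) - z‖ ≤ τ}) (a := ‖c‖)

lemma continuousOn_supNorm (z : D.pts) (g : D.Fun) :
    ContinuousOn (fun τ => D.supNorm z τ g) (Set.Ico 0 D.radius) := by
  intro τ hτ
  obtain ⟨τ', h1, h2⟩ := exists_between hτ.2
  -- locally the function is a uniform limit of the functions of polynomials
  refine (continuousWithinAt_of_locally_uniform_approx_of_continuousWithinAt hτ fun U hU => ?_)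
  obtain ⟨ε, hε, hU⟩ := Metric.mem_uniformity_dist.mp hU
  obtain ⟨P, hP⟩ := exists_poly_approx g.2 z h2 (half_pos hε)
  refine ⟨Set.Ico 0 D.radius ∩ Set.Iio τ', inter_mem_nhdsWithin _ (Iio_mem_nhds h1),
    fun t => rootNorm (z : k) t P, (continuous_rootNorm _ _).continuousWithinAt, fun t ht => hU ?_⟩
  have ht0 := ht.1.1
  have ht1 := ht.1.2
  have e := supNorm_aeval (z := z) P ht0 ht1
  have hP' : ∀ w : D.pts, ‖(w : k) - z‖ ≤ t → ‖g.1 w - (aeval D.coord P).1 w‖ ≤ ε / 2 :=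
    fun w hw => by
      rw [aeval_coord_apply]
      exact hP w (hw.trans (le_of_lt ht.2))
  have a1 := supNorm_le_add ht0 ht1 hP'
  have a2 := supNorm_le_add ht0 ht1 (fun w hw => by
    rw [norm_sub_rev]
    exact hP' w hw)
  rw [Real.dist_eq, abs_lt]
  constructor <;> linarith

end

end OpenDisc

end Analytic

/-! ### Units and zeros of analytic functions -/

section Units

open Polynomial Filter Topology

variable {k : Type u} [NontriviallyNormedField k] [IsUltrametricDist k] [CompleteSpace k]
  [IsAlgClosed k]

namespace OpenDisc

variable {D : OpenDisc k}

lemma exists_eq_add_coordSub_mul (g : D.Fun) (z : D.pts) :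
    ∃ q : D.Fun, g = algebraMap k D.Fun (g.1 z) + D.coordSub z * q := by
  classical
  obtain ⟨a, ha⟩ := g.2 z
  have ha0 : a 0 = g.1 z := by
    have h := ha z
    have h' := hasSum_single (f := fun n => a n * ((z : k) - z) ^ n) 0 (fun n hn => by simp [hn])
    simpa using h'.unique h
  let F : D.pts → k := fun w => if w = z then a 1 else (g.1 w - g.1 z) / ((w : k) - z)
  have hF : ∀ w : D.pts, HasSum (fun n => a (n + 1) * ((w : k) - z) ^ n) (F w) := by
    intro w
    by_cases hw : w = z
    · subst hw
      have h' := hasSum_single (f := fun n => a (n + 1) * ((w : k) - w) ^ n) 0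
        (fun n hn => by simp [hn])
      simpa [F] using h'
    · have hne : (w : k) - z ≠ 0 := sub_ne_zero.mpr fun h => hw (Subtype.ext h)
      have h1 := ((hasSum_nat_add_iff' 1).mpr (ha w)).div_const ((w : k) - z)
      simp only [F, hw, if_false]
      simp only [Finset.sum_range_one, pow_zero, mul_one, ha0] at h1
      refine h1.congr_fun ?_
      intro n
      rw [pow_succ]
      field_simp
  refine ⟨⟨F, isAnalytic_of_hasSum hF⟩, Fun.ext fun w => ?_⟩
  change g.1 w = g.1 z + ((w : k) - z) * F w
  by_cases hw : w = z
  · simp [hw]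
  · have hne : (w : k) - z ≠ 0 := sub_ne_zero.mpr fun h => hw (Subtype.ext h)
    simp only [F, hw, if_false]
    field_simp
    ring

lemma coordSub_eq_aeval (a : k) : D.coordSub a = aeval D.coord (X - C a) := by
  simp [coordSub]

lemma supNorm_coordSub (z : D.pts) (a : k) {τ : ℝ} (hτ0 : 0 ≤ τ) (hτ : τ < D.radius) :
    D.supNorm z τ (D.coordSub a) = max τ ‖(z : k) - a‖ := by
  rw [coordSub_eq_aeval, supNorm_aeval _ hτ0 hτ, rootNorm]
  simp

/-- Schwarz' lemma. -/
lemma exists_norm_sub_le {g : D.Fun} {C : ℝ} (h : ∀ w, ‖g.1 w‖ ≤ C) (z : D.pts) {τ : ℝ}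
    (hτ0 : 0 ≤ τ) (hτ : τ < D.radius) :
    ∃ θ, 0 ≤ θ ∧ θ < 1 ∧ ∀ w : D.pts, ‖(w : k) - z‖ ≤ τ → ‖g.1 w - g.1 z‖ ≤ C * θ := by
  obtain ⟨τ', h1, h2⟩ := exists_between hτ
  have hτ' : 0 < τ' := hτ0.trans_lt h1
  obtain ⟨q, hq⟩ := exists_eq_add_coordSub_mul g z
  have hq' : ∀ w, g.1 w - g.1 z = ((w : k) - z) * q.1 w := fun w => by
    conv_lhs => rw [hq]
    simp [coordSub_apply]
  have h3 : τ' * D.supNorm z τ' q ≤ C := by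
    have := supNorm_mul (z := z) (D.coordSub z) q hτ'.le h2
    rw [supNorm_coordSub z _ hτ'.le h2, sub_self, norm_zero, max_eq_left hτ'.le] at this
    rw [← this]
    refine supNorm_le hτ'.le fun w _ => ?_
    rw [Fun.mul_apply, coordSub_apply, ← hq' w, sub_eq_add_neg]
    refine (IsUltrametricDist.norm_add_le_max _ _).trans (max_le (h w) ?_)
    rw [norm_neg]
    exact h z
  refine ⟨τ / τ', by positivity, (div_lt_one hτ').mpr h1, fun w hw => ?_⟩
  rw [hq', norm_mul]
  calc ‖(w : k) - z‖ * ‖q.1 w‖ ≤ τ * (C / τ') := by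
        refine mul_le_mul hw ?_ (norm_nonneg _) hτ0
        rw [le_div_iff₀ hτ', mul_comm]
        exact (mul_le_mul_of_nonneg_left (norm_le_supNorm q h2 (hw.trans h1.le)) hτ'.le).trans h3
    _ = C * (τ / τ') := by ring

/-- An analytic function of constant absolute value is invertible. -/
lemma isUnit_of_norm_eq {g : D.Fun} {C : ℝ} (hC : 0 < C) (h : ∀ w, ‖g.1 w‖ = C) : IsUnit g := by
  obtain ⟨z⟩ := D.nonempty_pts
  have hg0 : ∀ w, g.1 w ≠ 0 := fun w => norm_pos_iff.mp (by rw [h]; exact hC)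
  set b := g.1 z with hb
  have hF : D.IsAnalytic fun w => (g.1 w)⁻¹ := by
    refine isAnalytic_of_uniform_limit z fun τ hτ ε hε => ?_
    obtain ⟨θ, h0, h1, hθ⟩ := exists_norm_sub_le (fun w => (h w).le) z (le_max_left 0 τ)
      (max_lt D.radius_pos hτ)
    obtain ⟨N, hN⟩ := exists_pow_lt_of_lt_one (mul_pos hC hε) h1
    -- the geometric series for `1 / g` around the constant `b`
    let r : D.Fun := 1 - algebraMap k D.Fun b⁻¹ * g
    let G : D.Fun := algebraMap k D.Fun b⁻¹ * ∑ m ∈ Finset.range N, r ^ m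
    refine ⟨G.1, G.2, fun w hw => ?_⟩
    have hr : r.1 w = 1 - b⁻¹ * g.1 w := by simp [r]
    have hG : G.1 w = b⁻¹ * ∑ m ∈ Finset.range N, (r.1 w) ^ m := by
      change evalHom w G = b⁻¹ * ∑ m ∈ Finset.range N, (evalHom w r) ^ m
      rw [map_mul, map_sum, AlgHom.commutes]
      simp only [map_pow]
      rfl
    have e : (g.1 w)⁻¹ - G.1 w = (g.1 w)⁻¹ * (r.1 w) ^ N := by
      have h2 := mul_neg_geom_sum (r.1 w) N
      rw [hG]
      have h3 : 1 - r.1 w = b⁻¹ * g.1 w := by rw [hr]; ring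
      rw [h3] at h2
      calc (g.1 w)⁻¹ - b⁻¹ * ∑ m ∈ Finset.range N, (r.1 w) ^ m
          = (g.1 w)⁻¹ * (1 - b⁻¹ * g.1 w * ∑ m ∈ Finset.range N, (r.1 w) ^ m) := by
            have := hg0 w
            field_simp
        _ = (g.1 w)⁻¹ * (r.1 w) ^ N := by
            rw [h2]
            ring
    have h4 : ‖r.1 w‖ ≤ θ := by
      have e2 : r.1 w = -(b⁻¹ * (g.1 w - b)) := by
        have := hg0 z
        rw [hr, mul_sub, inv_mul_cancel₀ (hg0 z)]
        ring
      rw [e2, norm_neg, norm_mul, norm_inv, h z]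
      have := hθ w (hw.trans (le_max_right _ _))
      rw [inv_mul_le_iff₀ hC]
      exact this
    rw [e, norm_mul, norm_inv, h w, norm_pow, inv_mul_le_iff₀ hC]
    exact (pow_le_pow_left₀ (norm_nonneg _) h4 N).trans hN.le
  exact IsUnit.of_mul_eq_one (⟨_, hF⟩ : D.Fun) (Fun.ext fun w => mul_inv_cancel₀ (hg0 w))

/-- An invertible analytic function has constant absolute value: on every disc the supremum norms
of the function and of its inverse are inverse to each other, so neither of them varies. -/
lemma exists_norm_eq_of_isUnit {g : D.Fun} (hg : IsUnit g) : ∃ C, 0 < C ∧ ∀ w, ‖g.1 w‖ = C := by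
  obtain ⟨g', hg'⟩ := hg.exists_right_inv
  obtain ⟨z⟩ := D.nonempty_pts
  have hmul : ∀ w, ‖g.1 w‖ * ‖g'.1 w‖ = 1 := fun w => by
    rw [← norm_mul, ← Fun.mul_apply, hg', Fun.one_apply, norm_one]
  have hpos : ∀ w, 0 < ‖g.1 w‖ := fun w => by
    refine (norm_nonneg _).lt_of_ne' fun h => ?_
    have := hmul w
    rw [h, zero_mul] at this
    exact zero_ne_one this
  have hmax : ∀ τ, 0 ≤ τ → τ < D.radius → ∀ w : D.pts, ‖(w : k) - z‖ ≤ τ →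
      ‖g.1 w‖ = D.supNorm z τ g := by
    intro τ hτ0 hτ w hw
    have h1 : D.supNorm z τ g * D.supNorm z τ g' = 1 := by
      rw [← supNorm_mul _ _ hτ0 hτ, hg', ← map_one (algebraMap k D.Fun),
        supNorm_algebraMap _ hτ0, norm_one]
    refine le_antisymm (norm_le_supNorm g hτ hw) ?_
    have h2 := norm_le_supNorm g' hτ hw
    have h3 := hmul w
    have h4 : 0 < ‖g'.1 w‖ := by
      rcases (norm_nonneg (g'.1 w)).eq_or_lt with h | h
      · rw [← h, mul_zero] at h3
        exact absurd h3 zero_ne_one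
      · exact h
    have h5 : 0 ≤ D.supNorm z τ g := supNorm_nonneg _
    have h6 : D.supNorm z τ g * ‖g'.1 w‖ ≤ ‖g.1 w‖ * ‖g'.1 w‖ := by
      rw [h3, ← h1]
      exact mul_le_mul_of_nonneg_left h2 h5
    exact le_of_mul_le_mul_right h6 h4
  refine ⟨‖g.1 z‖, hpos z, fun w => ?_⟩
  rw [hmax ‖(w : k) - z‖ (norm_nonneg _) (norm_sub_lt z w) w le_rfl,
    ← hmax ‖(w : k) - z‖ (norm_nonneg _) (norm_sub_lt z w) z (by simp)]

instance : Nontrivial D.Fun := by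
  obtain ⟨z⟩ := D.nonempty_pts
  exact (evalHom z).toRingHom.domain_nontrivial

instance : IsDomain D.Fun := by
  have : NoZeroDivisors D.Fun := ⟨fun {f g} h => by
    by_contra! hne
    obtain ⟨z⟩ := D.nonempty_pts
    have hpt : ∀ f : D.Fun, f ≠ 0 → ∃ w, f.1 w ≠ 0 := fun f hf => by
      by_contra! h0
      exact hf (Fun.ext h0)
    obtain ⟨w, hw⟩ := hpt f hne.1
    obtain ⟨w', hw'⟩ := hpt g hne.2
    set τ := max ‖(w : k) - z‖ ‖(w' : k) - z‖
    have hτ : τ < D.radius := max_lt (norm_sub_lt _ _) (norm_sub_lt _ _)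
    have hτ0 : 0 ≤ τ := (norm_nonneg _).trans (le_max_left _ _)
    have h1 := supNorm_mul (z := z) f g hτ0 hτ
    have h2 := (norm_pos_iff.mpr hw).trans_le (norm_le_supNorm f hτ (z := z) (le_max_left _ _))
    have h3 := (norm_pos_iff.mpr hw').trans_le (norm_le_supNorm g hτ (z := z) (le_max_right _ _))
    rw [h, ← map_zero (algebraMap k D.Fun), supNorm_algebraMap _ hτ0, norm_zero] at h1
    exact (mul_pos h2 h3).ne h1⟩
  exact NoZeroDivisors.to_isDomain _

lemma eq_zero_of_forall_pow_dvd {g : D.Fun} (z : D.pts) (h : ∀ n, D.coordSub z ^ n ∣ g) :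
    g = 0 := by
  refine Fun.ext fun w => ?_
  obtain ⟨τ, h1, h2⟩ := exists_between (norm_sub_lt z w)
  have hτ0 := (norm_nonneg _).trans_lt h1
  obtain ⟨τ', h3, h4⟩ := exists_between h2
  have hτ' := hτ0.trans h3
  have hpow : ∀ (n : ℕ) (t : ℝ), 0 ≤ t → t < D.radius →
      D.supNorm z t (D.coordSub z ^ n) = t ^ n := by
    intro n t ht0 ht
    induction n with
    | zero => rw [pow_zero, pow_zero, ← map_one (algebraMap k D.Fun), supNorm_algebraMap _ ht0,
        norm_one]
    | succ n ih =>
      rw [pow_succ, supNorm_mul _ _ ht0 ht, ih, supNorm_coordSub z _ ht0 ht, sub_self, norm_zero,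
        max_eq_left ht0, pow_succ]
  -- the norm on the disc of radius `τ` is at most `(τ / τ')ⁿ` times the norm on that of radius `τ'`
  have key : ∀ n : ℕ, D.supNorm z τ g ≤ (τ / τ') ^ n * D.supNorm z τ' g := by
    intro n
    obtain ⟨q, hq⟩ := h n
    rw [hq, supNorm_mul _ _ hτ0.le h2, supNorm_mul _ _ hτ'.le h4, hpow n τ hτ0.le h2,
      hpow n τ' hτ'.le h4, ← mul_assoc, ← mul_pow, div_mul_cancel₀ _ hτ'.ne']
    exact mul_le_mul_of_nonneg_left (supNorm_mono q hτ0.le h3.le h4) (by positivity)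
  have h5 : Tendsto (fun n : ℕ => (τ / τ') ^ n * D.supNorm z τ' g) atTop (𝓝 0) := by
    have := (tendsto_pow_atTop_nhds_zero_of_lt_one (by positivity)
      ((div_lt_one hτ').mpr h3)).mul_const (D.supNorm z τ' g)
    rwa [zero_mul] at this
  have h6 := ge_of_tendsto' h5 key
  exact norm_le_zero_iff.mp ((norm_le_supNorm g h2 h1.le).trans h6)

lemma isUnit_coordSub {a : k} (ha : a ∉ D.pts) : IsUnit (D.coordSub a) := by
  obtain ⟨z⟩ := D.nonempty_pts
  have hza : D.radius ≤ ‖(z : k) - a‖ := by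
    rw [norm_sub_rev]
    exact not_lt.mp fun h => ha ((mem_pts_iff z a).mpr h)
  refine isUnit_of_norm_eq (C := ‖(z : k) - a‖) (D.radius_pos.trans_le hza) fun w => ?_
  have hlt := (norm_sub_lt z w).trans_le hza
  rw [coordSub_apply]
  have e : (w : k) - a = ((w : k) - z) + (z - a) := by ring
  rw [e, IsUltrametricDist.norm_add_eq_max_of_norm_ne_norm hlt.ne, max_eq_right hlt.le]

/-- The `k`-points of `𝒪(D)` are the rational points of `D`. -/
lemma exists_eq_evalHom (χ : D.Fun →ₐ[k] k) : ∃ z : D.pts, χ = evalHom z := by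
  have h0 : χ (D.coordSub (χ D.coord)) = 0 := by simp [coordSub]
  have hz : χ D.coord ∈ D.pts := by
    by_contra h
    exact ((isUnit_coordSub h).map χ).ne_zero h0
  refine ⟨⟨_, hz⟩, AlgHom.ext fun g => ?_⟩
  obtain ⟨q, hq⟩ := exists_eq_add_coordSub_mul g ⟨_, hz⟩
  conv_lhs => rw [hq]
  rw [map_add, map_mul]
  simp [h0]

end OpenDisc

end Units

/-! ### Fibres of a finite étale morphism -/

section Fibres

open Polynomial Filter Topology

variable {k : Type u} [NontriviallyNormedField k] [IsUltrametricDist k] [CompleteSpace k]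
  [IsAlgClosed k]

open OpenDisc

namespace Morphism

variable {D₂ D₁ : OpenDisc k} {φ : Morphism D₂ D₁}

lemma pullback_apply (g : D₁.Fun) (z : D₂.pts) : (φ.pullback g).1 z = g.1 (φ.toFun z) := rfl

lemma pullback_coordSub_apply (a : k) (z : D₂.pts) :
    (φ.pullback (D₁.coordSub a)).1 z = (φ.toFun z : k) - a := rfl

lemma toFun_eq_of_forall {x : D₁.pts} {y : D₂.pts}
    (h : (φ.pullback (D₁.coordSub x)).1 y = 0) : φ.toFun y = x :=
  Subtype.ext (sub_eq_zero.mp h)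

/-- Modulo `φ^*(T - x)`, pulled back functions are constant. -/
lemma pullback_sub_mem (x : D₁.pts) (g : D₁.Fun) :
    φ.pullback (D₁.coordSub x) ∣ φ.pullback g - algebraMap k D₂.Fun (g.1 x) := by
  obtain ⟨q, hq⟩ := exists_eq_add_coordSub_mul g x
  refine ⟨φ.pullback q, ?_⟩
  have h := congrArg φ.pullback hq
  rw [map_add, map_mul, AlgHom.commutes] at h
  rw [h, add_sub_cancel_left]

/-- The prime ideals of `𝒪(D₂)` over the maximal ideal of a rational point `x` of `D₁` are the
ideals of the rational points of the fibre over `x`. -/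
lemma IsFiniteEtale.exists_point_of_prime (hφ : φ.IsFiniteEtale) {x : D₁.pts} (Q : Ideal D₂.Fun)
    [Q.IsPrime] (hQ : φ.pullback (D₁.coordSub x) ∈ Q) :
    ∃ y : D₂.pts, φ.toFun y = x ∧ Q = RingHom.ker (evalHom y) := by
  have hint : Algebra.IsIntegral k (D₂.Fun ⧸ Q) := by
    refine ⟨fun b => ?_⟩
    obtain ⟨b, rfl⟩ := Ideal.Quotient.mk_surjective b
    obtain ⟨p, hp, hpb⟩ := hφ.finite.to_isIntegral b
    refine ⟨p.map (evalHom x).toRingHom, hp.map _, ?_⟩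
    rw [eval₂_map]
    have e : (algebraMap k (D₂.Fun ⧸ Q)).comp (evalHom x).toRingHom =
        (Ideal.Quotient.mk Q).comp φ.pullback.toRingHom := by
      ext g
      have h := Ideal.mem_of_dvd _ (pullback_sub_mem (φ := φ) x g) hQ
      exact ((Ideal.Quotient.mk_eq_mk_iff_sub_mem _ _).mpr h).symm
    rw [e, ← hom_eval₂]
    exact (congrArg _ hpb).trans (map_zero _)
  have hbij := IsAlgClosed.algebraMap_bijective_of_isIntegral (k := k) (K := D₂.Fun ⧸ Q)
  let ψ : k ≃ₐ[k] (D₂.Fun ⧸ Q) := AlgEquiv.ofBijective (Algebra.ofId k _) hbij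
  let χ : D₂.Fun →ₐ[k] k := (ψ.symm : (D₂.Fun ⧸ Q) →ₐ[k] k).comp (Ideal.Quotient.mkₐ k Q)
  obtain ⟨y, hy⟩ := exists_eq_evalHom χ
  have hker : Q = RingHom.ker (evalHom y) := by
    rw [← hy]
    ext b
    rw [RingHom.mem_ker]
    change _ ↔ ψ.symm (Ideal.Quotient.mk Q b) = 0
    rw [EmbeddingLike.map_eq_zero_iff, Ideal.Quotient.eq_zero_iff_mem]
  refine ⟨y, toFun_eq_of_forall ?_, hker⟩
  rw [hker] at hQ
  exact hQ

/-- The fibres of an étale morphism are reduced. -/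
lemma IsFiniteEtale.dvd_of_forall_eq_zero (hφ : φ.IsFiniteEtale) {x : D₁.pts} {b : D₂.Fun}
    (hb : ∀ y, φ.toFun y = x → b.1 y = 0) : φ.pullback (D₁.coordSub x) ∣ b := by
  let _ : Algebra D₁.Fun D₂.Fun := φ.pullback.toRingHom.toAlgebra
  have : Algebra.Etale D₁.Fun D₂.Fun := hφ.etale
  let p : Ideal D₁.Fun := RingHom.ker (evalHom x)
  have hp : p = Ideal.span {D₁.coordSub x} := by
    ext g
    rw [RingHom.mem_ker, Ideal.mem_span_singleton]
    constructor
    · intro h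
      obtain ⟨q, hq⟩ := exists_eq_add_coordSub_mul g x
      rw [show g.1 x = 0 from h, map_zero, zero_add] at hq
      exact ⟨q, hq⟩
    · rintro ⟨q, rfl⟩
      rw [map_mul]
      simp [coordSub_apply]
  have hmax : p.IsMaximal := RingHom.ker_isMaximal_of_surjective (evalHom x).toRingHom
    fun c => ⟨algebraMap k D₁.Fun c, (evalHom x).commutes c⟩
  have hrad := Algebra.FormallyUnramified.isRadical_map_isMaximal (A := D₁.Fun) D₂.Fun p
  have hI : p.map (algebraMap D₁.Fun D₂.Fun) = Ideal.span {φ.pullback (D₁.coordSub x)} := by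
    rw [hp, Ideal.map_span, Set.image_singleton]
    rfl
  rw [hI] at hrad
  rw [← Ideal.mem_span_singleton]
  refine hrad ?_
  rw [Ideal.radical_eq_sInf, Ideal.mem_sInf]
  rintro Q ⟨hQ, hQp⟩
  obtain ⟨y, hy, rfl⟩ := hφ.exists_point_of_prime Q (hQ (Ideal.mem_span_singleton_self _))
  exact hb y hy

lemma IsFiniteEtale.pullback_injective (hφ : φ.IsFiniteEtale) :
    Function.Injective φ.pullback := by
  let _ : Algebra D₁.Fun D₂.Fun := φ.pullback.toRingHom.toAlgebra
  have : Algebra.Etale D₁.Fun D₂.Fun := hφ.etale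
  refine (injective_iff_map_eq_zero _).mpr fun a ha => ?_
  by_contra h
  have h1 : IsSMulRegular D₂.Fun a := IsSMulRegular.of_flat (IsRegular.of_ne_zero h).left.isSMulRegular
  have h2 : a • (1 : D₂.Fun) = a • 0 := by
    rw [smul_zero, Algebra.smul_def, mul_one]
    exact ha
  exact one_ne_zero (h1 h2)

lemma IsFiniteEtale.exists_toFun_eq (hφ : φ.IsFiniteEtale) (x : D₁.pts) :
    ∃ y, φ.toFun y = x := by
  let _ : Algebra D₁.Fun D₂.Fun := φ.pullback.toRingHom.toAlgebra
  have : Module.Finite D₁.Fun D₂.Fun := hφ.finite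
  let p : Ideal D₁.Fun := RingHom.ker (evalHom x)
  have hmax : p.IsMaximal := RingHom.ker_isMaximal_of_surjective (evalHom x).toRingHom
    fun c => ⟨algebraMap k D₁.Fun c, (evalHom x).commutes c⟩
  have hk : RingHom.ker (algebraMap D₁.Fun D₂.Fun) ≤ p := by
    rw [(RingHom.injective_iff_ker_eq_bot (algebraMap D₁.Fun D₂.Fun)).mp hφ.pullback_injective]
    exact bot_le
  obtain ⟨Q, hQ, hQp⟩ := Ideal.exists_ideal_over_maximal_of_isIntegral p hk
  have hmem : φ.pullback (D₁.coordSub x) ∈ Q := by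
    have : D₁.coordSub x ∈ Q.comap (algebraMap D₁.Fun D₂.Fun) := by
      rw [hQp]
      exact sub_self _
    exact this
  obtain ⟨y, hy, -⟩ := hφ.exists_point_of_prime Q hmem
  exact ⟨y, hy⟩

/-- The coordinate of `D₂` is a root of a monic polynomial over `𝒪(D₁)`; its degree bounds the
cardinality of the fibres. -/
lemma IsFiniteEtale.exists_bound (hφ : φ.IsFiniteEtale) :
    ∃ n : ℕ, ∀ x, ({y | φ.toFun y = x} : Set D₂.pts).Finite ∧
      ({y | φ.toFun y = x} : Set D₂.pts).ncard ≤ n := by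
  classical
  obtain ⟨p, hp, hpT⟩ := hφ.finite.to_isIntegral D₂.coord
  refine ⟨p.natDegree, fun x => ?_⟩
  let px := p.map (evalHom x).toRingHom
  have hpx : px ≠ 0 := (hp.map _).ne_zero
  have hroot : Subtype.val '' {y | φ.toFun y = x} ⊆ (px.roots.toFinset : Set k) := by
    rintro _ ⟨y, hy, rfl⟩
    rw [Finset.mem_coe, Multiset.mem_toFinset, mem_roots hpx, IsRoot.def, eval_map]
    have h := congrArg (evalHom y) hpT
    rw [map_zero] at h
    change (evalHom y).toRingHom (eval₂ φ.pullback.toRingHom D₂.coord p) = 0 at h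
    rw [hom_eval₂] at h
    have e : (evalHom y).toRingHom.comp φ.pullback.toRingHom = (evalHom x).toRingHom := by
      ext g
      change g.1 (φ.toFun y) = g.1 x
      rw [show φ.toFun y = x from hy]
    rwa [e] at h
  have hfin := (Finset.finite_toSet _).subset hroot
  refine ⟨hfin.of_finite_image Subtype.val_injective.injOn, ?_⟩
  rw [← Set.ncard_image_of_injective _ Subtype.val_injective]
  refine (Set.ncard_le_ncard hroot (Finset.finite_toSet _)).trans ?_
  rw [Set.ncard_coe_finset]
  exact (Multiset.toFinset_card_le _).trans ((card_roots' _).trans natDegree_map_le)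

/-- The fibre of a finite étale morphism over a rational point. -/
def IsFiniteEtale.fiber (hφ : φ.IsFiniteEtale) (x : D₁.pts) : Finset D₂.pts :=
  (hφ.exists_bound.choose_spec x).1.toFinset

lemma IsFiniteEtale.mem_fiber {hφ : φ.IsFiniteEtale} {x : D₁.pts} {y : D₂.pts} :
    y ∈ hφ.fiber x ↔ φ.toFun y = x := by
  simp [fiber]

lemma IsFiniteEtale.exists_card_fiber_le (hφ : φ.IsFiniteEtale) :
    ∃ n : ℕ, ∀ x, (hφ.fiber x).card ≤ n := by
  refine ⟨hφ.exists_bound.choose, fun x => ?_⟩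
  have h := (hφ.exists_bound.choose_spec x).2
  rwa [Set.ncard_eq_toFinset_card _ (hφ.exists_bound.choose_spec x).1] at h

lemma IsFiniteEtale.fiber_nonempty (hφ : φ.IsFiniteEtale) (x : D₁.pts) :
    (hφ.fiber x).Nonempty := by
  obtain ⟨y, hy⟩ := hφ.exists_toFun_eq x
  exact ⟨y, mem_fiber.mpr hy⟩

end Morphism

lemma OpenDisc.prod_coordSub_dvd {D : OpenDisc k} {g : D.Fun} (S : Finset D.pts)
    (h : ∀ y ∈ S, g.1 y = 0) : ∏ y ∈ S, D.coordSub y ∣ g := by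
  classical
  induction S using Finset.induction_on generalizing g with
  | empty => simp
  | insert y S hy ih =>
    obtain ⟨q, hq⟩ := exists_eq_add_coordSub_mul g y
    rw [h y (Finset.mem_insert_self _ _), map_zero, zero_add] at hq
    rw [Finset.prod_insert hy, hq]
    refine mul_dvd_mul_left _ (ih fun y' hy' => ?_)
    have h1 := h y' (Finset.mem_insert_of_mem hy')
    rw [hq, Fun.mul_apply, coordSub_apply] at h1
    refine (mul_eq_zero.mp h1).resolve_left (sub_ne_zero.mpr fun e => hy ?_)
    rwa [← Subtype.ext e]

namespace Morphism

variable {D₂ D₁ : OpenDisc k} {φ : Morphism D₂ D₁}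

/-- Up to a unit, `φ^*(T - x)` is the product of the `T - y` for the points `y` of the fibre
over `x`. -/
lemma IsFiniteEtale.exists_factorization (hφ : φ.IsFiniteEtale) (x : D₁.pts) :
    ∃ v : D₂.Fun, IsUnit v ∧
      φ.pullback (D₁.coordSub x) = v * ∏ y ∈ hφ.fiber x, D₂.coordSub y := by
  have h1 : ∏ y ∈ hφ.fiber x, D₂.coordSub y ∣ φ.pullback (D₁.coordSub x) := by
    refine prod_coordSub_dvd _ fun y hy => ?_
    rw [pullback_coordSub_apply, mem_fiber.mp hy, sub_self]
  have h2 : φ.pullback (D₁.coordSub x) ∣ ∏ y ∈ hφ.fiber x, D₂.coordSub y := by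
    refine hφ.dvd_of_forall_eq_zero fun y hy => ?_
    change evalHom y (∏ y ∈ hφ.fiber x, D₂.coordSub y) = 0
    rw [map_prod]
    exact Finset.prod_eq_zero (mem_fiber.mpr hy) (sub_self _)
  obtain ⟨w, hw⟩ := associated_of_dvd_dvd h1 h2
  exact ⟨w, w.isUnit, by rw [← hw, mul_comm]⟩

end Morphism

end Fibres

/-! ### The profile function -/

section Profile

open Filter Topology

variable {k : Type u} [NontriviallyNormedField k] [IsUltrametricDist k] [CompleteSpace k]
  [IsAlgClosed k]

open OpenDisc

lemma OpenDisc.supNorm_prod {D : OpenDisc k} {ι : Type*} (S : Finset ι) (g : ι → D.Fun)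
    {z : D.pts} {τ : ℝ} (hτ0 : 0 ≤ τ) (hτ : τ < D.radius) :
    D.supNorm z τ (∏ i ∈ S, g i) = ∏ i ∈ S, D.supNorm z τ (g i) := by
  classical
  induction S using Finset.induction_on with
  | empty => rw [Finset.prod_empty, Finset.prod_empty, ← map_one (algebraMap k D.Fun),
      supNorm_algebraMap _ hτ0, norm_one]
  | insert i S hi ih => rw [Finset.prod_insert hi, Finset.prod_insert hi,
      supNorm_mul _ _ hτ0 hτ, ih]

lemma BerkPoint.map_eq_of_norm_eq {D : OpenDisc k} (p : BerkPoint D) {g : D.Fun} {C : ℝ}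
    (hC : 0 < C) (h : ∀ w, ‖g.1 w‖ = C) : p.toFun g = C := by
  obtain ⟨t, -, ht⟩ := p.bounded
  obtain ⟨g', hg'⟩ := (isUnit_of_norm_eq hC h).exists_right_inv
  have h1 : p.toFun g ≤ C := ht g C fun z _ => (h z).le
  have h2 : p.toFun g' ≤ C⁻¹ := ht g' C⁻¹ fun z _ => by
    have : ‖g.1 z‖ * ‖g'.1 z‖ = 1 := by
      rw [← norm_mul, ← Fun.mul_apply, hg', Fun.one_apply, norm_one]
    rw [h z] at this
    exact (eq_inv_of_mul_eq_one_right this).le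
  have h3 : p.toFun g * p.toFun g' = 1 := by
    have e := p.map_mul' g g'
    rw [hg'] at e
    have e1 := p.map_const 1
    rw [map_one, norm_one] at e1
    exact e.symm.trans e1
  refine le_antisymm h1 ?_
  have h4 : 0 ≤ p.toFun g := apply_nonneg p.toMulRingSeminorm g
  have h5 : 1 ≤ p.toFun g * C⁻¹ := by
    rw [← h3]
    exact mul_le_mul_of_nonneg_left h2 h4
  rwa [← div_eq_mul_inv, le_div_iff₀ hC, one_mul] at h5

namespace Morphism

variable {D₂ D₁ : OpenDisc k} {φ : Morphism D₂ D₁}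

/-- The unit factor `φ^*(T - x) / ∏ (T - y)`, where `y` runs through the fibre over `x`. -/
def IsFiniteEtale.unitFactor (hφ : φ.IsFiniteEtale) (x : D₁.pts) : D₂.Fun :=
  (hφ.exists_factorization x).choose

lemma IsFiniteEtale.pullback_coordSub (hφ : φ.IsFiniteEtale) (x : D₁.pts) :
    φ.pullback (D₁.coordSub x) = hφ.unitFactor x * ∏ y ∈ hφ.fiber x, D₂.coordSub y :=
  (hφ.exists_factorization x).choose_spec.2

lemma IsFiniteEtale.toFun_sub_eq (hφ : φ.IsFiniteEtale) (x : D₁.pts) (z : D₂.pts) :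
    (φ.toFun z : k) - x = (hφ.unitFactor x).1 z * ∏ y ∈ hφ.fiber x, ((z : k) - y) := by
  have h := congrArg (evalHom z) (hφ.pullback_coordSub x)
  rw [map_mul, map_prod] at h
  exact h

/-- The absolute value of the unit factor is determined by the surjectivity of `φ`. -/
lemma IsFiniteEtale.norm_unitFactor (hφ : φ.IsFiniteEtale) (x : D₁.pts) (w : D₂.pts) :
    ‖(hφ.unitFactor x).1 w‖ = D₁.radius / D₂.radius ^ (hφ.fiber x).card := by
  obtain ⟨C, hC, h⟩ := exists_norm_eq_of_isUnit (hφ.exists_factorization x).choose_spec.1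
  have hn : ∀ z : D₂.pts, ‖(φ.toFun z : k) - x‖ = C * ∏ y ∈ hφ.fiber x, ‖(z : k) - y‖ :=
    fun z => by rw [hφ.toFun_sub_eq, norm_mul, norm_prod]; congr 1; exact h z
  have hρ := D₂.radius_pos
  set d := (hφ.fiber x).card
  have hle : ∀ z : D₂.pts, ‖(φ.toFun z : k) - x‖ ≤ C * D₂.radius ^ d := fun z => by
    rw [hn]
    refine mul_le_mul_of_nonneg_left ?_ hC.le
    rw [← Finset.prod_const]
    exact Finset.prod_le_prod (fun y _ => norm_nonneg _) fun y _ => (norm_sub_lt y z).le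
  rw [show ‖(hφ.unitFactor x).1 w‖ = C from h w, eq_div_iff (by positivity)]
  refine le_antisymm ?_ ?_
  · by_contra! hlt
    -- a generic point near the boundary of `D₂` would be mapped out of `D₁`
    have hcont : Continuous fun t : ℝ => C * t ^ d := by fun_prop
    have hev : ∀ᶠ t in 𝓝 D₂.radius, D₁.radius < C * t ^ d :=
      hcont.continuousAt.eventually_const_lt hlt
    obtain ⟨δ, hδ, h3⟩ := Metric.eventually_nhds_iff.mp hev
    obtain ⟨y₀, hy₀⟩ := hφ.fiber_nonempty x
    obtain ⟨z, hz1, hz2, hz3⟩ := exists_generic (y₀ : k) ((hφ.fiber x).map ⟨_, Subtype.val_injective⟩)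
      (le_max_left 0 (D₂.radius - δ)) (max_lt hρ (by linarith : D₂.radius - δ < D₂.radius))
    have hzD : z ∈ D₂.pts := (mem_pts_iff y₀ z).mpr hz2
    have h4 : D₁.radius < C * ‖z - y₀‖ ^ d := by
      refine h3 ?_
      rw [Real.dist_eq, abs_lt]
      have := (le_max_right 0 (D₂.radius - δ)).trans_lt hz1
      constructor <;> linarith
    have h5 := norm_sub_lt x (φ.toFun ⟨z, hzD⟩)
    rw [hn] at h5
    refine absurd (h4.trans_le (mul_le_mul_of_nonneg_left ?_ hC.le)) h5.not_gt
    rw [← Finset.prod_const]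
    refine Finset.prod_le_prod (fun y _ => norm_nonneg _) (fun y hy => ?_)
    rw [hz3 y (by simpa using hy)]
    exact le_max_left _ _
  · by_contra! hlt
    obtain ⟨u, hu1, hu2⟩ := exists_norm_mem_Ioo (k := k) (by positivity) hlt
    have hxu : (x : k) + u ∈ D₁.pts := by
      rw [mem_pts_iff x]
      simpa using hu2
    obtain ⟨z, hz⟩ := hφ.exists_toFun_eq ⟨_, hxu⟩
    have h4 := hle z
    rw [hz] at h4
    simp only [add_sub_cancel_left] at h4
    linarith

lemma IsFiniteEtale.norm_toFun_sub (hφ : φ.IsFiniteEtale) (x : D₁.pts) (z : D₂.pts) :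
    ‖(φ.toFun z : k) - x‖ = D₁.radius * ∏ y ∈ hφ.fiber x, (‖(z : k) - y‖ / D₂.radius) := by
  rw [hφ.toFun_sub_eq, norm_mul, norm_prod, hφ.norm_unitFactor, Finset.prod_div_distrib,
    Finset.prod_const]
  ring

lemma IsFiniteEtale.berk_pullback_coordSub (hφ : φ.IsFiniteEtale) (x : D₁.pts) (p : BerkPoint D₂) :
    p.toFun (φ.pullback (D₁.coordSub x)) =
      D₁.radius * ∏ y ∈ hφ.fiber x, (p.toFun (D₂.coordSub y) / D₂.radius) := by
  have h1 : p.toFun (hφ.unitFactor x) = D₁.radius / D₂.radius ^ (hφ.fiber x).card :=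
    p.map_eq_of_norm_eq (div_pos D₁.radius_pos (pow_pos D₂.radius_pos _))
      (hφ.norm_unitFactor x)
  have h2 : p.toFun (∏ y ∈ hφ.fiber x, D₂.coordSub y) =
      ∏ y ∈ hφ.fiber x, p.toFun (D₂.coordSub y) := by
    have h3 : p.toFun 1 = 1 := p.map_one'
    generalize hφ.fiber x = S
    classical
    induction S using Finset.induction_on with
    | empty => exact h3
    | insert y S hy ih =>
      rw [Finset.prod_insert hy, Finset.prod_insert hy, ← ih]
      exact p.map_mul' _ _
  rw [hφ.pullback_coordSub, Finset.prod_div_distrib, Finset.prod_const, ← h2]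
  refine (p.map_mul' _ _).trans ?_
  rw [h1]
  ring

end Morphism

/-- The function `t ↦ ∏ max(t, |y - y'|)` with `y'` running through a finite set of points of `D`;
distances are normalised so that `D` has radius `1`. -/
def fiberProfile {D : OpenDisc k} (F : Finset D.pts) (y : D.pts) (t : ℝ) : ℝ :=
  ∏ y' ∈ F, max t (‖(y : k) - y'‖ / D.radius)

section fiberProfile

variable {D : OpenDisc k} {F : Finset D.pts} {y : D.pts}

lemma continuous_fiberProfile : Continuous (fiberProfile F y) :=
  continuous_finsetProd _ fun _ _ => continuous_id.max continuous_const

lemma fiberProfile_zero (hy : y ∈ F) : fiberProfile F y 0 = 0 :=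
  Finset.prod_eq_zero hy (by simp)

lemma fiberProfile_one : fiberProfile F y 1 = 1 :=
  Finset.prod_eq_one fun y' _ => max_eq_left
    ((div_le_one D.radius_pos).mpr (norm_sub_lt y' y).le)

lemma strictMonoOn_fiberProfile (hy : y ∈ F) :
    StrictMonoOn (fiberProfile F y) (Set.Ici 0) := by
  intro s hs t _ hst
  have ht : 0 < t := lt_of_le_of_lt hs hst
  have hpos : ∀ y', 0 < max t (‖(y : k) - y'‖ / D.radius) := fun y' => lt_max_of_lt_left ht
  rcases (show 0 ≤ s from hs).eq_or_lt with rfl | hs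
  · rw [fiberProfile_zero hy]
    exact Finset.prod_pos fun y' _ => hpos y'
  · refine Finset.prod_lt_prod (fun y' _ => lt_max_of_lt_left hs)
      (fun y' _ => max_le_max_right _ hst.le) ⟨y, hy, ?_⟩
    simp [hs.le, ht.le, hst]

/-- If the numbers `N y` behave like the distances of a point to the points of `F`, then their
product is the profile at a point of `F` for which the distance is smallest. -/
lemma exists_prod_eq_fiberProfile (hF : F.Nonempty) {N : D.pts → ℝ}
    (h1 : ∀ y ∈ F, ∀ y' ∈ F, N y' ≤ max (N y) ‖(y : k) - y'‖)
    (h2 : ∀ y ∈ F, ∀ y' ∈ F, ‖(y : k) - y'‖ ≤ max (N y) (N y')) :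
    ∃ y ∈ F, (∀ y' ∈ F, N y ≤ N y') ∧
      ∏ y' ∈ F, (N y' / D.radius) = fiberProfile F y (N y / D.radius) := by
  obtain ⟨y, hy, hmin⟩ := F.exists_min_image N hF
  refine ⟨y, hy, hmin, Finset.prod_congr rfl fun y' hy' => ?_⟩
  rw [max_div_div_right D.radius_pos.le]
  congr 1
  refine le_antisymm (h1 y hy y' hy') (max_le (hmin y' hy') ?_)
  exact (h2 y hy y' hy').trans (max_le (hmin y' hy') le_rfl)

end fiberProfile

namespace Morphism

variable {D₂ D₁ : OpenDisc k} {φ : Morphism D₂ D₁}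

lemma IsFiniteEtale.profileAt_eq (hφ : φ.IsFiniteEtale) (x : D₁.pts) {y : D₂.pts}
    (hy : φ.toFun y = x) : Set.EqOn (φ.profileAt y) (fiberProfile (hφ.fiber x) y) (Set.Icc 0 1) := by
  intro t ht
  rcases ht.2.lt_or_eq with ht1 | rfl
  swap
  · simp [profileAt, fiberProfile_one]
  have hρ := D₂.radius_pos
  have hτ0 : 0 ≤ t * D₂.radius := mul_nonneg ht.1 hρ.le
  have hτ : t * D₂.radius < D₂.radius := by nlinarith
  rw [profileAt, if_pos ht1, radiusOf]
  simp only [shilov_eq_supNorm]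
  have hinf : ⨅ a : k, D₂.supNorm y (t * D₂.radius) (φ.pullback (D₁.coordSub a)) =
      D₂.supNorm y (t * D₂.radius) (φ.pullback (D₁.coordSub x)) := by
    refine le_antisymm (ciInf_le ⟨0, ?_⟩ (x : k)) (le_ciInf fun a => supNorm_le hτ0 fun w hw => ?_)
    · rintro _ ⟨a, rfl⟩
      exact supNorm_nonneg _
    · have e : (φ.toFun w : k) - x = (φ.toFun w - a) + -(φ.toFun y - a) := by rw [hy]; ring
      rw [pullback_coordSub_apply, e]
      refine (IsUltrametricDist.norm_add_le_max _ _).trans (max_le ?_ ?_)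
      · exact norm_le_supNorm (φ.pullback (D₁.coordSub a)) hτ hw
      · rw [norm_neg]
        exact norm_le_supNorm (φ.pullback (D₁.coordSub a)) hτ (by simpa using hτ0)
  have hunit : D₂.supNorm y (t * D₂.radius) (hφ.unitFactor x) =
      D₁.radius / D₂.radius ^ (hφ.fiber x).card :=
    le_antisymm (supNorm_le hτ0 fun w _ => (hφ.norm_unitFactor x w).le)
      ((hφ.norm_unitFactor x y).ge.trans (norm_le_supNorm _ hτ (by simpa using hτ0)))
  rw [hinf, hφ.pullback_coordSub, supNorm_mul _ _ hτ0 hτ, supNorm_prod _ _ hτ0 hτ, hunit,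
    fiberProfile, Finset.prod_congr rfl fun (y' : D₂.pts) _ => supNorm_coordSub y (y' : k) hτ0 hτ]
  have e : ∀ y' : D₂.pts, max t (‖(y : k) - y'‖ / D₂.radius) =
      max (t * D₂.radius) ‖(y : k) - y'‖ / D₂.radius := fun y' => by
    rw [← max_div_div_right hρ.le, mul_div_cancel_right₀ _ hρ.ne']
  rw [Finset.prod_congr rfl fun y' _ => e y', Finset.prod_div_distrib, Finset.prod_const]
  have := D₁.radius_pos
  field_simp

variable {f : ℝ → ℝ}

lemma IsFiniteEtale.profile_eqOn (hφ : φ.IsFiniteEtale) (hf : φ.IsRadialWithProfile f) {x : D₁.pts}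
    {y : D₂.pts} (hy : y ∈ hφ.fiber x) :
    Set.EqOn f (fiberProfile (hφ.fiber x) y) (Set.Icc 0 1) := fun _ ht =>
  (hf y ht).symm.trans (hφ.profileAt_eq x (mem_fiber.mp hy) ht)

lemma IsFiniteEtale.profile_zero (hφ : φ.IsFiniteEtale) (hf : φ.IsRadialWithProfile f)
    (x : D₁.pts) : f 0 = 0 := by
  obtain ⟨y, hy⟩ := hφ.fiber_nonempty x
  rw [hφ.profile_eqOn hf hy (by simp), fiberProfile_zero hy]

lemma IsFiniteEtale.profile_one (hφ : φ.IsFiniteEtale) (hf : φ.IsRadialWithProfile f)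
    (x : D₁.pts) : f 1 = 1 := by
  obtain ⟨y, hy⟩ := hφ.fiber_nonempty x
  rw [hφ.profile_eqOn hf hy (by simp), fiberProfile_one]

lemma IsFiniteEtale.profile_strictMonoOn (hφ : φ.IsFiniteEtale) (hf : φ.IsRadialWithProfile f)
    (x : D₁.pts) : StrictMonoOn f (Set.Icc 0 1) := by
  obtain ⟨y, hy⟩ := hφ.fiber_nonempty x
  exact ((strictMonoOn_fiberProfile hy).mono fun _ ht => ht.1).congr (hφ.profile_eqOn hf hy).symm

lemma IsFiniteEtale.profile_continuousOn (hφ : φ.IsFiniteEtale) (hf : φ.IsRadialWithProfile f)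
    (x : D₁.pts) : ContinuousOn f (Set.Icc 0 1) := by
  obtain ⟨y, hy⟩ := hφ.fiber_nonempty x
  exact continuous_fiberProfile.continuousOn.congr (hφ.profile_eqOn hf hy)

lemma IsFiniteEtale.exists_profile_eq (hφ : φ.IsFiniteEtale) (hf : φ.IsRadialWithProfile f)
    (x : D₁.pts) {s : ℝ} (hs0 : 0 < s) (hs1 : s ≤ 1) : ∃ σ, 0 < σ ∧ σ ≤ 1 ∧ f σ = s := by
  have h := intermediate_value_Icc zero_le_one (hφ.profile_continuousOn hf x)
  rw [hφ.profile_zero hf x, hφ.profile_one hf x] at h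
  obtain ⟨σ, hσ, rfl⟩ := h ⟨hs0.le, hs1⟩
  refine ⟨σ, hσ.1.lt_of_ne fun h0 => ?_, hσ.2, rfl⟩
  rw [← h0, hφ.profile_zero hf x] at hs0
  exact lt_irrefl _ hs0

/-- A point of `D₂` lies over the disc with centre `x` and normalised radius `f(σ)` if and only if
it lies in one of the discs of normalised radius `σ` around the points of the fibre over `x`. This
is stated for the distances `N y` of a possibly non-rational point to the rational points `y`. -/
lemma IsFiniteEtale.prod_lt_iff (hφ : φ.IsFiniteEtale) (hf : φ.IsRadialWithProfile f) (x : D₁.pts)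
    {N : D₂.pts → ℝ} (h0 : ∀ y, 0 ≤ N y) (hlt : ∀ y, N y < D₂.radius)
    (h1 : ∀ y y' : D₂.pts, N y' ≤ max (N y) ‖(y : k) - y'‖)
    (h2 : ∀ y y' : D₂.pts, ‖(y : k) - y'‖ ≤ max (N y) (N y')) {σ : ℝ} (hσ0 : 0 < σ) (hσ1 : σ ≤ 1) :
    D₁.radius * ∏ y ∈ hφ.fiber x, (N y / D₂.radius) < f σ * D₁.radius ↔
      ∃ y ∈ hφ.fiber x, N y < σ * D₂.radius := by
  obtain ⟨y, hy, hmin, hprod⟩ := exists_prod_eq_fiberProfile (hφ.fiber_nonempty x)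
    (fun y _ y' _ => h1 y y') (fun y _ y' _ => h2 y y')
  have hρ := D₂.radius_pos
  have hmem : N y / D₂.radius ∈ Set.Icc (0 : ℝ) 1 :=
    ⟨div_nonneg (h0 y) hρ.le, (div_le_one hρ).mpr (hlt y).le⟩
  rw [hprod, ← hφ.profile_eqOn hf hy hmem, mul_comm, mul_lt_mul_iff_left₀ D₁.radius_pos,
    (hφ.profile_strictMonoOn hf x).lt_iff_lt hmem ⟨hσ0.le, hσ1⟩, div_lt_iff₀ hρ]
  exact ⟨fun h => ⟨y, hy, h⟩, fun ⟨y', hy', h⟩ => (hmin y' hy').trans_lt h⟩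

end Morphism

end Profile

/-! ### Connected components of the preimage of a disc -/

section Berkovich

open Polynomial Filter Topology

variable {k : Type u} [NontriviallyNormedField k] [IsUltrametricDist k] [CompleteSpace k]
  [IsAlgClosed k]

open OpenDisc

namespace BerkPoint

variable {D : OpenDisc k}

lemma nonneg (p : BerkPoint D) (g : D.Fun) : 0 ≤ p.toFun g := apply_nonneg p.toMulRingSeminorm g

lemma map_mul (p : BerkPoint D) (f g : D.Fun) : p.toFun (f * g) = p.toFun f * p.toFun g :=
  p.map_mul' f g

lemma map_pow (p : BerkPoint D) (f : D.Fun) (n : ℕ) : p.toFun (f ^ n) = p.toFun f ^ n :=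
  _root_.map_pow p.toMulRingSeminorm f n

/-- A multiplicative seminorm which extends a non-archimedean absolute value is itself
non-archimedean. -/
lemma add_le_max (p : BerkPoint D) (f g : D.Fun) :
    p.toFun (f + g) ≤ max (p.toFun f) (p.toFun g) := by
  set M := max (p.toFun f) (p.toFun g)
  have hM : 0 ≤ M := (p.nonneg f).trans (le_max_left _ _)
  have hpow : ∀ n : ℕ, p.toFun (f + g) ^ n ≤ (n + 1 : ℕ) * M ^ n := by
    intro n
    rw [← p.map_pow, add_pow]
    refine (Finset.le_sum_of_subadditive p.toFun (p.map_zero').le p.add_le' _ _).trans ?_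
    refine (Finset.sum_le_card_nsmul _ _ (M ^ n) fun i hi => ?_).trans ?_
    · have hi' : i ≤ n := Nat.lt_succ_iff.mp (Finset.mem_range.mp hi)
      have h1 : p.toFun ((n.choose i : ℕ) : D.Fun) ≤ 1 := by
        have := p.map_const (n.choose i : k)
        rw [map_natCast] at this
        rw [this]
        exact IsUltrametricDist.norm_natCast_le_one k _
      rw [p.map_mul, p.map_mul, p.map_pow, p.map_pow]
      calc p.toFun f ^ i * p.toFun g ^ (n - i) * p.toFun ((n.choose i : ℕ) : D.Fun)
          ≤ M ^ i * M ^ (n - i) * 1 := by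
            have := p.nonneg f
            have := p.nonneg g
            have := p.nonneg ((n.choose i : ℕ) : D.Fun)
            have := le_max_left (p.toFun f) (p.toFun g)
            have := le_max_right (p.toFun f) (p.toFun g)
            gcongr
        _ = M ^ n := by rw [mul_one, ← pow_add, Nat.add_sub_cancel' hi']
    · rw [Finset.card_range, nsmul_eq_mul]
  by_contra! hlt
  have hMp : 0 < M := by
    refine hM.lt_of_ne fun h => ?_
    have h1 := hpow 1
    rw [← h, pow_one, pow_one, mul_zero] at h1
    linarith
  obtain ⟨n, hn⟩ := Real.exists_natCast_add_one_lt_pow_of_one_lt ((one_lt_div hMp).mpr hlt)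
  rw [div_pow, lt_div_iff₀ (by positivity)] at hn
  have := hpow n
  push_cast at this
  linarith

lemma coordSub_eq_add (a b : k) : D.coordSub b = D.coordSub a + algebraMap k D.Fun (a - b) := by
  rw [coordSub, coordSub, map_sub]
  ring

lemma coordSub_le_max (p : BerkPoint D) (a b : k) :
    p.toFun (D.coordSub b) ≤ max (p.toFun (D.coordSub a)) ‖a - b‖ := by
  rw [coordSub_eq_add a b, ← p.map_const]
  exact p.add_le_max _ _

lemma norm_sub_le_max (p : BerkPoint D) (a b : k) :
    ‖a - b‖ ≤ max (p.toFun (D.coordSub a)) (p.toFun (D.coordSub b)) := by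
  have e : algebraMap k D.Fun (a - b) = D.coordSub b + -D.coordSub a := by
    rw [coordSub_eq_add a b]
    ring
  rw [← p.map_const, e, max_comm]
  refine (p.add_le_max _ _).trans (le_of_eq ?_)
  congr 1
  exact p.neg' _

lemma coordSub_lt_radius (p : BerkPoint D) (y : D.pts) : p.toFun (D.coordSub y) < D.radius := by
  obtain ⟨t, ht, hb⟩ := p.bounded
  refine (hb (D.coordSub y) (max t ‖D.center - y‖) fun z hz => ?_).trans_lt (max_lt ht ?_)
  · rw [coordSub_apply]
    exact norm_sub_le_max_of_le hz
  · rw [norm_sub_rev, ← dist_eq_norm]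
    exact y.2

lemma abs_sub_le (p : BerkPoint D) (f g : D.Fun) : |p.toFun f - p.toFun g| ≤ p.toFun (f - g) :=
  abs_sub_map_le_sub p.toMulRingSeminorm f g

lemma map_aeval (p : BerkPoint D) (P : k[X]) : p.toFun (aeval D.coord P) =
    ‖P.leadingCoeff‖ * (P.roots.map fun a => p.toFun (D.coordSub a)).prod := by
  conv_lhs => rw [(IsAlgClosed.splits P).eq_prod_roots]
  rw [_root_.map_mul, p.map_mul, aeval_C, p.map_const]
  congr 1
  induction P.roots using Multiset.induction_on with
  | empty =>
    rw [Multiset.map_zero, Multiset.map_zero, Multiset.prod_zero, Multiset.prod_zero, map_one]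
    exact p.map_one'
  | cons a s ih =>
    simp only [Multiset.map_cons, Multiset.prod_cons]
    rw [_root_.map_mul, p.map_mul, ih, coordSub_eq_aeval]

end BerkPoint

variable {D : OpenDisc k}

/-- The Shilov point of the closed disc with centre `z` and radius `τ`. -/
def OpenDisc.shilovPoint (D : OpenDisc k) (z : D.pts) (τ : ℝ) (hτ : τ ∈ Set.Ico 0 D.radius) :
    BerkPoint D where
  toFun := D.supNorm z τ
  map_zero' := by
    rw [← map_zero (algebraMap k D.Fun), supNorm_algebraMap _ hτ.1, norm_zero]
  add_le' f g := (supNorm_add_le f g hτ.1 hτ.2).trans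
    (max_le_add_of_nonneg (supNorm_nonneg _) (supNorm_nonneg _))
  neg' f := by
    unfold supNorm
    exact iSup_congr fun w => norm_neg _
  map_one' := by
    rw [← map_one (algebraMap k D.Fun), supNorm_algebraMap _ hτ.1, norm_one]
  map_mul' f g := supNorm_mul f g hτ.1 hτ.2
  map_const c := supNorm_algebraMap c hτ.1
  bounded := by
    refine ⟨max τ ‖(z : k) - D.center‖, max_lt hτ.2 ?_, fun g C h =>
      supNorm_le hτ.1 fun w hw => h w (norm_sub_le_max_of_le hw)⟩
    rw [← dist_eq_norm]
    exact z.2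

lemma OpenDisc.shilovPoint_toFun (z : D.pts) {τ : ℝ} (hτ : τ ∈ Set.Ico 0 D.radius) (g : D.Fun) :
    (D.shilovPoint z τ hτ).toFun g = D.supNorm z τ g := rfl

lemma BerkPoint.isInducing : Topology.IsInducing fun (p : BerkPoint D) (g : D.Fun) => p.toFun g :=
  ⟨rfl⟩

lemma OpenDisc.continuous_shilovPoint (z : D.pts) :
    Continuous fun τ : Set.Ico 0 D.radius => D.shilovPoint z τ τ.2 := by
  rw [BerkPoint.isInducing.continuous_iff, continuous_pi_iff]
  exact fun g => (continuousOn_supNorm z g).domRestrict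

/-- Shilov points do not depend on the choice of the centre. -/
lemma OpenDisc.shilovPoint_eq {z w : D.pts} {τ : ℝ} (hτ : τ ∈ Set.Ico 0 D.radius)
    (h : ‖(z : k) - w‖ ≤ τ) : D.shilovPoint z τ hτ = D.shilovPoint w τ hτ := by
  have e : D.supNorm z τ = D.supNorm w τ := by
    funext g
    refine le_antisymm (supNorm_le hτ.1 fun x hx => norm_le_supNorm g hτ.2 ?_)
      (supNorm_le hτ.1 fun x hx => norm_le_supNorm g hτ.2 ?_)
    · exact (norm_sub_le_max_of_le hx).trans (max_le le_rfl h)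
    · exact (norm_sub_le_max_of_le hx).trans (max_le le_rfl (by rwa [norm_sub_rev]))
  simp only [shilovPoint, e]

/-- The points of the Berkovich disc with centre `y` and radius `R`. -/
def berkDisc (D : OpenDisc k) (y : D.pts) (R : ℝ) : Set (BerkPoint D) :=
  {p | p.toFun (D.coordSub y) < R}

lemma isOpen_berkDisc (y : D.pts) (R : ℝ) : IsOpen (berkDisc D y R) := by
  have : Continuous fun p : BerkPoint D => p.toFun (D.coordSub y) :=
    (continuous_apply (D.coordSub y)).comp BerkPoint.isInducing.continuous
  exact isOpen_lt this continuous_const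

/-- The Shilov points of the closed discs in the open disc with centre `y` and radius `R`. -/
def shilovSet (D : OpenDisc k) (y : D.pts) (R : ℝ) : Set (BerkPoint D) :=
  {p | ∃ (z : D.pts) (τ : ℝ) (hτ : τ ∈ Set.Ico 0 D.radius), ‖(z : k) - y‖ < R ∧ τ < R ∧
    D.shilovPoint z τ hτ = p}

lemma shilovSet_subset_berkDisc (y : D.pts) (R : ℝ) : shilovSet D y R ⊆ berkDisc D y R := by
  rintro _ ⟨z, τ, hτ, hz, hτR, rfl⟩
  change D.supNorm z τ (D.coordSub y) < R
  rw [supNorm_coordSub z _ hτ.1 hτ.2]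
  exact max_lt hτR hz

lemma isPreconnected_shilovSet (y : D.pts) {R : ℝ} (hR : 0 < R) (hRD : R ≤ D.radius) :
    IsPreconnected (shilovSet D y R) := by
  -- the path of Shilov points of the discs with a given centre
  have hIco : ∀ τ, τ ∈ Set.Ico 0 R → τ ∈ Set.Ico 0 D.radius := fun τ h => ⟨h.1, h.2.trans_le hRD⟩
  let P : D.pts → Set (BerkPoint D) := fun z =>
    Set.range fun τ : Set.Ico 0 R => D.shilovPoint z τ (hIco τ τ.2)
  have hP : ∀ z, IsPreconnected (P z) := fun z => by
    have : PreconnectedSpace (Set.Ico (0 : ℝ) R) :=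
      isPreconnected_iff_preconnectedSpace.mp isPreconnected_Ico
    refine isPreconnected_range ?_
    exact (continuous_shilovPoint z).comp (continuous_subtype_val.subtype_mk fun τ => hIco τ τ.2)
  have hPs : ∀ z : D.pts, ‖(z : k) - y‖ < R → P z ⊆ shilovSet D y R := by
    rintro z hz _ ⟨τ, rfl⟩
    exact ⟨z, τ, _, hz, τ.2.2, rfl⟩
  have h0 : (0 : ℝ) ∈ Set.Ico 0 R := ⟨le_rfl, hR⟩
  refine isPreconnected_of_forall (D.shilovPoint y 0 (hIco 0 h0)) ?_
  rintro _ ⟨z, τ, hτ, hz, hτR, rfl⟩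
  have hz' : ‖(z : k) - y‖ ∈ Set.Ico 0 R := ⟨norm_nonneg _, hz⟩
  refine ⟨P y ∪ P z, Set.union_subset (hPs y (by simpa using hR)) (hPs z hz),
    Or.inl ⟨⟨0, h0⟩, rfl⟩, Or.inr ⟨⟨τ, hτ.1, hτR⟩, rfl⟩, ?_⟩
  exact IsPreconnected.union (D.shilovPoint y ‖(z : k) - y‖ (hIco _ hz')) ⟨⟨_, hz'⟩, rfl⟩
    ⟨⟨_, hz'⟩, shilovPoint_eq _ le_rfl⟩ (hP y) (hP z)

/-- On finitely many polynomials, every point of a Berkovich disc agrees with a Shilov point: the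
one of the smallest disc around a root which contains the point. -/
lemma exists_shilovPoint_eq (y : D.pts) {R : ℝ} (hRD : R ≤ D.radius) {p : BerkPoint D}
    (hp : p ∈ berkDisc D y R) (T : Finset k[X]) :
    ∃ (z : D.pts) (τ : ℝ) (hτ : τ ∈ Set.Ico 0 D.radius),
      ‖(z : k) - y‖ ≤ p.toFun (D.coordSub y) ∧ τ ≤ p.toFun (D.coordSub y) ∧
      ∀ P ∈ T, (D.shilovPoint z τ hτ).toFun (aeval D.coord P) = p.toFun (aeval D.coord P) := by
  classical
  let S : Finset k := insert (y : k) (T.biUnion fun P => P.roots.toFinset)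
  obtain ⟨a, -, ha⟩ := S.exists_min_image (fun a => p.toFun (D.coordSub a))
    ⟨y, Finset.mem_insert_self _ _⟩
  have hay := ha y (Finset.mem_insert_self _ _)
  have hayn : ‖a - y‖ ≤ p.toFun (D.coordSub y) := (p.norm_sub_le_max a y).trans (max_le hay le_rfl)
  have hpy : p.toFun (D.coordSub y) < R := hp
  have haD : a ∈ D.pts := (mem_pts_iff y a).mpr (hayn.trans_lt (hpy.trans_le hRD))
  have hτ : p.toFun (D.coordSub a) ∈ Set.Ico 0 D.radius :=
    ⟨p.nonneg _, hay.trans_lt (hpy.trans_le hRD)⟩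
  refine ⟨⟨a, haD⟩, _, hτ, hayn, hay, fun P hP => ?_⟩
  rw [BerkPoint.map_aeval, BerkPoint.map_aeval]
  congr 2
  refine Multiset.map_congr rfl fun b hb => ?_
  have hab := ha b (Finset.mem_insert_of_mem
    (Finset.mem_biUnion.mpr ⟨P, hP, Multiset.mem_toFinset.mpr hb⟩))
  rw [shilovPoint_toFun, supNorm_coordSub _ _ hτ.1 hτ.2]
  exact le_antisymm (max_le hab ((p.norm_sub_le_max a b).trans (max_le hab le_rfl)))
    (p.coordSub_le_max a b)

/-- The Shilov points of closed discs are dense in a Berkovich disc. -/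
lemma berkDisc_subset_closure (y : D.pts) {R : ℝ} (hRD : R ≤ D.radius) :
    berkDisc D y R ⊆ closure (shilovSet D y R) := by
  classical
  intro p hp
  have hpy : p.toFun (D.coordSub y) < R := hp
  rw [BerkPoint.isInducing.closure_eq_preimage_closure_image, Set.mem_preimage, mem_closure_iff]
  intro o ho hpo
  obtain ⟨I, U, hU, hIU⟩ := isOpen_pi_iff.mp ho _ hpo
  have hε : ∀ g : D.Fun, ∃ ε > 0, g ∈ I → Metric.ball (p.toFun g) ε ⊆ U g := by
    intro g
    by_cases hg : g ∈ I
    · obtain ⟨ε, h1, h2⟩ := Metric.isOpen_iff.mp (hU g hg).1 _ (hU g hg).2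
      exact ⟨ε, h1, fun _ => h2⟩
    · exact ⟨1, one_pos, fun h => absurd h hg⟩
  choose ε hε hεU using hε
  obtain ⟨t, ht, hb⟩ := p.bounded
  -- a closed disc which contains all discs in question
  let t' := max t (max (p.toFun (D.coordSub y)) ‖(y : k) - D.center‖)
  have hyc : ‖(y : k) - D.center‖ < D.radius := by
    rw [← dist_eq_norm]
    exact y.2
  have ht' : t' < D.radius := max_lt ht (max_lt (hpy.trans_le hRD) hyc)
  choose P hP using fun g : D.Fun => exists_poly_approx g.2
    ⟨D.center, Metric.mem_ball_self D.radius_pos⟩ ht' (half_pos (half_pos (hε g)))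
  obtain ⟨z, τ, hτ, hz, hτp, hq⟩ := exists_shilovPoint_eq y hRD hp (I.image P)
  refine ⟨_, hIU ?_, ⟨D.shilovPoint z τ hτ,
    ⟨z, τ, hτ, hz.trans_lt hpy, hτp.trans_lt hpy, rfl⟩, rfl⟩⟩
  intro g hg
  refine hεU g hg ?_
  have h1 : p.toFun (g - aeval D.coord (P g)) ≤ ε g / 2 / 2 := by
    refine hb _ _ fun w hw => ?_
    rw [Fun.sub_apply, aeval_coord_apply]
    exact hP g w (hw.trans (le_max_left _ _))
  have h2 : (D.shilovPoint z τ hτ).toFun (g - aeval D.coord (P g)) ≤ ε g / 2 / 2 := by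
    refine supNorm_le hτ.1 fun w hw => ?_
    rw [Fun.sub_apply, aeval_coord_apply]
    refine hP g w (le_trans (norm_sub_le_max_of_le (hw.trans hτp)) ?_)
    refine max_le ((le_max_left _ _).trans (le_max_right _ _)) ?_
    exact (norm_sub_le_max_of_le hz).trans (le_max_right _ _)
  have h3 := (p.abs_sub_le _ _).trans h1
  have h4 := ((D.shilovPoint z τ hτ).abs_sub_le _ _).trans h2
  rw [hq (P g) (Finset.mem_image_of_mem P hg)] at h4
  rw [Metric.mem_ball, Real.dist_eq, abs_lt]
  rw [abs_le] at h3 h4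
  have := hε g
  constructor <;> linarith [h3.1, h3.2, h4.1, h4.2]

lemma isPreconnected_berkDisc (y : D.pts) {R : ℝ} (hR : 0 < R) (hRD : R ≤ D.radius) :
    IsPreconnected (berkDisc D y R) :=
  (isPreconnected_shilovSet y hR hRD).subset_closure (shilovSet_subset_berkDisc y R)
    (berkDisc_subset_closure y hRD)

/-- The fibres of a surjective locally constant map are the connected components if they are
preconnected. -/
lemma natCard_connectedComponents_eq {X Y : Type*} [TopologicalSpace X] {c : X → Y}
    (hc : IsLocallyConstant c) (hs : Function.Surjective c) (hp : ∀ y, IsPreconnected (c ⁻¹' {y})) :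
    Nat.card (ConnectedComponents X) = Nat.card Y := by
  let F : ConnectedComponents X → Y := Quotient.lift c fun a b hab =>
    hc.apply_eq_of_isPreconnected isPreconnected_connectedComponent mem_connectedComponent
      (show b ∈ connectedComponent a from (show connectedComponent a = connectedComponent b from
        hab) ▸ mem_connectedComponent)
  refine Nat.card_eq_of_bijective F ⟨?_, fun y => ?_⟩
  · rintro ⟨a⟩ ⟨b⟩ hab
    have hab' : c a = c b := hab
    exact ConnectedComponents.coe_eq_coe'.mpr
      ((hp (c b)).subset_connectedComponent (x := b) rfl hab')
  · obtain ⟨a, rfl⟩ := hs y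
    exact ⟨(a : ConnectedComponents X), rfl⟩

/-- The open discs of radius `R` around the points of `F`. -/
def discsAround (F : Finset D.pts) (R : ℝ) : Finset (Set k) :=
  letI := Classical.decEq (Set k)
  F.image fun y : D.pts => Metric.ball (y : k) R

lemma mem_discsAround {F : Finset D.pts} {R : ℝ} {b : Set k} :
    b ∈ discsAround F R ↔ ∃ y ∈ F, Metric.ball (y : k) R = b := by
  classical
  simp [discsAround]

lemma ball_eq_iff {R : ℝ} (hR : 0 < R) (a b : k) :
    Metric.ball a R = Metric.ball b R ↔ ‖a - b‖ < R := by
  rw [← dist_eq_norm]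
  constructor
  · intro h
    have : a ∈ Metric.ball b R := h ▸ Metric.mem_ball_self hR
    exact this
  · exact fun h => (IsUltrametricDist.ball_eq_of_mem (show a ∈ Metric.ball b R from h)).symm

namespace Morphism

variable {D₂ D₁ : OpenDisc k} {φ : Morphism D₂ D₁} {f : ℝ → ℝ}

/-- The connected components of the preimage of the disc with centre `x` and radius `f(σ)` are the
discs of radius `σ` around the points of the fibre over `x`. -/
lemma IsFiniteEtale.N_eq (hφ : φ.IsFiniteEtale) (hf : φ.IsRadialWithProfile f) (x : D₁.pts) {σ : ℝ}
    (hσ0 : 0 < σ) (hσ1 : σ ≤ 1) :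
    φ.N x (f σ) = (discsAround (hφ.fiber x) (σ * D₂.radius)).card := by
  classical
  have := D₂.nonempty_pts
  set R := σ * D₂.radius with hRdef
  have hR : 0 < R := mul_pos hσ0 D₂.radius_pos
  have hRD : R ≤ D₂.radius := by
    have := D₂.radius_pos
    nlinarith
  have hX : ∀ p : BerkPoint D₂, p ∈ φ.preimageDisc x (f σ) ↔
      ∃ y ∈ hφ.fiber x, p.toFun (D₂.coordSub y) < R := by
    intro p
    rw [← hφ.prod_lt_iff hf x (fun y => p.nonneg (D₂.coordSub y)) p.coordSub_lt_radius
      (fun y y' => p.coordSub_le_max y y') (fun y y' => p.norm_sub_le_max y y') hσ0 hσ1,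
      ← hφ.berk_pullback_coordSub]
    rfl
  choose! Y hYF hYR using fun p => (hX p).mp
  have hball : ∀ (p : BerkPoint D₂) (y y' : D₂.pts), p.toFun (D₂.coordSub y) < R →
      p.toFun (D₂.coordSub y') < R → Metric.ball (y : k) R = Metric.ball (y' : k) R :=
    fun p y y' h h' => (ball_eq_iff hR _ _).mpr ((p.norm_sub_le_max y y').trans_lt (max_lt h h'))
  let c : φ.preimageDisc x (f σ) → discsAround (hφ.fiber x) R := fun p =>
    ⟨Metric.ball (Y p : k) R, mem_discsAround.mpr ⟨Y p, hYF p p.2, rfl⟩⟩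
  have hcy : ∀ (p : φ.preimageDisc x (f σ)) (y : D₂.pts) (hy : y ∈ hφ.fiber x),
      c p = ⟨Metric.ball (y : k) R, mem_discsAround.mpr ⟨y, hy, rfl⟩⟩ ↔
        p.1.toFun (D₂.coordSub y) < R := by
    intro p y hy
    rw [Subtype.ext_iff]
    change Metric.ball (Y p : k) R = Metric.ball (y : k) R ↔ _
    constructor
    · intro h
      exact (p.1.coordSub_le_max (Y p) y).trans_lt
        (max_lt (hYR p p.2) ((ball_eq_iff hR _ _).mp h))
    · exact fun h => hball p (Y p) y (hYR p p.2) h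
  have hfib : ∀ (y : D₂.pts) (hy : y ∈ hφ.fiber x),
      c ⁻¹' {⟨Metric.ball (y : k) R, mem_discsAround.mpr ⟨y, hy, rfl⟩⟩} =
        Subtype.val ⁻¹' berkDisc D₂ y R := by
    intro y hy
    ext p
    exact hcy p y hy
  have hcard : Nat.card (discsAround (hφ.fiber x) R) = (discsAround (hφ.fiber x) R).card := by
    rw [Nat.card_eq_fintype_card, Fintype.card_coe]
  rw [← hcard, N]
  refine natCard_connectedComponents_eq (c := c) ?_ ?_ ?_
  · rw [IsLocallyConstant.iff_isOpen_fiber]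
    rintro ⟨b, hb⟩
    obtain ⟨y, hy, rfl⟩ := mem_discsAround.mp hb
    rw [hfib y hy]
    exact (isOpen_berkDisc y R).preimage continuous_subtype_val
  · rintro ⟨b, hb⟩
    obtain ⟨y, hy, rfl⟩ := mem_discsAround.mp hb
    have h0 : (0 : ℝ) ∈ Set.Ico 0 D₂.radius := ⟨le_rfl, D₂.radius_pos⟩
    have hlt : (D₂.shilovPoint y 0 h0).toFun (D₂.coordSub y) < R := by
      rw [shilovPoint_toFun, supNorm_coordSub y _ le_rfl D₂.radius_pos]
      simpa using hR
    exact ⟨⟨_, (hX _).mpr ⟨y, hy, hlt⟩⟩, (hcy _ y hy).mpr hlt⟩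
  · rintro ⟨b, hb⟩
    obtain ⟨y, hy, rfl⟩ := mem_discsAround.mp hb
    have hsub : berkDisc D₂ y R ⊆ φ.preimageDisc x (f σ) := fun p hp => (hX p).mpr ⟨y, hy, hp⟩
    rw [hfib y hy, ← Topology.IsInducing.subtypeVal.isPreconnected_image,
      Subtype.image_preimage_coe, Set.inter_eq_right.mpr hsub]
    exact isPreconnected_berkDisc y hR hRD

end Morphism

end Berkovich

/-! ### Base change of a module along a product decomposition -/

section ProductDecomposition

variable {A B R E ι : Type*} {V : ι → Type*} [CommRing A] [CommRing B] [CommRing R]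
  [∀ i, CommRing (V i)] [Algebra A B] [Algebra A R] [∀ i, Algebra B (V i)]
  [∀ i, Algebra R (V i)] [AddCommGroup E] [Module A E] [Module B E] [IsScalarTower A B E]
  (hcomm : ∀ i a, algebraMap R (V i) (algebraMap A R a) = algebraMap B (V i) (algebraMap A B a))

/-- The map `R ⊗_A E → V_i ⊗_B E`, `a ⊗ e ↦ a ⊗ e`. -/
def compMap (i : ι) : R ⊗[A] E →+ V i ⊗[B] E :=
  TensorProduct.liftAddHom
    (AddMonoidHom.mk' (fun a => AddMonoidHom.mk' (fun e => algebraMap R (V i) a ⊗ₜ[B] e)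
        (fun e e' => TensorProduct.tmul_add _ _ _))
      (fun a a' => by
        ext e
        simp [TensorProduct.add_tmul]))
    (fun a r e => by
      simp only [AddMonoidHom.mk'_apply]
      rw [Algebra.smul_def, map_mul, hcomm, ← Algebra.smul_def, TensorProduct.smul_tmul,
        algebraMap_smul])

lemma compMap_tmul (i : ι) (a : R) (e : E) :
    compMap hcomm i (a ⊗ₜ[A] e) = algebraMap R (V i) a ⊗ₜ[B] e := rfl

lemma compMap_smul (i : ι) (a : R) (t : R ⊗[A] E) :
    compMap hcomm i (a • t) = algebraMap R (V i) a • compMap hcomm i t := by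
  induction t using TensorProduct.induction_on with
  | zero => simp
  | add s t hs ht => rw [smul_add, map_add, map_add, hs, ht, smul_add]
  | tmul b e =>
    rw [TensorProduct.smul_tmul', compMap_tmul, compMap_tmul, smul_eq_mul, map_mul,
      TensorProduct.smul_tmul', smul_eq_mul]

/-- The map `R ⊗_A B → V_i`, `a ⊗ b ↦ ab`. -/
def multMap (i : ι) : R ⊗[A] B →+ V i :=
  TensorProduct.liftAddHom
    (AddMonoidHom.mk' (fun a => AddMonoidHom.mk'
        (fun b => algebraMap R (V i) a * algebraMap B (V i) b) (fun b b' => by rw [map_add, mul_add]))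
      (fun a a' => by
        ext b
        simp [add_mul]))
    (fun a r b => by
      simp only [AddMonoidHom.mk'_apply]
      rw [Algebra.smul_def, map_mul, hcomm, Algebra.smul_def, map_mul]
      ring)

lemma multMap_tmul (i : ι) (a : R) (b : B) :
    multMap hcomm i (a ⊗ₜ[A] b) = algebraMap R (V i) a * algebraMap B (V i) b := rfl

lemma multMap_mul (i : ι) (s t : R ⊗[A] B) :
    multMap hcomm i (s * t) = multMap hcomm i s * multMap hcomm i t := by
  induction s using TensorProduct.induction_on with
  | zero => simp
  | add s s' hs hs' => rw [add_mul, map_add, map_add, hs, hs', add_mul]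
  | tmul a b =>
    induction t using TensorProduct.induction_on with
    | zero => simp
    | add t t' ht ht' => rw [mul_add, map_add, map_add, ht, ht', mul_add]
    | tmul a' b' =>
      simp only [Algebra.TensorProduct.tmul_mul_tmul, multMap_tmul, map_mul]
      ring

lemma multMap_lTensor (i : ι) (l : E →ₗ[B] B) (t : R ⊗[A] E) :
    multMap hcomm i ((l.restrictScalars A).lTensor R t) =
      TensorProduct.rid B (V i) (l.lTensor (V i) (compMap hcomm i t)) := by
  induction t using TensorProduct.induction_on with
  | zero => simp
  | add s t hs ht => simp only [map_add, hs, ht]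
  | tmul a e =>
    simp [compMap_tmul, multMap_tmul, Algebra.smul_def, mul_comm]

/-- If `R ⊗_A B → ∏ V_i` is injective, then so is `R ⊗_A E → ∏ V_i ⊗_B E` for projective `E`. -/
lemma compMap_injective [Module.Finite B E] [Module.Projective B E]
    (hinj : ∀ t : R ⊗[A] B, (∀ i, multMap hcomm i t = 0) → t = 0) {t : R ⊗[A] E}
    (ht : ∀ i, compMap hcomm i t = 0) : t = 0 := by
  obtain ⟨n, p, s, -, -, hps⟩ := Module.Finite.exists_comp_eq_id_of_projective B E
  -- a dual basis of `E`
  let l : Fin n → E →ₗ[B] B := fun j => (LinearMap.proj j).comp s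
  let m : Fin n → B →ₗ[B] E := fun j => p.comp (LinearMap.single B (fun _ => B) j)
  have hid : ∑ j, (m j).comp (l j) = LinearMap.id := by
    rw [← hps]
    ext e
    simp only [l, m, LinearMap.sum_apply, LinearMap.comp_apply, ← map_sum]
    congr 1
    ext i
    simp [Pi.single_apply]
  have h1 : ∀ j, (((l j).restrictScalars A).lTensor R) t = 0 := fun j => by
    refine hinj _ fun i => ?_
    rw [multMap_lTensor, ht i]
    simp
  have h2 : (∑ j, (((m j).comp (l j)).restrictScalars A).lTensor R) t = t := by
    have h3 : ∑ j, (((m j).comp (l j)).restrictScalars A) = (LinearMap.id : E →ₗ[A] E) := by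
      ext e
      have := LinearMap.congr_fun hid e
      simpa using this
    have h4 := congrArg (LinearMap.lTensor R) h3
    rw [LinearMap.lTensor_id] at h4
    have h5 : ∑ j, (((m j).comp (l j)).restrictScalars A).lTensor R =
        LinearMap.lTensor R (∑ j, (((m j).comp (l j)).restrictScalars A)) :=
      (map_sum (LinearMap.lTensorHom R) _ _).symm
    rw [h5, h4]
    rfl
  rw [← h2, LinearMap.sum_apply]
  refine Finset.sum_eq_zero fun j _ => ?_
  have h6 : (((m j).comp (l j)).restrictScalars A) =
      ((m j).restrictScalars A).comp ((l j).restrictScalars A) := rfl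
  rw [h6, LinearMap.lTensor_comp, LinearMap.comp_apply, h1 j, map_zero]

/-- If `R ⊗_A B → ∏ V_i` is surjective, then so is `R ⊗_A E → ∏ V_i ⊗_B E`. -/
lemma compMap_surjective [Fintype ι] [DecidableEq ι]
    (hsurj : ∀ i (w : V i), ∃ t : R ⊗[A] B, ∀ j, multMap hcomm j t = Pi.single i w j)
    (w : ∀ i, V i ⊗[B] E) : ∃ t : R ⊗[A] E, ∀ i, compMap hcomm i t = w i := by
  -- the elements `(δ_{ij} w ⊗ e)_j` generate the target and are easily lifted
  have key : ∀ i (w : V i ⊗[B] E), ∃ t : R ⊗[A] E,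
      ∀ j, compMap hcomm j t = (Pi.single i w : ∀ j, V j ⊗[B] E) j := by
    intro i w
    induction w using TensorProduct.induction_on with
    | zero => exact ⟨0, fun j => by simp⟩
    | add s t hs ht =>
      obtain ⟨s', hs'⟩ := hs
      obtain ⟨t', ht'⟩ := ht
      exact ⟨s' + t', fun j => by rw [map_add, hs', ht', Pi.single_add, Pi.add_apply]⟩
    | tmul w e =>
      obtain ⟨t, ht⟩ := hsurj i w
      have h1 : ∀ (t : R ⊗[A] B) (j : ι), compMap hcomm j
          ((((LinearMap.toSpanSingleton B E e).restrictScalars A).lTensor R) t) =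
          multMap hcomm j t ⊗ₜ[B] e := by
        intro t j
        induction t using TensorProduct.induction_on with
        | zero => simp
        | add s t hs ht => rw [map_add, map_add, map_add, hs, ht, TensorProduct.add_tmul]
        | tmul a b =>
          rw [LinearMap.lTensor_tmul, compMap_tmul, multMap_tmul]
          simp only [LinearMap.coe_restrictScalars, LinearMap.toSpanSingleton_apply]
          rw [← TensorProduct.smul_tmul, Algebra.smul_def, mul_comm]
      refine ⟨_, fun j => (h1 t j).trans ?_⟩
      rw [ht j]
      rcases eq_or_ne j i with rfl | h
      · simp
      · simp [Pi.single_eq_of_ne h]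
  choose t ht using fun i => key i (w i)
  refine ⟨∑ i, t i, fun j => ?_⟩
  rw [map_sum, Finset.sum_congr rfl fun i _ => ht i j, ← Finset.sum_apply,
    Finset.univ_sum_single]

end ProductDecomposition

/-! ### The preimage of a disc as a disjoint union of discs -/

section Splitting

open Polynomial Filter Topology

variable {k : Type u} [NontriviallyNormedField k] [IsUltrametricDist k] [CompleteSpace k]
  [IsAlgClosed k]

open OpenDisc

namespace Morphism

variable {D₂ D₁ : OpenDisc k} {φ : Morphism D₂ D₁} {f : ℝ → ℝ}

/-- The preimage of the disc with centre `x` and normalised radius `s` is the union of the discs of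
normalised radius `σ < 1` around the points of `J`. The distances between these discs are larger
than their radii, and `φ` induces proper maps from these discs to the given one. -/
structure Splits (φ : Morphism D₂ D₁) (x : D₁.pts) (s σ : ℝ) (J : Finset D₂.pts) : Prop where
  s_pos : 0 < s
  s_le : s ≤ 1
  σ_pos : 0 < σ
  σ_lt : σ < 1
  mem_iff : ∀ z, ‖(φ.toFun z : k) - x‖ < s * D₁.radius ↔ ∃ y ∈ J, ‖(z : k) - y‖ < σ * D₂.radius
  separated : ∀ y ∈ J, ∀ y' ∈ J, y ≠ y' → σ * D₂.radius < ‖(y : k) - y'‖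
  proper : ∀ t < s * D₁.radius, ∃ τ < σ * D₂.radius, ∀ y ∈ J, ∀ z : D₂.pts,
    ‖(z : k) - y‖ < σ * D₂.radius → ‖(φ.toFun z : k) - x‖ ≤ t → ‖(z : k) - y‖ ≤ τ
  bounded : ∀ τ < σ * D₂.radius, ∃ t < s * D₁.radius, ∀ y ∈ J, ∀ z : D₂.pts,
    ‖(z : k) - y‖ ≤ τ → ‖(φ.toFun z : k) - x‖ ≤ t

/-- A finite set of numbers smaller than `b` is bounded by a number smaller than `b`. -/
lemma exists_lt_forall_le {α : Type*} (S : Finset α) (g : α → ℝ) (b : ℝ) :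
    ∃ τ < b, ∀ a ∈ S, g a < b → g a ≤ τ := by
  have h : ∀ a ∈ S, ∀ᶠ τ in 𝓝[<] b, g a < b → g a ≤ τ := fun a _ => by
    by_cases hab : g a < b
    · filter_upwards [Ioo_mem_nhdsLT hab] with τ hτ _ using hτ.1.le
    · exact Eventually.of_forall fun _ h => absurd h hab
  obtain ⟨τ, h1, h2⟩ := (((Filter.eventually_all_finset S).mpr h).and
    (eventually_mem_nhdsWithin (a := b) (s := Set.Iio b))).exists
  exact ⟨τ, h2, h1⟩

/-- For all but finitely many radii, the preimage of a disc splits. -/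
lemma IsFiniteEtale.exists_splits (hφ : φ.IsFiniteEtale) (hf : φ.IsRadialWithProfile f) (x : D₁.pts)
    {σ : ℝ} (hσ0 : 0 < σ) (hσ1 : σ < 1)
    (hgen : ∀ y ∈ hφ.fiber x, ∀ y' ∈ hφ.fiber x, ‖(y : k) - y'‖ ≠ σ * D₂.radius) :
    ∃ J ⊆ hφ.fiber x, φ.Splits x (f σ) σ J ∧ J.card = φ.N x (f σ) := by
  classical
  set F := hφ.fiber x with hF
  set R := σ * D₂.radius with hRdef
  have hR : 0 < R := mul_pos hσ0 D₂.radius_pos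
  have hσm : σ ∈ Set.Icc (0 : ℝ) 1 := ⟨hσ0.le, hσ1.le⟩
  have h0m : (0 : ℝ) ∈ Set.Icc (0 : ℝ) 1 := by simp
  have h1m : (1 : ℝ) ∈ Set.Icc (0 : ℝ) 1 := by simp
  have hmono := hφ.profile_strictMonoOn hf x
  have := D₂.nonempty_pts
  choose! rep hrepF hrep using (fun b hb => mem_discsAround.mp hb :
    ∀ b ∈ discsAround F R, ∃ y ∈ F, Metric.ball (y : k) R = b)
  have hinj : Set.InjOn rep (discsAround F R) := fun b hb b' hb' h => by
    rw [← hrep b hb, ← hrep b' hb', h]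
  have hlt : ∀ (σ' : ℝ), 0 < σ' → σ' ≤ 1 → ∀ z : D₂.pts,
      ‖(φ.toFun z : k) - x‖ < f σ' * D₁.radius ↔ ∃ y ∈ F, ‖(z : k) - y‖ < σ' * D₂.radius := by
    intro σ' h0 h1 z
    rw [hφ.norm_toFun_sub]
    refine hφ.prod_lt_iff hf x (N := fun y => ‖(z : k) - y‖) (fun y => norm_nonneg _)
      (fun y => norm_sub_lt y z) (fun y y' => norm_sub_le_max_of_le le_rfl) (fun y y' => ?_) h0 h1
    rw [norm_sub_rev (z : k) y]
    exact norm_sub_le_max_of_le le_rfl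
  have hsmall : ∀ y ∈ F, ∃ j ∈ (discsAround F R).image rep, ‖(y : k) - j‖ < R := by
    intro y hy
    have hb : Metric.ball (y : k) R ∈ discsAround F R := mem_discsAround.mpr ⟨y, hy, rfl⟩
    refine ⟨_, Finset.mem_image_of_mem rep hb, ?_⟩
    rw [← ball_eq_iff hR]
    exact (hrep _ hb).symm
  have hJF : (discsAround F R).image rep ⊆ F := by
    intro j hj
    obtain ⟨b, hb, rfl⟩ := Finset.mem_image.mp hj
    exact hrepF b hb
  refine ⟨(discsAround F R).image rep, hJF, ⟨?_, ?_, hσ0, hσ1, ?_, ?_, ?_, ?_⟩, ?_⟩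
  · rw [← hφ.profile_zero hf x]
    exact hmono h0m hσm hσ0
  · rw [← hφ.profile_one hf x]
    exact (hmono hσm h1m hσ1).le
  · intro z
    rw [hlt σ hσ0 hσ1.le]
    constructor
    · rintro ⟨y, hy, hz⟩
      obtain ⟨j, hj, hyj⟩ := hsmall y hy
      exact ⟨j, hj, (norm_sub_le_max_of_le le_rfl).trans_lt (max_lt hz hyj)⟩
    · rintro ⟨j, hj, hz⟩
      exact ⟨j, hJF hj, hz⟩
  · intro y hy y' hy' hne
    refine lt_of_le_of_ne ?_ (hgen y (hJF hy) y' (hJF hy')).symm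
    by_contra! h
    obtain ⟨b, hb, rfl⟩ := Finset.mem_image.mp hy
    obtain ⟨b', hb', rfl⟩ := Finset.mem_image.mp hy'
    refine hne (congrArg rep ?_)
    rw [← hrep b hb, ← hrep b' hb']
    exact (ball_eq_iff hR _ _).mpr h
  · intro t ht
    -- a slightly smaller radius, the image of which is still larger than `t`
    obtain ⟨σ', hσ', hσ'0, hσ't⟩ : ∃ σ' < σ, 0 < σ' ∧ t < f σ' * D₁.radius := by
      have h1 : ContinuousWithinAt f (Set.Iio σ) σ := by
        have h2 := hφ.profile_continuousOn hf x σ hσm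
        exact ((h2.continuousAt (Icc_mem_nhds hσ0 hσ1))).continuousWithinAt
      have h3 : ∀ᶠ σ' in 𝓝[<] σ, t < f σ' * D₁.radius :=
        (h1.mul continuousWithinAt_const).eventually_const_lt ht
      obtain ⟨σ', h4, h5⟩ := (h3.and (Ioo_mem_nhdsLT hσ0)).exists
      exact ⟨σ', h5.2, h5.1, h4⟩
    obtain ⟨τ, hτ, hτF⟩ := exists_lt_forall_le (F ×ˢ F) (fun p => ‖(p.1 : k) - p.2‖) R
    refine ⟨max (σ' * D₂.radius) τ, max_lt ?_ hτ, fun y hy z hz hzt => ?_⟩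
    · exact mul_lt_mul_of_pos_right hσ' D₂.radius_pos
    · obtain ⟨y', hy', hzy'⟩ := (hlt σ' hσ'0 (hσ'.trans hσ1).le z).mp (hzt.trans_lt hσ't)
      refine (norm_sub_le_max_of_le hzy'.le).trans (max_le_max_left _ ?_)
      refine hτF (y', y) (Finset.mk_mem_product hy' (hJF hy)) ?_
      have h6 : ‖(y' : k) - z‖ ≤ R := by
        rw [norm_sub_rev]
        exact (hzy'.trans (mul_lt_mul_of_pos_right hσ' D₂.radius_pos)).le
      refine (norm_sub_le_max_of_le le_rfl).trans_lt (max_lt ?_ hz)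
      rw [norm_sub_rev]
      exact hzy'.trans (mul_lt_mul_of_pos_right hσ' D₂.radius_pos)
  · intro τ hτ
    have hρ := D₂.radius_pos
    refine ⟨f (max τ 0 / D₂.radius) * D₁.radius, ?_, fun y hy z hz => ?_⟩
    · refine mul_lt_mul_of_pos_right (hmono ⟨by positivity, ?_⟩ hσm ?_) D₁.radius_pos
      · rw [div_le_one hρ]
        exact max_le (hτ.le.trans (by nlinarith)) hρ.le
      · rw [div_lt_iff₀ hρ]
        exact max_lt hτ hR
    · have hmem : max τ 0 / D₂.radius ∈ Set.Icc (0 : ℝ) 1 := ⟨by positivity, by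
        rw [div_le_one hρ]
        exact max_le (hτ.le.trans (by nlinarith)) hρ.le⟩
      rw [hφ.norm_toFun_sub, hφ.profile_eqOn hf (hJF hy) hmem, mul_comm]
      refine mul_le_mul_of_nonneg_right (Finset.prod_le_prod (fun y' _ => by positivity)
        fun y' _ => ?_) D₁.radius_pos.le
      rw [max_div_div_right hρ.le]
      gcongr
      exact (norm_sub_le_max_of_le hz).trans (max_le_max_right _ (le_max_left _ _))
  · rw [hφ.N_eq hf x hσ0 hσ1.le, Finset.card_image_of_injOn hinj]

/-! ### Interpolation on the fibres -/

open Classical in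
/-- A Lagrange interpolation function for the fibre of `φ` through `y`: it takes the value `1` at `y`
and `0` at the other points of the fibre. -/
def IsFiniteEtale.lagrange (hφ : φ.IsFiniteEtale) (y : D₂.pts) : D₂.Fun :=
  algebraMap k D₂.Fun (∏ y' ∈ (hφ.fiber (φ.toFun y)).erase y, ((y : k) - y'))⁻¹ *
    ∏ y' ∈ (hφ.fiber (φ.toFun y)).erase y, D₂.coordSub y'

open Classical in
lemma IsFiniteEtale.lagrange_apply (hφ : φ.IsFiniteEtale) {x : D₁.pts}
    {y z : D₂.pts} (hy : y ∈ hφ.fiber x) (hz : z ∈ hφ.fiber x) :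
    (hφ.lagrange y).1 z = if z = y then 1 else 0 := by
  rw [mem_fiber] at hy
  have e : (hφ.lagrange y).1 z = (∏ y' ∈ (hφ.fiber x).erase y, ((y : k) - y'))⁻¹ *
      ∏ y' ∈ (hφ.fiber x).erase y, ((z : k) - y') := by
    change evalHom z (hφ.lagrange y) = _
    rw [lagrange, _root_.map_mul, map_prod, AlgHom.commutes, hy]
    simp only [evalHom_apply, coordSub_apply]
    rfl
  rw [e]
  split_ifs with h
  · subst h
    refine inv_mul_cancel₀ (Finset.prod_ne_zero_iff.mpr fun y' hy' => ?_)
    exact sub_ne_zero.mpr fun h => (Finset.mem_erase.mp hy').1 (Subtype.ext h.symm)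
  · exact mul_eq_zero_of_right _
      (Finset.prod_eq_zero (i := z) (Finset.mem_erase.mpr ⟨h, hz⟩) (sub_self (z : k)))

/-- An `𝒪(D₁)`-linear functional on `𝒪(D₂)` is computed fibre by fibre. -/
lemma IsFiniteEtale.functional_apply (hφ : φ.IsFiniteEtale) {μ : D₂.Fun →+ D₁.Fun}
    (hμ : ∀ a b, μ (φ.pullback a * b) = a * μ b) (b : D₂.Fun) (x : D₁.pts) :
    (μ b).1 x = ∑ y ∈ hφ.fiber x, b.1 y * (μ (hφ.lagrange y)).1 x := by
  classical
  have hμc : ∀ (c : k) (b : D₂.Fun), μ (algebraMap k D₂.Fun c * b) = algebraMap k D₁.Fun c * μ b :=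
    fun c b => by rw [← hμ, AlgHom.commutes]
  obtain ⟨q, hq⟩ := hφ.dvd_of_forall_eq_zero (x := x)
    (b := b - ∑ y ∈ hφ.fiber x, algebraMap k D₂.Fun (b.1 y) * hφ.lagrange y) (fun z hz => by
      change evalHom z (b - ∑ y ∈ hφ.fiber x, algebraMap k D₂.Fun (b.1 y) * hφ.lagrange y) = 0
      rw [map_sub, map_sum, sub_eq_zero, Finset.sum_eq_single_of_mem z (mem_fiber.mpr hz)]
      · rw [_root_.map_mul, AlgHom.commutes, evalHom_apply, evalHom_apply,
          hφ.lagrange_apply (mem_fiber.mpr hz) (mem_fiber.mpr hz), if_pos rfl, mul_one]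
        rfl
      · intro y hy hne
        rw [_root_.map_mul, evalHom_apply z (hφ.lagrange y),
          hφ.lagrange_apply hy (mem_fiber.mpr hz), if_neg hne.symm, mul_zero])
  have h := congrArg (fun g => evalHom x (μ g)) hq
  simp only [map_sub, map_sum, hμ, hμc, _root_.map_mul] at h
  have h0 : evalHom x (D₁.coordSub x) = 0 := sub_self _
  rw [h0, zero_mul, sub_eq_zero] at h
  refine h.trans (Finset.sum_congr rfl fun y _ => ?_)
  rfl

lemma d_coordSub {D : OpenDisc k} (a : k) : D.d (D.coordSub a) = 1 := by
  rw [coordSub, map_sub, d_coord, Derivation.map_algebraMap, sub_zero]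

open Classical in
lemma IsFiniteEtale.deriv_apply (hφ : φ.IsFiniteEtale) (y : D₂.pts) :
    φ.deriv.1 y = (hφ.unitFactor (φ.toFun y)).1 y *
      ∏ y' ∈ (hφ.fiber (φ.toFun y)).erase y, ((y : k) - y') := by
  set x := φ.toFun y with hx
  have h1 : φ.deriv = D₂.d (φ.pullback (D₁.coordSub x)) := by
    rw [coordSub, map_sub, map_sub, AlgHom.commutes, Derivation.map_algebraMap, sub_zero]
    rfl
  have hy : y ∈ hφ.fiber x := mem_fiber.mpr rfl
  rw [h1, hφ.pullback_coordSub, ← Finset.mul_prod_erase _ _ hy, mul_left_comm, Derivation.leibniz,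
    d_coordSub]
  change evalHom y (D₂.coordSub ↑y • D₂.d (hφ.unitFactor x *
    ∏ x ∈ (hφ.fiber x).erase y, D₂.coordSub ↑x) +
      (hφ.unitFactor x * ∏ x ∈ (hφ.fiber x).erase y, D₂.coordSub ↑x) • 1) = _
  have h0 : evalHom y (D₂.coordSub y) = 0 := sub_self _
  simp only [smul_eq_mul, map_add, _root_.map_mul, map_prod, h0, zero_mul, zero_add, mul_one]
  rfl

open Classical in
/-- The denominators of the interpolation functions are bounded away from zero. -/
lemma IsFiniteEtale.exists_le_norm_prod (hφ : φ.IsFiniteEtale) :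
    ∃ c > 0, ∀ y : D₂.pts, c ≤ ‖∏ y' ∈ (hφ.fiber (φ.toFun y)).erase y, ((y : k) - y')‖ := by
  obtain ⟨C, hC, hd⟩ := exists_norm_eq_of_isUnit hφ.isUnit_deriv
  obtain ⟨n, hn⟩ := hφ.exists_card_fiber_le
  have h1 := D₁.radius_pos
  have h2 := D₂.radius_pos
  have hm : 0 < min 1 D₂.radius := lt_min one_pos h2
  refine ⟨C * min 1 D₂.radius ^ n / D₁.radius, by positivity, fun y => ?_⟩
  have h3 := hd y
  rw [hφ.deriv_apply, norm_mul, hφ.norm_unitFactor] at h3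
  set d := (hφ.fiber (φ.toFun y)).card
  set p := ‖∏ y' ∈ (hφ.fiber (φ.toFun y)).erase y, ((y : k) - y')‖
  have h4 : min 1 D₂.radius ^ n ≤ D₂.radius ^ d :=
    (pow_le_pow_of_le_one hm.le (min_le_left _ _) (hn _)).trans
      (pow_le_pow_left₀ hm.le (min_le_right _ _) _)
  rw [← h3, div_le_iff₀ h1]
  have hp : 0 ≤ p := norm_nonneg _
  calc D₁.radius / D₂.radius ^ d * p * min 1 D₂.radius ^ n
      ≤ D₁.radius / D₂.radius ^ d * p * D₂.radius ^ d := by gcongr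
    _ = p * D₁.radius := by field_simp

/-- On every smaller disc, the values of a functional on the interpolation functions are bounded. -/
lemma IsFiniteEtale.exists_functional_le (hφ : φ.IsFiniteEtale) {μ : D₂.Fun →+ D₁.Fun}
    (hμ : ∀ a b, μ (φ.pullback a * b) = a * μ b) (x : D₁.pts) {t : ℝ} (ht : t < D₁.radius) :
    ∃ K, 0 < K ∧ ∀ y : D₂.pts, ‖(φ.toFun y : k) - x‖ ≤ t →
      ‖(μ (hφ.lagrange y)).1 (φ.toFun y)‖ ≤ K := by
  classical
  have hμc : ∀ (c : k) (b : D₂.Fun), μ (algebraMap k D₂.Fun c * b) = algebraMap k D₁.Fun c * μ b :=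
    fun c b => by rw [← hμ, AlgHom.commutes]
  obtain ⟨c, hc, hcy⟩ := hφ.exists_le_norm_prod
  obtain ⟨n, hn⟩ := hφ.exists_card_fiber_le
  -- bounds for the points of `D₂` and for the values of `μ` on powers of the coordinate
  set M := max 1 (max ‖D₂.center‖ D₂.radius)
  have hM1 : 1 ≤ M := le_max_left _ _
  have hM : ∀ y : D₂.pts, ‖(y : k)‖ ≤ M := fun y => by
    have e : (y : k) = (y - D₂.center) + D₂.center := by ring
    rw [e]
    refine (IsUltrametricDist.norm_add_le_max _ _).trans (max_le ?_ ?_)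
    · have : ‖(y : k) - D₂.center‖ < D₂.radius := by
        rw [← dist_eq_norm]
        exact y.2
      exact this.le.trans ((le_max_right _ _).trans (le_max_right _ _))
    · exact (le_max_left _ _).trans (le_max_right _ _)
  set K := ∑ j ∈ Finset.range (n + 1), D₁.supNorm x t (μ (D₂.coord ^ j))
  have hK0 : 0 ≤ K := Finset.sum_nonneg fun _ _ => supNorm_nonneg _
  have hK : ∀ j ≤ n, ∀ w : D₁.pts, ‖(w : k) - x‖ ≤ t → ‖(μ (D₂.coord ^ j)).1 w‖ ≤ K := by
    intro j hj w hw
    refine (norm_le_supNorm _ ht hw).trans ?_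
    exact Finset.single_le_sum (f := fun j => D₁.supNorm x t (μ (D₂.coord ^ j)))
      (fun _ _ => supNorm_nonneg _) (Finset.mem_range.mpr (Nat.lt_succ_of_le hj))
  have key : ∀ (S : Finset D₂.pts) (j : ℕ), j + S.card ≤ n → ∀ w : D₁.pts, ‖(w : k) - x‖ ≤ t →
      ‖(μ (D₂.coord ^ j * ∏ y ∈ S, D₂.coordSub y)).1 w‖ ≤ K * M ^ S.card := by
    intro S
    induction S using Finset.induction_on with
    | empty =>
      intro j hj w hw
      simpa using hK j (by simpa using hj) w hw
    | insert y S hy ih =>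
      intro j hj w hw
      rw [Finset.card_insert_of_notMem hy] at hj ⊢
      have e : D₂.coord ^ j * ∏ y' ∈ insert y S, D₂.coordSub y' =
          D₂.coord ^ (j + 1) * ∏ y' ∈ S, D₂.coordSub y' -
            algebraMap k D₂.Fun y * (D₂.coord ^ j * ∏ y' ∈ S, D₂.coordSub y') := by
        rw [Finset.prod_insert hy, coordSub]
        ring
      rw [e, map_sub, hμc, Fun.sub_apply, Fun.mul_apply, Fun.algebraMap_apply, sub_eq_add_neg]
      refine (IsUltrametricDist.norm_add_le_max _ _).trans (max_le ?_ ?_)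
      · refine (ih (j + 1) (by omega) w hw).trans ?_
        exact mul_le_mul_of_nonneg_left (pow_le_pow_right₀ hM1 (Nat.le_succ _)) hK0
      · rw [norm_neg, norm_mul, pow_succ']
        calc ‖(y : k)‖ * _ ≤ M * (K * M ^ S.card) :=
              mul_le_mul (hM y) (ih j (by omega) w hw) (norm_nonneg _) (zero_le_one.trans hM1)
          _ = _ := by ring
  refine ⟨c⁻¹ * (K * M ^ n) + 1, by positivity, fun y hy => ?_⟩
  have e : (μ (hφ.lagrange y)).1 (φ.toFun y) =
      (∏ y' ∈ (hφ.fiber (φ.toFun y)).erase y, ((y : k) - y'))⁻¹ *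
        (μ (D₂.coord ^ 0 * ∏ y' ∈ (hφ.fiber (φ.toFun y)).erase y, D₂.coordSub y')).1
          (φ.toFun y) := by
    rw [lagrange, hμc, Fun.mul_apply, pow_zero, one_mul, Fun.algebraMap_apply]
  rw [e, norm_mul, norm_inv]
  have hcard : ((hφ.fiber (φ.toFun y)).erase y).card ≤ n :=
    (Finset.card_le_card (Finset.erase_subset _ _)).trans (hn _)
  have h5 := key _ 0 (by simpa using hcard) (φ.toFun y) hy
  refine le_trans ?_ (le_add_of_nonneg_right zero_le_one)
  refine mul_le_mul (inv_anti₀ hc (hcy y)) (h5.trans ?_) (norm_nonneg _) (by positivity)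
  exact mul_le_mul_of_nonneg_left (pow_le_pow_right₀ hM1 hcard) hK0

end Morphism

end Splitting

/-! ### Functions on the preimage of a disc -/

section PreimageFunctions

open Polynomial Filter Topology

variable {k : Type u} [NontriviallyNormedField k] [IsUltrametricDist k] [CompleteSpace k]
  [IsAlgClosed k]

open OpenDisc

namespace OpenDisc

variable {D : OpenDisc k}

lemma mem_sub_iff {x : D.pts} {s : ℝ} (hs : 0 < s) {w : k} :
    w ∈ (D.sub x s hs).pts ↔ ‖w - x‖ < s * D.radius := by
  change w ∈ Metric.ball (x : k) (s * D.radius) ↔ _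
  rw [Metric.mem_ball, dist_eq_norm]

/-- The centre of a subdisc. -/
def subCenter (D : OpenDisc k) (x : D.pts) {s : ℝ} (hs : 0 < s) : (D.sub x s hs).pts :=
  ⟨x, by
    rw [mem_sub_iff, sub_self, norm_zero]
    exact mul_pos hs D.radius_pos⟩

/-- The inclusion of a subdisc. -/
def incl (D : OpenDisc k) (x : D.pts) {s : ℝ} (hs : 0 < s) (hs1 : s ≤ 1) (w : (D.sub x s hs).pts) : D.pts :=
  ⟨w, D.sub_subset x s hs hs1 w.2⟩

end OpenDisc

namespace Morphism

variable {D₂ D₁ : OpenDisc k} {φ : Morphism D₂ D₁} {x : D₁.pts} {s σ : ℝ} {J : Finset D₂.pts}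

namespace Splits

lemma toFun_mem (h : φ.Splits x s σ J) (y : J)
    (z : (D₂.sub y.1 σ h.σ_pos).pts) : (φ.toFun (D₂.incl y.1 h.σ_pos h.σ_lt.le z) : k) ∈ (D₁.sub x s h.s_pos).pts := by
  rw [mem_sub_iff, h.mem_iff]
  exact ⟨y.1, y.2, (mem_sub_iff h.σ_pos).mp z.2⟩

/-- The morphism induced by `φ` on one of the discs which make up the preimage of a disc. -/
def morphism (h : φ.Splits x s σ J) (y : J) :
    Morphism (D₂.sub y.1 σ h.σ_pos) (D₁.sub x s h.s_pos) where
  toFun z := ⟨φ.toFun (D₂.incl y.1 h.σ_pos h.σ_lt.le z), h.toFun_mem y z⟩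
  comp_analytic g := by
    refine isAnalytic_of_uniform_limit (D₂.subCenter y.1 h.σ_pos) fun τ hτ ε hε => ?_
    obtain ⟨t, ht, hb⟩ := h.bounded τ hτ
    obtain ⟨P, hP⟩ := exists_poly_approx g.2 (D₁.subCenter x h.s_pos) ht hε
    refine ⟨_, (res (D₂.sub_subset y.1 σ h.σ_pos h.σ_lt.le) (φ.pullback (aeval D₁.coord P))).2,
      fun w hw => ?_⟩
    have h1 : (res (D₂.sub_subset y.1 σ h.σ_pos h.σ_lt.le) (φ.pullback (aeval D₁.coord P))).1 w =
        P.eval (φ.toFun (D₂.incl y.1 h.σ_pos h.σ_lt.le w) : k) := aeval_coord_apply P _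
    rw [h1]
    exact hP _ (hb y.1 y.2 _ hw)

end Splits

/-- A basis of `𝒪(D₂)` together with the dual functionals exists locally on `D₁`; globally there are
elements and functionals with the property of dual bases. -/
lemma IsFiniteEtale.exists_dual_basis (hφ : φ.IsFiniteEtale) :
    ∃ (n : ℕ) (μ : Fin n → D₂.Fun →+ D₁.Fun) (b : Fin n → D₂.Fun),
      (∀ j a c, μ j (φ.pullback a * c) = a * μ j c) ∧ ∀ c, c = ∑ j, φ.pullback (μ j c) * b j := by
  let _ : Algebra D₁.Fun D₂.Fun := φ.pullback.toRingHom.toAlgebra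
  have : Module.Finite D₁.Fun D₂.Fun := hφ.finite
  have : Algebra.Etale D₁.Fun D₂.Fun := hφ.etale
  have : Module.FinitePresentation D₁.Fun D₂.Fun :=
    Module.FinitePresentation.of_finite_of_finitePresentation _ _
  have : Module.Projective D₁.Fun D₂.Fun := Module.Flat.projective_of_finitePresentation
  obtain ⟨n, p, i, -, -, hpi⟩ := Module.Finite.exists_comp_eq_id_of_projective D₁.Fun D₂.Fun
  refine ⟨n, fun j => ((LinearMap.proj j).comp i : D₂.Fun →ₗ[D₁.Fun] D₁.Fun).toAddMonoidHom,
    fun j => p (Pi.single j 1), fun j a c => ?_, fun c => ?_⟩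
  · exact LinearMap.map_smul ((LinearMap.proj j).comp i : D₂.Fun →ₗ[D₁.Fun] D₁.Fun) a c
  · have h1 : p (i c) = c := LinearMap.congr_fun hpi c
    have h2 : i c = ∑ j, (i c j) • (Pi.single j 1 : Fin n → D₁.Fun) := by
      ext l
      simp [Pi.single_apply]
    conv_lhs => rw [← h1, h2, map_sum]
    exact Finset.sum_congr rfl fun j _ => LinearMap.map_smul p (i c j) (Pi.single j 1)

/-- The functionals of a dual basis separate the points of a fibre. -/
lemma IsFiniteEtale.sum_dual_basis (hφ : φ.IsFiniteEtale) {n : ℕ} {μ : Fin n → D₂.Fun →+ D₁.Fun}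
    {b : Fin n → D₂.Fun} (hb : ∀ c, c = ∑ j, φ.pullback (μ j c) * b j) (C : D₂.pts → k)
    (z : D₂.pts) :
    ∑ j, (∑ y ∈ hφ.fiber (φ.toFun z), C y * (μ j (hφ.lagrange y)).1 (φ.toFun z)) * (b j).1 z = C z := by
  classical
  simp only [Finset.sum_mul]
  rw [Finset.sum_comm]
  have hz : z ∈ hφ.fiber (φ.toFun z) := mem_fiber.mpr rfl
  have h1 : ∀ y ∈ hφ.fiber (φ.toFun z), ∑ j, C y * (μ j (hφ.lagrange y)).1 (φ.toFun z) * (b j).1 z =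
      C y * if z = y then 1 else 0 := by
    intro y hy
    have h2 := congrArg (evalHom z) (hb (hφ.lagrange y))
    rw [map_sum] at h2
    simp only [_root_.map_mul, evalHom_apply, pullback_apply] at h2
    have h3 := hφ.lagrange_apply hy hz
    rw [h2] at h3
    simp only [mul_assoc]
    rw [← Finset.mul_sum, h3]
  rw [Finset.sum_congr rfl h1, Finset.sum_eq_single_of_mem z hz]
  · simp
  · intro y _ hy
    simp [hy.symm]

namespace Splits

section Tensor

/-- The algebra structures between `𝒪(D₁)`, `𝒪(D₂)`, `𝒪(U)` and the `𝒪(V_y)` are given by `φ` and by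
restriction; here `U` is a disc whose preimage under `φ` is the disjoint union of the discs `V_y`. -/
structure Compatible (h : φ.Splits x s σ J) [Algebra D₁.Fun D₂.Fun]
    [Algebra D₁.Fun (D₁.sub x s h.s_pos).Fun]
    [∀ y : J, Algebra D₂.Fun (D₂.sub y.1 σ h.σ_pos).Fun]
    [∀ y : J, Algebra (D₁.sub x s h.s_pos).Fun (D₂.sub y.1 σ h.σ_pos).Fun] : Prop where
  map_AB : ∀ a, algebraMap D₁.Fun D₂.Fun a = φ.pullback a
  map_AU : ∀ a, algebraMap D₁.Fun (D₁.sub x s h.s_pos).Fun a =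
    res (D₁.sub_subset x s h.s_pos h.s_le) a
  map_BV : ∀ (y : J) a, algebraMap D₂.Fun (D₂.sub y.1 σ h.σ_pos).Fun a =
    res (D₂.sub_subset y.1 σ h.σ_pos h.σ_lt.le) a
  map_UV : ∀ (y : J) a, algebraMap (D₁.sub x s h.s_pos).Fun (D₂.sub y.1 σ h.σ_pos).Fun a =
    (h.morphism y).pullback a

variable {h : φ.Splits x s σ J}
  [Algebra D₁.Fun D₂.Fun] [Algebra D₁.Fun (D₁.sub x s h.s_pos).Fun]
  [∀ y : J, Algebra D₂.Fun (D₂.sub y.1 σ h.σ_pos).Fun]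
  [∀ y : J, Algebra (D₁.sub x s h.s_pos).Fun (D₂.sub y.1 σ h.σ_pos).Fun]

namespace Compatible

lemma comm (hc : h.Compatible) (y : J) (a : D₁.Fun) :
    algebraMap (D₁.sub x s h.s_pos).Fun (D₂.sub y.1 σ h.σ_pos).Fun
      (algebraMap D₁.Fun (D₁.sub x s h.s_pos).Fun a) =
    algebraMap D₂.Fun (D₂.sub y.1 σ h.σ_pos).Fun (algebraMap D₁.Fun D₂.Fun a) := by
  rw [hc.map_AB, hc.map_AU, hc.map_BV, hc.map_UV]
  rfl

/-- The function on `φ⁻¹(U)` given by an element of `𝒪(U) ⊗ 𝒪(D₂)`. -/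
abbrev mult (hc : h.Compatible) (y : J) :
    (D₁.sub x s h.s_pos).Fun ⊗[D₁.Fun] D₂.Fun →+ (D₂.sub y.1 σ h.σ_pos).Fun :=
  multMap (R := (D₁.sub x s h.s_pos).Fun) (V := fun y : J => (D₂.sub y.1 σ h.σ_pos).Fun) hc.comm y

lemma mult_tmul_apply (hc : h.Compatible) (y : J) (a : (D₁.sub x s h.s_pos).Fun) (b : D₂.Fun)
    (z : (D₂.sub y.1 σ h.σ_pos).pts) : (hc.mult y (a ⊗ₜ b)).1 z =
      a.1 ((h.morphism y).toFun z) * b.1 (D₂.incl y.1 h.σ_pos h.σ_lt.le z) := by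
  rw [mult, multMap_tmul, hc.map_BV, hc.map_UV]
  rfl

end Compatible

open Classical in
/-- The value at a point of `φ⁻¹(U)` of a family of functions on the discs `V_y`, and `0` at the
other points. -/
def glue (h : φ.Splits x s σ J) (c : ∀ y : J, (D₂.sub y.1 σ h.σ_pos).Fun) (z : D₂.pts) : k :=
  if hz : ∃ y : J, (z : k) ∈ (D₂.sub y.1 σ h.σ_pos).pts then
    (c hz.choose).1 ⟨z, hz.choose_spec⟩ else 0

lemma eq_of_mem (h : φ.Splits x s σ J) {y y' : J} {z : k} (hz : z ∈ (D₂.sub y.1 σ h.σ_pos).pts)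
    (hz' : z ∈ (D₂.sub y'.1 σ h.σ_pos).pts) : y = y' := by
  rw [mem_sub_iff] at hz hz'
  by_contra hne
  have h1 := h.separated y.1 y.2 y'.1 y'.2 fun e => hne (Subtype.ext e)
  rw [norm_sub_rev] at hz
  exact absurd ((norm_sub_le_max_of_le le_rfl).trans_lt (max_lt hz hz')) h1.not_gt

lemma glue_apply (h : φ.Splits x s σ J) (c : ∀ y : J, (D₂.sub y.1 σ h.σ_pos).Fun) (y : J)
    (z : (D₂.sub y.1 σ h.σ_pos).pts) :
    h.glue c (D₂.incl y.1 h.σ_pos h.σ_lt.le z) = (c y).1 z := by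
  have hz : ∃ y : J, (z : k) ∈ (D₂.sub y.1 σ h.σ_pos).pts := ⟨y, z.2⟩
  have e : h.glue c (D₂.incl y.1 h.σ_pos h.σ_lt.le z) = (c hz.choose).1 ⟨z, hz.choose_spec⟩ :=
    dif_pos hz
  rw [e]
  have h1 : ∀ (y' : J) (hy' : (z : k) ∈ (D₂.sub y'.1 σ h.σ_pos).pts), y = y' →
      (c y').1 ⟨z, hy'⟩ = (c y).1 z := by
    rintro _ hy' rfl
    rfl
  exact h1 _ _ (h.eq_of_mem z.2 hz.choose_spec)

lemma exists_incl_eq (h : φ.Splits x s σ J) {z : D₂.pts}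
    (hz : (φ.toFun z : k) ∈ (D₁.sub x s h.s_pos).pts) :
    ∃ (y : J) (w : (D₂.sub y.1 σ h.σ_pos).pts), D₂.incl y.1 h.σ_pos h.σ_lt.le w = z := by
  rw [mem_sub_iff, h.mem_iff] at hz
  obtain ⟨y, hy, hz⟩ := hz
  exact ⟨⟨y, hy⟩, ⟨z, (mem_sub_iff h.σ_pos).mpr hz⟩, rfl⟩

namespace Compatible

/-- The coefficients of an element of `𝒪(U) ⊗ 𝒪(D₂)` with respect to dual bases are computed by
interpolation on the fibres. -/
lemma exists_coeff (hc : h.Compatible) (hφ : φ.IsFiniteEtale) {n : ℕ}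
    {μ : Fin n → D₂.Fun →+ D₁.Fun} {b : Fin n → D₂.Fun}
    (hμ : ∀ j a c, μ j (φ.pullback a * c) = a * μ j c)
    (hb : ∀ c, c = ∑ j, φ.pullback (μ j c) * b j)
    (t : (D₁.sub x s h.s_pos).Fun ⊗[D₁.Fun] D₂.Fun) :
    ∃ q : Fin n → (D₁.sub x s h.s_pos).Fun, t = ∑ j, q j ⊗ₜ b j ∧ ∀ j w, (q j).1 w =
      ∑ y ∈ hφ.fiber (D₁.incl x h.s_pos h.s_le w), h.glue (fun y => hc.mult y t) y *
        (μ j (hφ.lagrange y)).1 (D₁.incl x h.s_pos h.s_le w) := by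
  have hmem : ∀ (w : (D₁.sub x s h.s_pos).pts), ∀ y ∈ hφ.fiber (D₁.incl x h.s_pos h.s_le w),
      ∃ (y' : J) (w' : (D₂.sub y'.1 σ h.σ_pos).pts), D₂.incl y'.1 h.σ_pos h.σ_lt.le w' = y ∧
        (h.morphism y').toFun w' = w := by
    intro w y hy
    rw [IsFiniteEtale.mem_fiber] at hy
    obtain ⟨y', w', hw'⟩ := h.exists_incl_eq (z := y) (by rw [hy]; exact w.2)
    refine ⟨y', w', hw', Subtype.ext ?_⟩
    change (φ.toFun (D₂.incl y'.1 h.σ_pos h.σ_lt.le w') : k) = w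
    rw [hw', hy]
    rfl
  induction t using TensorProduct.induction_on with
  | zero =>
    refine ⟨0, by simp, fun j w => ?_⟩
    rw [Finset.sum_eq_zero]
    · rfl
    · intro y hy
      obtain ⟨y', w', rfl, -⟩ := hmem w y hy
      rw [h.glue_apply, map_zero, Fun.zero_apply, zero_mul]
  | add t t' ht ht' =>
    obtain ⟨q, h1, h2⟩ := ht
    obtain ⟨q', h1', h2'⟩ := ht'
    refine ⟨q + q', ?_, fun j w => ?_⟩
    · conv_lhs => rw [h1, h1']
      simp [TensorProduct.add_tmul, Finset.sum_add_distrib]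
    · rw [Pi.add_apply, Fun.add_apply, h2, h2', ← Finset.sum_add_distrib]
      refine Finset.sum_congr rfl fun y hy => ?_
      obtain ⟨y', w', rfl, -⟩ := hmem w y hy
      rw [h.glue_apply, h.glue_apply, h.glue_apply, map_add, Fun.add_apply, add_mul]
  | tmul a c =>
    refine ⟨fun j => a * algebraMap _ _ (μ j c), ?_, fun j w => ?_⟩
    · conv_lhs => rw [hb c]
      rw [TensorProduct.tmul_sum]
      refine Finset.sum_congr rfl fun j _ => ?_
      rw [← hc.map_AB, ← Algebra.smul_def, ← TensorProduct.smul_tmul, Algebra.smul_def, mul_comm]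
    · rw [Fun.mul_apply, hc.map_AU]
      change a.1 w * (μ j c).1 (D₁.incl x h.s_pos h.s_le w) = _
      rw [hφ.functional_apply (hμ j), Finset.mul_sum]
      refine Finset.sum_congr rfl fun y hy => ?_
      obtain ⟨y', w', rfl, hw⟩ := hmem w y hy
      rw [h.glue_apply, hc.mult_tmul_apply, hw, mul_assoc]

/-- `𝒪(U) ⊗ 𝒪(D₂) → ∏ 𝒪(V_y)` is injective. -/
lemma mult_injective (hc : h.Compatible) (hφ : φ.IsFiniteEtale)
    (t : (D₁.sub x s h.s_pos).Fun ⊗[D₁.Fun] D₂.Fun) (ht : ∀ y, hc.mult y t = 0) : t = 0 := by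
  obtain ⟨n, μ, b, hμ, hb⟩ := hφ.exists_dual_basis
  obtain ⟨q, hq, hq'⟩ := hc.exists_coeff hφ hμ hb t
  rw [hq]
  refine Finset.sum_eq_zero fun j _ => ?_
  have : q j = 0 := Fun.ext fun w => by
    rw [hq', Fun.zero_apply]
    refine Finset.sum_eq_zero fun y hy => ?_
    have e : h.glue (fun y => hc.mult y t) y = 0 := by
      obtain ⟨y', w', rfl⟩ := h.exists_incl_eq (z := y) (by
        rw [IsFiniteEtale.mem_fiber.mp hy]
        exact w.2)
      rw [h.glue_apply, ht, Fun.zero_apply]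
    rw [e, zero_mul]
  rw [this, TensorProduct.zero_tmul]

/-- The image of `𝒪(U) ⊗ 𝒪(D₂)` in `∏ 𝒪(V_y)` is closed. -/
lemma exists_mult_eq_of_approx (hc : h.Compatible) (hφ : φ.IsFiniteEtale)
    (c : ∀ y : J, (D₂.sub y.1 σ h.σ_pos).Fun)
    (happ : ∀ t < s * D₁.radius, ∀ ε > 0, ∃ r, ∀ (y : J) (z : (D₂.sub y.1 σ h.σ_pos).pts),
      ‖((h.morphism y).toFun z : k) - x‖ ≤ t → ‖(hc.mult y r).1 z - (c y).1 z‖ ≤ ε) :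
    ∃ r, ∀ y, hc.mult y r = c y := by
  obtain ⟨n, μ, b, hμ, hb⟩ := hφ.exists_dual_basis
  let q : Fin n → (D₁.sub x s h.s_pos).pts → k := fun j w =>
    ∑ y ∈ hφ.fiber (D₁.incl x h.s_pos h.s_le w), h.glue c y *
      (μ j (hφ.lagrange y)).1 (D₁.incl x h.s_pos h.s_le w)
  have hq : ∀ j, (D₁.sub x s h.s_pos).IsAnalytic (q j) := by
    intro j
    refine isAnalytic_of_uniform_limit (D₁.subCenter x h.s_pos) fun t ht ε hε => ?_
    have ht' : t < D₁.radius := lt_of_lt_of_le ht (mul_le_of_le_one_left D₁.radius_pos.le h.s_le)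
    obtain ⟨K, hK0, hK⟩ := hφ.exists_functional_le (hμ j) x ht'
    obtain ⟨r, hr⟩ := happ t ht (ε / K) (by positivity)
    obtain ⟨q', -, hq'⟩ := hc.exists_coeff hφ hμ hb r
    refine ⟨_, (q' j).2, fun w hw => ?_⟩
    rw [hq', ← Finset.sum_sub_distrib]
    refine IsUltrametricDist.norm_sum_le_of_forall_le_of_nonneg hε.le fun y hy => ?_
    rw [← sub_mul, norm_mul]
    have hy' := IsFiniteEtale.mem_fiber.mp hy
    have h1 : ‖(μ j (hφ.lagrange y)).1 (D₁.incl x h.s_pos h.s_le w)‖ ≤ K := by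
      have := hK y (by rw [hy']; exact hw)
      rwa [hy'] at this
    obtain ⟨y', w', rfl⟩ := h.exists_incl_eq (z := y) (by
      rw [hy']
      exact w.2)
    rw [h.glue_apply, h.glue_apply, norm_sub_rev]
    have h2 := hr y' w' (by
      change ‖(φ.toFun (D₂.incl y'.1 h.σ_pos h.σ_lt.le w') : k) - x‖ ≤ t
      rw [hy']
      exact hw)
    calc _ ≤ ε / K * K := mul_le_mul h2 h1 (norm_nonneg _) (by positivity)
      _ = ε := by field_simp
  refine ⟨∑ j, (⟨q j, hq j⟩ : (D₁.sub x s h.s_pos).Fun) ⊗ₜ b j, fun y => Fun.ext fun z => ?_⟩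
  rw [map_sum]
  change evalHom z (∑ j, hc.mult y ((⟨q j, hq j⟩ : (D₁.sub x s h.s_pos).Fun) ⊗ₜ b j)) = _
  rw [map_sum]
  refine (Finset.sum_congr rfl fun j _ => hc.mult_tmul_apply y _ _ z).trans ?_
  rw [← h.glue_apply c, ← hφ.sum_dual_basis hb (h.glue c)]
  rfl

end Compatible

end Tensor

end Splits

end Morphism

end PreimageFunctions

section PreimageSurjective

open Polynomial Filter Topology

variable {k : Type u} [NontriviallyNormedField k] [IsUltrametricDist k] [CompleteSpace k]
  [IsAlgClosed k]

open OpenDisc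

namespace Morphism.Splits.Compatible

variable {D₂ D₁ : OpenDisc k} {φ : Morphism D₂ D₁} {x : D₁.pts} {s σ : ℝ} {J : Finset D₂.pts}
  {h : φ.Splits x s σ J}
  [Algebra D₁.Fun D₂.Fun] [Algebra D₁.Fun (D₁.sub x s h.s_pos).Fun]
  [∀ y : J, Algebra D₂.Fun (D₂.sub y.1 σ h.σ_pos).Fun]
  [∀ y : J, Algebra (D₁.sub x s h.s_pos).Fun (D₂.sub y.1 σ h.σ_pos).Fun]

/-- A linear polynomial which does not vanish on `φ⁻¹(U)` is invertible in the image of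
`𝒪(U) ⊗ 𝒪(D₂)`: it divides a function pulled back from `D₁` which is invertible on `U`. -/
lemma exists_mult_sub_inv (hc : h.Compatible) {a : k} (ha : a ∈ D₂.pts)
    (haJ : ∀ y ∈ J, σ * D₂.radius ≤ ‖a - y‖) :
    ∃ r, ∀ (y : J) (z : (D₂.sub y.1 σ h.σ_pos).pts), (hc.mult y r).1 z * ((z : k) - a) = 1 := by
  have h1 : (φ.toFun ⟨a, ha⟩ : k) ∉ (D₁.sub x s h.s_pos).pts := by
    rw [mem_sub_iff, h.mem_iff]
    rintro ⟨y, hy, hlt⟩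
    exact absurd hlt (haJ y hy).not_gt
  obtain ⟨u, hu⟩ := isUnit_coordSub h1
  obtain ⟨q, hq⟩ := exists_eq_add_coordSub_mul (φ.pullback (D₁.coordSub (φ.toFun ⟨a, ha⟩))) ⟨a, ha⟩
  rw [pullback_coordSub_apply, sub_self, map_zero, zero_add] at hq
  refine ⟨(↑u⁻¹ : (D₁.sub x s h.s_pos).Fun) ⊗ₜ q, fun y z => ?_⟩
  rw [hc.mult_tmul_apply]
  have h2 := congrArg (evalHom (D₂.incl y.1 h.σ_pos h.σ_lt.le z)) hq
  rw [map_mul] at h2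
  have h3 := congrArg (evalHom ((h.morphism y).toFun z)) u.inv_mul
  rw [map_mul, hu, map_one] at h3
  rw [mul_assoc, ← h3]
  congr 1
  rw [mul_comm]
  exact h2.symm

/-- A polynomial without zeros in `φ⁻¹(U)` is invertible in the image of `𝒪(U) ⊗ 𝒪(D₂)`. -/
lemma exists_mult_eval_inv (hc : h.Compatible) {P : k[X]} (hP : P ≠ 0)
    (hroots : ∀ a ∈ P.roots, a ∈ D₂.pts ∧ ∀ y ∈ J, σ * D₂.radius ≤ ‖a - y‖) :
    ∃ r, ∀ (y : J) (z : (D₂.sub y.1 σ h.σ_pos).pts), (hc.mult y r).1 z * P.eval (z : k) = 1 := by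
  have key : ∀ S : Multiset k, (∀ a ∈ S, a ∈ D₂.pts ∧ ∀ y ∈ J, σ * D₂.radius ≤ ‖a - y‖) →
      ∃ r, ∀ (y : J) (z : (D₂.sub y.1 σ h.σ_pos).pts),
        (hc.mult y r).1 z * (S.map fun a => (z : k) - a).prod = 1 := by
    intro S
    induction S using Multiset.induction_on with
    | empty =>
      intro _
      refine ⟨1 ⊗ₜ 1, fun y z => ?_⟩
      rw [hc.mult_tmul_apply]
      simp
    | cons a S ih =>
      intro hS
      obtain ⟨r, hr⟩ := ih fun b hb => hS b (Multiset.mem_cons_of_mem hb)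
      obtain ⟨ha, haJ⟩ := hS a (Multiset.mem_cons_self a S)
      obtain ⟨r', hr'⟩ := hc.exists_mult_sub_inv ha haJ
      refine ⟨r' * r, fun y z => ?_⟩
      rw [mult, multMap_mul, Multiset.map_cons, Multiset.prod_cons]
      have e : ((hc.mult y r' * hc.mult y r).1 z) = (hc.mult y r').1 z * (hc.mult y r).1 z := rfl
      change (hc.mult y r' * hc.mult y r).1 z * _ = 1
      rw [e, mul_mul_mul_comm, hr', hr, one_mul]
  obtain ⟨r, hr⟩ := key P.roots hroots
  have hl : P.leadingCoeff ≠ 0 := leadingCoeff_ne_zero.mpr hP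
  refine ⟨(algebraMap k (D₁.sub x s h.s_pos).Fun P.leadingCoeff⁻¹ ⊗ₜ 1) * r, fun y z => ?_⟩
  rw [(IsAlgClosed.splits P).eval_eq_prod_roots, mult, multMap_mul]
  change (hc.mult y (algebraMap k (D₁.sub x s h.s_pos).Fun P.leadingCoeff⁻¹ ⊗ₜ 1)).1 z *
    (hc.mult y r).1 z * _ = 1
  rw [hc.mult_tmul_apply, mul_mul_mul_comm, hr, mul_one, Fun.algebraMap_apply, Fun.one_apply,
    mul_one, inv_mul_cancel₀ hl]

/-- The characteristic function of one of the discs `V_y` can be approximated on smaller closed discs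
by elements of `𝒪(U) ⊗ 𝒪(D₂)`, namely by `1 / (1 - ((T - y) / u) ^ M)`, where `‖u‖` lies between the
radius of the disc and its distance from the other ones. -/
lemma exists_mult_approx_single (hc : h.Compatible) (y₀ : J) {τ : ℝ} (hτ0 : 0 ≤ τ)
    (hτ : τ < σ * D₂.radius) {δ : ℝ} (hδ : 0 < δ) :
    ∃ r, (∀ z : (D₂.sub y₀.1 σ h.σ_pos).pts, ‖(z : k) - y₀.1‖ ≤ τ → ‖(hc.mult y₀ r).1 z - 1‖ ≤ δ) ∧
      ∀ y : J, y ≠ y₀ → ∀ z : (D₂.sub y.1 σ h.σ_pos).pts, ‖(hc.mult y r).1 z‖ ≤ δ := by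
  have hρ := D₂.radius_pos
  have hR : 0 < σ * D₂.radius := mul_pos h.σ_pos hρ
  have hRρ : σ * D₂.radius < D₂.radius := by nlinarith [h.σ_lt]
  obtain ⟨b, hbR, hbρ, hbJ⟩ : ∃ b, σ * D₂.radius < b ∧ b < D₂.radius ∧
      ∀ y ∈ J, y ≠ y₀.1 → b < ‖(y : k) - y₀.1‖ := by
    have h1 : ∀ᶠ b in 𝓝[>] (σ * D₂.radius), ∀ y ∈ J, y ≠ y₀.1 → b < ‖(y : k) - y₀.1‖ := by
      refine (Filter.eventually_all_finset J).mpr fun y hy => ?_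
      by_cases hne : y = y₀.1
      · exact Eventually.of_forall fun _ h => absurd hne h
      · filter_upwards [Ioo_mem_nhdsGT (h.separated y hy y₀.1 y₀.2 hne)] with b hb _ using hb.2
    obtain ⟨b, h2, h3⟩ := (h1.and (Ioo_mem_nhdsGT hRρ)).exists
    exact ⟨b, h3.1, h3.2, h2⟩
  obtain ⟨u, hu1, hu2⟩ := exists_norm_mem_Ioo (k := k) hR.le hbR
  have hu0 : 0 < ‖u‖ := hR.trans hu1
  have hune : u ≠ 0 := norm_pos_iff.mp hu0
  -- the quotients of the radii involved are uniformly smaller than one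
  obtain ⟨θ, hθ1, hθ0, hθτ⟩ : ∃ θ < 1, 0 ≤ θ ∧ τ / ‖u‖ ≤ θ ∧ ‖u‖ / b ≤ θ := by
    refine ⟨max (τ / ‖u‖) (‖u‖ / b), max_lt ?_ ?_, ?_, le_max_left _ _, le_max_right _ _⟩
    · exact (div_lt_one hu0).mpr (hτ.trans hu1)
    · exact (div_lt_one (hu0.trans hu2)).mpr hu2
    · exact le_max_of_le_left (by positivity)
  obtain ⟨M, hMδ⟩ : ∃ M : ℕ, θ ^ (M + 1) ≤ δ := by
    obtain ⟨M, hM⟩ := exists_pow_lt_of_lt_one hδ hθ1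
    exact ⟨M, (pow_le_pow_of_le_one hθ0 hθ1.le (Nat.le_succ M)).trans hM.le⟩
  set P : k[X] := 1 - (C u⁻¹ * (X - C (y₀.1 : k))) ^ (M + 1) with hPdef
  have hev : ∀ z : k, P.eval z = 1 - ((z - y₀.1) / u) ^ (M + 1) := fun z => by
    simp [hPdef, div_eq_inv_mul]
  have hP : P ≠ 0 := fun h0 => by
    have := hev (y₀.1 : k)
    simp [h0] at this
  have hdist : ∀ y : J, y ≠ y₀ → ∀ z : k, ‖z - y.1‖ < b → b < ‖z - y₀.1‖ := by
    intro y hy z hz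
    have h1 := hbJ y.1 y.2 fun e => hy (Subtype.ext e)
    have e : z - y₀.1 = (z - y.1) + (y.1 - y₀.1) := by ring
    rw [e, IsUltrametricDist.norm_add_eq_max_of_norm_ne_norm (hz.trans h1).ne]
    exact lt_max_of_lt_right h1
  obtain ⟨r, hr⟩ := hc.exists_mult_eval_inv hP fun a ha => by
    have h1 : P.eval a = 0 := (mem_roots hP).mp ha
    rw [hev, sub_eq_zero] at h1
    have h2 : ‖(a - y₀.1) / u‖ = 1 := by
      rw [← pow_eq_one_iff_of_nonneg (norm_nonneg _) (Nat.succ_ne_zero M), ← norm_pow, ← h1, norm_one]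
    rw [norm_div, div_eq_one_iff_eq hu0.ne'] at h2
    refine ⟨(mem_pts_iff y₀.1 a).mpr ?_, fun y hy => ?_⟩
    · rw [h2]
      exact hu2.trans hbρ
    · by_cases hy0 : (⟨y, hy⟩ : J) = y₀
      · rw [← hy0] at h2
        exact hu1.le.trans h2.ge
      · by_contra! hlt
        have := hdist ⟨y, hy⟩ hy0 a (hlt.trans hbR)
        rw [h2] at this
        exact absurd this hu2.not_gt
  refine ⟨r, fun z hz => ?_, fun y hy z => ?_⟩
  · have h1 := hr y₀ z
    rw [hev] at h1
    set g := (hc.mult y₀ r).1 z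
    set w := (((z : k) - y₀.1) / u) ^ (M + 1) with hw
    have hwθ : ‖w‖ ≤ θ ^ (M + 1) := by
      rw [hw, norm_pow, norm_div]
      have : ‖(z : k) - y₀.1‖ / ‖u‖ ≤ θ := (div_le_div_of_nonneg_right hz hu0.le).trans hθτ.1
      gcongr
    have hw1 : ‖w‖ < 1 := hwθ.trans_lt (pow_lt_one₀ hθ0 hθ1 (Nat.succ_ne_zero M))
    have h2 : ‖(1 : k) - w‖ = 1 := by
      rw [sub_eq_add_neg, IsUltrametricDist.norm_add_eq_max_of_norm_ne_norm (by
        rw [norm_neg, norm_one]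
        exact hw1.ne'), norm_neg, norm_one, max_eq_left hw1.le]
    have h3 : ‖g‖ = 1 := by
      have := congrArg norm h1
      rwa [norm_mul, h2, mul_one, norm_one] at this
    have e : g - 1 = g * w := by linear_combination h1
    rw [e, norm_mul, h3, one_mul]
    exact hwθ.trans hMδ
  · have h1 := hr y z
    rw [hev] at h1
    set g := (hc.mult y r).1 z
    set w := (((z : k) - y₀.1) / u) ^ (M + 1) with hw
    have h4 := hdist y hy z (((mem_sub_iff h.σ_pos).mp z.2).trans hbR)
    have hb0 : 0 < b := hu0.trans hu2
    have hwn : ‖w‖ = (‖(z : k) - y₀.1‖ / ‖u‖) ^ (M + 1) := by rw [hw, norm_pow, norm_div]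
    have hw1 : 1 < ‖w‖ := by
      rw [hwn]
      exact one_lt_pow₀ ((one_lt_div hu0).mpr (hu2.trans h4)) (Nat.succ_ne_zero M)
    have h2 : ‖(1 : k) - w‖ = ‖w‖ := by
      rw [sub_eq_add_neg, IsUltrametricDist.norm_add_eq_max_of_norm_ne_norm (by
        rw [norm_neg, norm_one]
        exact hw1.ne), norm_neg, norm_one, max_eq_right hw1.le]
    have h3 : ‖g‖ * ‖w‖ = 1 := by
      have := congrArg norm h1
      rwa [norm_mul, h2, norm_one] at this
    have h5 : 1 ≤ θ ^ (M + 1) * ‖w‖ := by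
      rw [hwn, ← mul_pow]
      refine one_le_pow₀ ?_
      rw [← mul_div_assoc, one_le_div hu0]
      exact ((div_le_iff₀ hb0).mp hθτ.2).trans (mul_le_mul_of_nonneg_left h4.le hθ0)
    calc ‖g‖ ≤ ‖g‖ * (θ ^ (M + 1) * ‖w‖) := le_mul_of_one_le_right (norm_nonneg g) h5
      _ = θ ^ (M + 1) * (‖g‖ * ‖w‖) := by ring
      _ ≤ δ := by rw [h3, mul_one]; exact hMδ

open Classical in
/-- `𝒪(U) ⊗ 𝒪(D₂) → ∏ 𝒪(V_y)` is surjective. -/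
lemma exists_mult_eq_single (hc : h.Compatible) (hφ : φ.IsFiniteEtale) (y₀ : J)
    (v : (D₂.sub y₀.1 σ h.σ_pos).Fun) :
    ∃ r, ∀ y, hc.mult y r = (Pi.single y₀ v : ∀ y : J, (D₂.sub y.1 σ h.σ_pos).Fun) y := by
  refine hc.exists_mult_eq_of_approx hφ _ fun t ht ε hε => ?_
  obtain ⟨τ', hτ', hprop⟩ := h.proper t ht
  set τ := max τ' 0
  have hτ0 : 0 ≤ τ := le_max_right _ _
  have hτ : τ < σ * D₂.radius := max_lt hτ' (mul_pos h.σ_pos D₂.radius_pos)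
  obtain ⟨P, hP⟩ := exists_poly_approx v.2 (D₂.subCenter y₀.1 h.σ_pos) hτ hε
  -- a bound for `P` on `D₂`
  obtain ⟨C, hC0, hC⟩ : ∃ C > 0, ∀ z : D₂.pts, ‖P.eval (z : k)‖ ≤ C := by
    have h0 : 0 ≤ rootNorm (y₀.1 : k) D₂.radius P := rootNorm_nonneg D₂.radius_pos.le P
    exact ⟨_, by linarith, fun z => (norm_eval_le_rootNorm P (norm_sub_lt y₀.1 z).le).trans
      (le_add_of_nonneg_right zero_le_one)⟩
  obtain ⟨r, hr1, hr2⟩ := hc.exists_mult_approx_single y₀ hτ0 hτ (δ := ε / C) (by positivity)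
  refine ⟨r * (1 ⊗ₜ aeval D₂.coord P), fun y z hz => ?_⟩
  have e : (hc.mult y (r * (1 ⊗ₜ aeval D₂.coord P))).1 z = (hc.mult y r).1 z * P.eval (z : k) := by
    rw [mult, multMap_mul]
    change (hc.mult y r).1 z * (hc.mult y (1 ⊗ₜ aeval D₂.coord P)).1 z = _
    rw [hc.mult_tmul_apply, aeval_coord_apply, Fun.one_apply, one_mul]
    rfl
  rw [e]
  have hPz := hC (D₂.incl y.1 h.σ_pos h.σ_lt.le z)
  by_cases hy : y = y₀
  · subst hy
    rw [Pi.single_eq_same]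
    have hzτ : ‖(z : k) - y.1‖ ≤ τ := (hprop y.1 y.2 (D₂.incl y.1 h.σ_pos h.σ_lt.le z)
      ((mem_sub_iff h.σ_pos).mp z.2) hz).trans (le_max_left _ _)
    have e1 : (hc.mult y r).1 z * P.eval (z : k) - v.1 z =
        ((hc.mult y r).1 z - 1) * P.eval (z : k) + -(v.1 z - P.eval (z : k)) := by ring
    rw [e1]
    refine (IsUltrametricDist.norm_add_le_max _ _).trans (max_le ?_ ?_)
    · rw [norm_mul]
      calc _ ≤ ε / C * C := mul_le_mul (hr1 z hzτ) hPz (norm_nonneg _) (by positivity)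
        _ = ε := by field_simp
    · rw [norm_neg]
      exact hP z hzτ
  · rw [Pi.single_eq_of_ne hy, Fun.zero_apply, sub_zero, norm_mul]
    calc _ ≤ ε / C * C := mul_le_mul (hr2 y hy z) hPz (norm_nonneg _) (by positivity)
      _ = ε := by field_simp

end Morphism.Splits.Compatible

end PreimageSurjective

/-! ### Horizontal sections of the pushforward -/

section

variable {A B R E ι : Type*} {V : ι → Type*} [CommRing A] [CommRing B] [CommRing R]
  [∀ i, CommRing (V i)] [Algebra A B] [Algebra A R] [∀ i, Algebra B (V i)]
  [∀ i, Algebra R (V i)] [AddCommGroup E] [Module A E] [Module B E] [IsScalarTower A B E]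

/-- The map `R ⊗_A E → V_i ⊗_B E` respects connections, up to the factor by which the derivations of
`R` and `V_i` differ. -/
lemma compMap_baseChangeConn
    (hcomm : ∀ i a, algebraMap R (V i) (algebraMap A R a) = algebraMap B (V i) (algebraMap A B a))
    (i : ι) (dA : A → A) (dR : R →+ R) (hR : ∀ a b, dR (a * b) = a * dR b + b * dR a)
    (hAR : ∀ a, dR (algebraMap A R a) = algebraMap A R (dA a)) (connA : E →+ E)
    (hA : ∀ (a : A) (m : E), connA (a • m) = dA a • m + a • connA m)
    (dB : B → B) (dV : V i →+ V i) (hV : ∀ a b, dV (a * b) = a * dV b + b * dV a)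
    (hBV : ∀ a, dV (algebraMap B (V i) a) = algebraMap B (V i) (dB a)) (connB : E →+ E)
    (hB : ∀ (a : B) (m : E), connB (a • m) = dB a • m + a • connB m) (u : B)
    (hu : ∀ e, connB e = u • connA e)
    (hd : ∀ a, dV (algebraMap R (V i) a) = algebraMap B (V i) u * algebraMap R (V i) (dR a))
    (t : R ⊗[A] E) :
    algebraMap B (V i) u • compMap hcomm i (baseChangeConn dA dR hR hAR connA hA t) =
      baseChangeConn dB dV hV hBV connB hB (compMap hcomm i t) := by
  induction t using TensorProduct.induction_on with
  | zero => simp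
  | add t t' ht ht' => rw [map_add, map_add, map_add, map_add, smul_add, ht, ht']
  | tmul a e =>
    rw [baseChangeConn_tmul, map_add, compMap_tmul, compMap_tmul, compMap_tmul,
      baseChangeConn_tmul, smul_add, TensorProduct.smul_tmul', smul_eq_mul, hd, hu,
      TensorProduct.smul_tmul', smul_eq_mul, ← TensorProduct.smul_tmul, Algebra.smul_def]

end

section HorizontalPushforward

open Polynomial Filter Topology

variable {k : Type u} [NontriviallyNormedField k] [IsUltrametricDist k] [CompleteSpace k]
  [IsAlgClosed k]

open OpenDisc

namespace Morphism.Splits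

variable {D₂ D₁ : OpenDisc k} {φ : Morphism D₂ D₁} {x : D₁.pts} {s σ : ℝ} {J : Finset D₂.pts}

lemma deriv_morphism (h : φ.Splits x s σ J) (y : J) :
    (h.morphism y).deriv = res (D₂.sub_subset y.1 σ h.σ_pos h.σ_lt.le) φ.deriv :=
  d_res (D₂.sub_subset y.1 σ h.σ_pos h.σ_lt.le) (φ.pullback D₁.coord)

/-- The horizontal sections of `φ_*(ℰ, ∇)` on a disc `U` are the families of horizontal sections of
`(ℰ, ∇)` on the discs which make up `φ⁻¹(U)`. -/
theorem dimH0_pushforward (h : φ.Splits x s σ J) (hφ : φ.IsFiniteEtale) (E : DiffEq.{u, v} D₂) :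
    (φ.pushforward hφ E).dimH0 x s h.s_pos h.s_le =
      Cardinal.sum fun y : J => E.dimH0 y.1 σ h.σ_pos h.σ_lt.le := by
  classical
  let iAB : Algebra D₁.Fun D₂.Fun := φ.pullback.toRingHom.toAlgebra
  let iAU : Algebra D₁.Fun (D₁.sub x s h.s_pos).Fun :=
    (res (D₁.sub_subset x s h.s_pos h.s_le)).toRingHom.toAlgebra
  let iBV : ∀ y : J, Algebra D₂.Fun (D₂.sub y.1 σ h.σ_pos).Fun := fun y =>
    (res (D₂.sub_subset y.1 σ h.σ_pos h.σ_lt.le)).toRingHom.toAlgebra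
  let iUV : ∀ y : J, Algebra (D₁.sub x s h.s_pos).Fun (D₂.sub y.1 σ h.σ_pos).Fun := fun y =>
    (h.morphism y).pullback.toRingHom.toAlgebra
  let iAE : Module D₁.Fun E.carrier := Module.compHom E.carrier φ.pullback.toRingHom
  have : IsScalarTower D₁.Fun D₂.Fun E.carrier := ⟨fun a b c => mul_smul _ _ _⟩
  have hc : h.Compatible := ⟨fun _ => rfl, fun _ => rfl, fun _ _ => rfl, fun _ _ => rfl⟩
  let E' := (φ.pushforward hφ E).restrict (D₁.sub_subset x s h.s_pos h.s_le)
  let Ey : ∀ y : J, DiffEq.{u, max u v} (D₂.sub y.1 σ h.σ_pos) := fun y =>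
    E.restrict (D₂.sub_subset y.1 σ h.σ_pos h.σ_lt.le)
  let Θ₀ : ∀ y : J, (D₁.sub x s h.s_pos).Fun ⊗[D₁.Fun] E.carrier →+
      (D₂.sub y.1 σ h.σ_pos).Fun ⊗[D₂.Fun] E.carrier := fun y =>
    compMap (R := (D₁.sub x s h.s_pos).Fun) (V := fun y : J => (D₂.sub y.1 σ h.σ_pos).Fun)
      (E := E.carrier) hc.comm y
  let Θ : ∀ y : J, E'.carrier →+ (Ey y).carrier := Θ₀
  have hΘ₀inj : ∀ t : (D₁.sub x s h.s_pos).Fun ⊗[D₁.Fun] E.carrier, (∀ y, Θ₀ y t = 0) → t = 0 :=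
    fun t ht => compMap_injective hc.comm (hc.mult_injective hφ) ht
  have hΘinj : ∀ t : E'.carrier, (∀ y, Θ y t = 0) → t = 0 := hΘ₀inj
  have hΘ₀surj : ∀ w : ∀ y : J, (D₂.sub y.1 σ h.σ_pos).Fun ⊗[D₂.Fun] E.carrier,
      ∃ t, ∀ y, Θ₀ y t = w y :=
    compMap_surjective hc.comm (hc.exists_mult_eq_single hφ)
  have hΘsurj : ∀ w : ∀ y, (Ey y).carrier, ∃ t, ∀ y, Θ y t = w y := hΘ₀surj
  have hΘ₀smul : ∀ y (a : (D₁.sub x s h.s_pos).Fun) t,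
      Θ₀ y (a • t) = (h.morphism y).pullback a • Θ₀ y t := fun y a t =>
    compMap_smul hc.comm y a t
  have hΘsmul : ∀ y (c : k) t, Θ y (c • t) = c • Θ y t := fun y c t =>
    hΘ₀smul y (algebraMap k (D₁.sub x s h.s_pos).Fun c) t
  -- compatibility with the connections
  have hconn : ∀ y t, res (D₂.sub_subset y.1 σ h.σ_pos h.σ_lt.le) φ.deriv • Θ y (E'.conn t) =
      (Ey y).conn (Θ y t) := by
    intro y t
    have hd := h.deriv_morphism y
    have hu : φ.deriv * ↑hφ.isUnit_deriv.unit⁻¹ = 1 := hφ.isUnit_deriv.mul_val_inv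
    have hunit : ∀ e : E.carrier, φ.deriv •
        ((↑hφ.isUnit_deriv.unit⁻¹ : D₂.Fun) • E.conn e) = E.conn e := fun e => by
      rw [smul_smul, hu, one_smul]
    let U := D₁.sub x s h.s_pos
    let V := D₂.sub y.1 σ h.σ_pos
    exact compMap_baseChangeConn (E := E.carrier) hc.comm y D₁.d (U.d : U.Fun →+ U.Fun) U.d.leibniz
      (d_res (D₁.sub_subset x s h.s_pos h.s_le)) (φ.pushforward hφ E).conn
      (φ.pushforward hφ E).leibniz D₂.d (V.d : V.Fun →+ V.Fun) V.d.leibniz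
      (d_res (D₂.sub_subset y.1 σ h.σ_pos h.σ_lt.le)) E.conn E.leibniz φ.deriv
      (fun e => (hunit e).symm)
      (fun a => ((h.morphism y).chain_rule a).trans (by rw [hd, mul_comm]; rfl)) t
  have hH0 : ∀ t, t ∈ E'.H0 ↔ ∀ y, Θ y t ∈ (Ey y).H0 := by
    intro t
    constructor
    · intro ht y
      change (Ey y).conn (Θ y t) = 0
      rw [← hconn, show E'.conn t = 0 from ht, map_zero, smul_zero]
    · intro ht
      refine hΘinj _ fun y => ?_
      have h1 : IsUnit (res (D₂.sub_subset y.1 σ h.σ_pos h.σ_lt.le) φ.deriv) :=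
        hφ.isUnit_deriv.map _
      refine h1.smul_eq_zero.mp ?_
      rw [hconn]
      exact ht y
  let L : E'.H0 →ₗ[k] (∀ y, (Ey y).H0) :=
    { toFun := fun t y => ⟨Θ y t, (hH0 t).mp t.2 y⟩
      map_add' := fun a b => funext fun y => Subtype.ext (map_add (Θ y) a.1 b.1)
      map_smul' := fun c a => funext fun y => Subtype.ext (hΘsmul y c a.1) }
  have hL : Function.Bijective L := by
    constructor
    · refine (injective_iff_map_eq_zero L).mpr fun t ht => Subtype.ext (hΘinj _ fun y => ?_)
      exact congrArg Subtype.val (congrFun ht y)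
    · intro w
      obtain ⟨t, ht⟩ := hΘsurj fun y => (w y).1
      exact ⟨⟨t, (hH0 t).mpr fun y => by rw [ht y]; exact (w y).2⟩,
        funext fun y => Subtype.ext (ht y)⟩
  have := (LinearEquiv.ofBijective L hL).rank_eq
  rw [rank_pi] at this
  exact this

end Morphism.Splits

end HorizontalPushforward

/-! ### The dimension of the space of horizontal sections -/

section Dimension

open Filter Topology

lemma finrank_baseChange_of_isDomain (R S M : Type*) [CommRing R] [IsDomain R] [CommRing S]
    [IsDomain S] [Algebra R S] [AddCommGroup M] [Module R M] [Module.Finite R M]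
    [Module.Projective R M] : Module.finrank S (S ⊗[R] M) = Module.finrank R M := by
  rw [← Ideal.finrank_fiber_eq_finrank (⊥ : Ideal S), Ideal.finrank_fiber_eq_rankAtStalk,
    Module.rankAtStalk_baseChange,
    ← Ideal.finrank_fiber_eq_finrank (PrimeSpectrum.comap (algebraMap R S) ⟨⊥, _⟩).asIdeal,
    Ideal.finrank_fiber_eq_rankAtStalk]

lemma baseChangeConn_rTensor {A B B' M : Type*} [CommRing A] [CommRing B] [Algebra A B] [CommRing B']
    [Algebra A B'] [AddCommGroup M] [Module A M] (dA : A → A)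
    (dB : B →+ B) (hB : ∀ a b, dB (a * b) = a * dB b + b * dB a)
    (hAB : ∀ a, dB (algebraMap A B a) = algebraMap A B (dA a))
    (dB' : B' →+ B') (hB' : ∀ a b, dB' (a * b) = a * dB' b + b * dB' a)
    (hAB' : ∀ a, dB' (algebraMap A B' a) = algebraMap A B' (dA a))
    (conn : M →+ M) (hc : ∀ (a : A) (m : M), conn (a • m) = dA a • m + a • conn m)
    (r : B →ₗ[A] B') (hr : ∀ b, dB' (r b) = r (dB b)) (t : B ⊗[A] M) :
    baseChangeConn dA dB' hB' hAB' conn hc (r.rTensor M t) =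
      r.rTensor M (baseChangeConn dA dB hB hAB conn hc t) := by
  induction t using TensorProduct.induction_on with
  | zero => simp
  | add t t' ht ht' => simp only [map_add, ht, ht']
  | tmul a e =>
    rw [baseChangeConn_tmul, map_add, LinearMap.rTensor_tmul, LinearMap.rTensor_tmul,
      LinearMap.rTensor_tmul, baseChangeConn_tmul, hr]

/-- A finitely generated projective module has elements and functionals with the property of dual
bases. -/
lemma exists_dual_family (B E : Type*) [CommRing B] [AddCommGroup E] [Module B E]
    [Module.Finite B E] [Module.Projective B E] :
    ∃ (n : ℕ) (l : Fin n → E →ₗ[B] B) (m : Fin n → E), ∀ e, e = ∑ j, l j e • m j := by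
  obtain ⟨n, p, i, -, -, hpi⟩ := Module.Finite.exists_comp_eq_id_of_projective B E
  refine ⟨n, fun j => (LinearMap.proj j).comp i, fun j => p (Pi.single j 1), fun e => ?_⟩
  have h1 : p (i e) = e := LinearMap.congr_fun hpi e
  have h2 : i e = ∑ j, (i e j) • (Pi.single j 1 : Fin n → B) := by
    ext l
    simp [Pi.single_apply]
  conv_lhs => rw [← h1, h2, map_sum]
  exact Finset.sum_congr rfl fun j _ => LinearMap.map_smul p (i e j) (Pi.single j 1)

variable {k : Type u} [NontriviallyNormedField k] [IsUltrametricDist k] [CompleteSpace k]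
  [IsAlgClosed k]

open OpenDisc

namespace DiffEq

variable {D : OpenDisc k}

lemma rank_restrict (E : DiffEq.{u, v} D) {U : OpenDisc k} (h : U.pts ⊆ D.pts) :
    (E.restrict h).rank = E.rank := by
  let _ : Algebra D.Fun U.Fun := (res h).toRingHom.toAlgebra
  exact finrank_baseChange_of_isDomain D.Fun U.Fun E.carrier

/-- A horizontal section which vanishes at a point vanishes identically. -/
lemma eq_zero_of_mem_H0 [CharZero k] (E : DiffEq.{u, v} D) (z : D.pts) {e : E.carrier}
    (he : e ∈ E.H0) (hz : ∃ e', e = D.coordSub z • e') : e = 0 := by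
  obtain ⟨n, l, m, hlm⟩ := exists_dual_family D.Fun E.carrier
  have htf : ∀ (g : D.Fun) (e : E.carrier), g ≠ 0 → g • e = 0 → e = 0 := by
    intro g e hg hge
    rw [hlm e]
    refine Finset.sum_eq_zero fun j _ => ?_
    have := congrArg (l j) hge
    rw [map_smul, map_zero, smul_eq_mul] at this
    rw [(mul_eq_zero.mp this).resolve_left hg, zero_smul]
  have hT : D.coordSub z ≠ 0 := fun h0 => by
    have := supNorm_coordSub (D := D) z z (τ := D.radius / 2) (by linarith [D.radius_pos])
      (by linarith [D.radius_pos])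
    rw [h0, sub_self, norm_zero, max_eq_left (by linarith [D.radius_pos])] at this
    have h1 : D.supNorm z (D.radius / 2) 0 = 0 := by
      simp [supNorm]
    linarith [D.radius_pos]
  have key : ∀ n : ℕ, ∃ e', e = D.coordSub z ^ (n + 1) • e' := by
    intro n
    induction n with
    | zero => simpa using hz
    | succ n ih =>
      obtain ⟨e', he'⟩ := ih
      have h1 : E.conn e = 0 := he
      rw [he', E.leibniz, Derivation.leibniz_pow, Morphism.d_coordSub] at h1
      have h2 : D.coordSub z ^ n • ((n + 1 : D.Fun) • e' + D.coordSub z • E.conn e') = 0 := by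
        rw [← h1, smul_add, smul_smul, smul_smul, ← pow_succ]
        simp [mul_comm]
      have h3 := htf _ _ (pow_ne_zero n hT) h2
      have h4 : (algebraMap k D.Fun ((n + 1 : k)⁻¹)) * (n + 1 : D.Fun) = 1 := by
        have : (n + 1 : D.Fun) = algebraMap k D.Fun (n + 1 : k) := by simp
        rw [this, ← _root_.map_mul, inv_mul_cancel₀ (Nat.cast_add_one_ne_zero n), map_one]
      refine ⟨-(algebraMap k D.Fun ((n + 1 : k)⁻¹) • E.conn e'), ?_⟩
      have h5 : e' = -(algebraMap k D.Fun ((n + 1 : k)⁻¹) • D.coordSub z • E.conn e') := by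
        have h6 := congrArg (algebraMap k D.Fun ((n + 1 : k)⁻¹) • ·) h3
        simp only [smul_add, smul_zero] at h6
        rw [smul_smul, h4, one_smul] at h6
        exact eq_neg_of_add_eq_zero_left h6
      conv_lhs => rw [he', h5]
      rw [smul_neg, smul_neg, pow_succ _ (n + 1), mul_smul, smul_comm (D.coordSub z)]
  rw [hlm e]
  refine Finset.sum_eq_zero fun j _ => ?_
  rw [eq_zero_of_forall_pow_dvd z (g := l j e), zero_smul]
  intro n
  obtain ⟨e', he'⟩ := key n
  rw [he', map_smul, smul_eq_mul, pow_succ, mul_assoc]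
  exact dvd_mul_right _ _

/-- Restricting sections to their fibre at `z`: the map is linear over `k`. -/
def fiberMap (E : DiffEq.{u, v} D) (z : D.pts) [Algebra D.Fun k]
    (hk : ∀ a : D.Fun, algebraMap D.Fun k a = a.1 z) : E.carrier →ₗ[k] k ⊗[D.Fun] E.carrier where
  toFun e := 1 ⊗ₜ e
  map_add' e e' := TensorProduct.tmul_add _ _ _
  map_smul' c e := by
    change (1 : k) ⊗ₜ[D.Fun] (algebraMap k D.Fun c • e) = c • (1 : k) ⊗ₜ[D.Fun] e
    rw [← TensorProduct.smul_tmul, TensorProduct.smul_tmul', Algebra.smul_def, hk]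
    rfl

/-- A section whose fibre at `z` is zero is divisible by the coordinate at `z`. -/
lemma exists_eq_smul_of_fiberMap_eq_zero (E : DiffEq.{u, v} D) (z : D.pts) [Algebra D.Fun k]
    (hk : ∀ a : D.Fun, algebraMap D.Fun k a = a.1 z) {e : E.carrier} (he : E.fiberMap z hk e = 0) :
    ∃ e', e = D.coordSub z • e' := by
  obtain ⟨n, l, m, hlm⟩ := exists_dual_family D.Fun E.carrier
  have h1 : ∀ j, ∃ q, l j e = D.coordSub z * q := by
    intro j
    obtain ⟨q, hq⟩ := exists_eq_add_coordSub_mul (l j e) z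
    refine ⟨q, ?_⟩
    have h2 := congrArg (fun t => TensorProduct.rid D.Fun k ((l j).lTensor k t)) he
    simp only [map_zero] at h2
    change TensorProduct.rid D.Fun k ((l j).lTensor k ((1 : k) ⊗ₜ e)) = 0 at h2
    rw [LinearMap.lTensor_tmul, TensorProduct.rid_tmul, Algebra.smul_def, mul_one, hk] at h2
    rw [h2, map_zero, zero_add] at hq
    exact hq
  choose q hq using h1
  refine ⟨∑ j, q j • m j, ?_⟩
  rw [Finset.smul_sum]
  conv_lhs => rw [hlm e]
  exact Finset.sum_congr rfl fun j _ => by rw [hq, mul_smul]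

lemma rank_fiber (E : DiffEq.{u, v} D) [Algebra D.Fun k] :
    Module.rank k (k ⊗[D.Fun] E.carrier) = E.rank := by
  rw [← Module.finrank_eq_rank, finrank_baseChange_of_isDomain]
  rfl

lemma rank_H0_le [CharZero k] (E : DiffEq.{u, v} D) (z : D.pts) :
    Module.rank k E.H0 ≤ (E.rank : Cardinal.{v}) := by
  let _ : Algebra D.Fun k := (evalHom z).toRingHom.toAlgebra
  have hk : ∀ a : D.Fun, algebraMap D.Fun k a = a.1 z := fun _ => rfl
  have hinj : Function.Injective ((E.fiberMap z hk).comp E.H0.subtype) := by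
    refine (injective_iff_map_eq_zero _).mpr fun e he => Subtype.ext ?_
    exact E.eq_zero_of_mem_H0 z e.2 (E.exists_eq_smul_of_fiberMap_eq_zero z hk he)
  have h := LinearMap.lift_rank_le_of_injective _ hinj
  rw [rank_fiber] at h
  simpa using h

/-- The dimension of the space of horizontal sections on a disc is at most the rank. -/
lemma dimH0_le [CharZero k] (E : DiffEq.{u, v} D) (x : D.pts) {s : ℝ} (hs : 0 < s) (hs1 : s ≤ 1) :
    E.dimH0 x s hs hs1 ≤ E.rank := by
  refine (rank_H0_le _ (D.subCenter x hs)).trans ?_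
  rw [rank_restrict]

end DiffEq

/-- The identity theorem for functions on a disc. -/
lemma OpenDisc.res_injective {U D : OpenDisc k} (h : U.pts ⊆ D.pts) :
    Function.Injective (res h) := by
  refine (injective_iff_map_eq_zero _).mpr fun g hg => ?_
  obtain ⟨z⟩ := U.nonempty_pts
  have key : ∀ n : ℕ, ∃ q : D.Fun, g = D.coordSub z ^ n * q ∧ res h q = 0 := by
    intro n
    induction n with
    | zero => exact ⟨g, by simp, hg⟩
    | succ n ih =>
      obtain ⟨q, hq, hq0⟩ := ih
      obtain ⟨q', hq'⟩ := exists_eq_add_coordSub_mul q ⟨z, h z.2⟩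
      have h0 : ∀ w : U.pts, q.1 ⟨w, h w.2⟩ = 0 := fun w =>
        congrArg (fun F : U.Fun => F.1 w) hq0
      rw [h0 z, map_zero, zero_add] at hq'
      have h1 : ∀ w : U.pts, (w : k) ≠ z → q'.1 ⟨w, h w.2⟩ = 0 := by
        intro w hw
        have h2 := h0 w
        rw [hq'] at h2
        exact (mul_eq_zero.mp h2).resolve_left (sub_ne_zero.mpr hw)
      -- the remaining value vanishes by continuity
      have h3 : q'.1 ⟨z, h z.2⟩ = 0 := by
        have h4 := (D.hasDerivAt q' ⟨z, h z.2⟩).continuousAt.tendsto.mono_left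
          (nhdsWithin_le_nhds (s := {(z : k)}ᶜ))
        have h5 : Tendsto (D.ext q'.1) (𝓝[≠] (z : k)) (𝓝 0) := by
          refine tendsto_const_nhds.congr' ?_
          filter_upwards [self_mem_nhdsWithin,
            mem_nhdsWithin_of_mem_nhds (Metric.isOpen_ball.mem_nhds z.2)] with w hw hwU
          exact ((D.ext_apply q'.1 ⟨w, h hwU⟩).trans (h1 ⟨w, hwU⟩ hw)).symm
        rw [← D.ext_apply q'.1]
        exact tendsto_nhds_unique h4 h5
      refine ⟨q', by rw [hq, hq', pow_succ, mul_assoc], Fun.ext fun w => ?_⟩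
      by_cases hw : (w : k) = z
      · have e : w = z := Subtype.ext hw
        rw [e]
        exact h3
      · exact h1 w hw
  exact eq_zero_of_forall_pow_dvd ⟨z, h z.2⟩ fun n => ⟨_, (key n).choose_spec.1⟩

namespace DiffEq

variable {D : OpenDisc k}

/-- Horizontal sections can be restricted to smaller discs without loss of information. -/
lemma dimH0_antitone (E : DiffEq.{u, v} D) (x : D.pts) {s s' : ℝ} (hs : 0 < s) (hss : s ≤ s')
    (hs1 : s' ≤ 1) :
    E.dimH0 x s' (hs.trans_le hss) hs1 ≤ E.dimH0 x s hs (hss.trans hs1) := by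
  have hU' := D.sub_subset x s' (hs.trans_le hss) hs1
  have hU := D.sub_subset x s hs (hss.trans hs1)
  have hUU : (D.sub x s hs).pts ⊆ (D.sub x s' (hs.trans_le hss)).pts := by
    intro w hw
    rw [mem_sub_iff] at hw ⊢
    exact hw.trans_le (mul_le_mul_of_nonneg_right hss D.radius_pos.le)
  set U' := D.sub x s' (hs.trans_le hss)
  set U := D.sub x s hs
  let i1 : Algebra D.Fun U'.Fun := (res hU').toRingHom.toAlgebra
  let i2 : Algebra D.Fun U.Fun := (res hU).toRingHom.toAlgebra
  let r : U'.Fun →ₗ[D.Fun] U.Fun :=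
    { toFun := res hUU
      map_add' := map_add _
      map_smul' := fun a b => by
        rw [Algebra.smul_def, Algebra.smul_def, _root_.map_mul]
        rfl }
  have hr : Function.Injective (r.rTensor E.carrier) :=
    Module.Flat.rTensor_preserves_injective_linearMap r (OpenDisc.res_injective hUU)
  have hconn : ∀ t : U'.Fun ⊗[D.Fun] E.carrier,
      (E.restrict hU).conn (r.rTensor E.carrier t) =
        r.rTensor E.carrier ((E.restrict hU').conn t) := by
    intro t
    exact baseChangeConn_rTensor D.d (U'.d : U'.Fun →+ U'.Fun) U'.d.leibniz (d_res hU')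
      (U.d : U.Fun →+ U.Fun) U.d.leibniz (d_res hU) E.conn E.leibniz r (d_res hUU) t
  have hsmul : ∀ (c : k) (t : U'.Fun ⊗[D.Fun] E.carrier),
      r.rTensor E.carrier (algebraMap k U'.Fun c • t) =
        algebraMap k U.Fun c • r.rTensor E.carrier t := by
    intro c t
    induction t using TensorProduct.induction_on with
    | zero => simp
    | add t t' ht ht' => simp only [map_add, smul_add, ht, ht']
    | tmul a e =>
      rw [TensorProduct.smul_tmul', LinearMap.rTensor_tmul, LinearMap.rTensor_tmul,
        TensorProduct.smul_tmul', smul_eq_mul, smul_eq_mul]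
      congr 1
  let L : (E.restrict hU').H0 →ₗ[k] (E.restrict hU).H0 :=
    { toFun := fun t => ⟨r.rTensor E.carrier t.1, by
        have h0 : (E.restrict hU').conn t.1 = 0 := t.2
        exact (hconn t.1).trans (by rw [h0]; exact map_zero _)⟩
      map_add' := fun a b => Subtype.ext (map_add (r.rTensor E.carrier) a.1 b.1)
      map_smul' := fun c a => Subtype.ext (hsmul c a.1) }
  exact LinearMap.rank_le_of_injective L fun a b hab => Subtype.ext (hr (congrArg Subtype.val hab))

end DiffEq

end Dimension

/-! ### Local solutions of differential equations -/

section Cauchy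

open Filter Topology OpenDisc

variable {k : Type u} [NontriviallyNormedField k] [IsUltrametricDist k] [CompleteSpace k]
  [IsAlgClosed k]

lemma norm_natCast_eq_one_of_coprime {p m : ℕ} (hp : ‖(p : k)‖ < 1) (h : Nat.Coprime m p) :
    ‖(m : k)‖ = 1 := by
  refine le_antisymm (IsUltrametricDist.norm_natCast_le_one k m) ?_
  by_contra! hm
  have h1 := congrArg (fun z : ℤ => (z : k)) (Nat.gcd_eq_gcd_ab m p)
  rw [h] at h1
  push_cast at h1
  have h2 : ‖(m : k) * (m.gcdA p : k) + p * (m.gcdB p : k)‖ < 1 := by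
    refine (IsUltrametricDist.norm_add_le_max _ _).trans_lt (max_lt ?_ ?_)
    · rw [norm_mul]
      exact mul_lt_one_of_nonneg_of_lt_one_left (norm_nonneg _) hm
        (IsUltrametricDist.norm_intCast_le_one k _)
    · rw [norm_mul]
      exact mul_lt_one_of_nonneg_of_lt_one_left (norm_nonneg _) hp
        (IsUltrametricDist.norm_intCast_le_one k _)
  rw [← h1, norm_one] at h2
  exact lt_irrefl _ h2

/-- The absolute values of the factorials decrease at most exponentially. -/
lemma exists_pow_le_norm_factorial [CharZero k] :
    ∃ c : ℝ, 0 < c ∧ ∀ n : ℕ, c ^ n ≤ ‖(n.factorial : k)‖ := by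
  by_cases hall : ∀ n : ℕ, n ≠ 0 → ‖(n : k)‖ = 1
  · exact ⟨1, one_pos, fun n => by rw [one_pow, hall _ (Nat.factorial_ne_zero n)]⟩
  -- the least `p ≥ 1` with `‖p‖ < 1` is prime
  have hex : ∃ n : ℕ, n ≠ 0 ∧ ‖(n : k)‖ < 1 := by
    push Not at hall
    obtain ⟨n, hn, hn1⟩ := hall
    exact ⟨n, hn, lt_of_le_of_ne (IsUltrametricDist.norm_natCast_le_one k n) hn1⟩
  classical
  set p := Nat.find hex
  obtain ⟨hp0, hp1⟩ : p ≠ 0 ∧ ‖(p : k)‖ < 1 := Nat.find_spec hex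
  have hmin : ∀ m < p, m ≠ 0 → ‖(m : k)‖ = 1 := fun m hm hm0 => by
    have h1 := Nat.find_min hex hm
    push Not at h1
    exact le_antisymm (IsUltrametricDist.norm_natCast_le_one k m) (h1 hm0)
  have hpp : p.Prime := by
    rw [Nat.prime_def_lt]
    have hpne1 : p ≠ 1 := fun h => by
      rw [h, Nat.cast_one, norm_one] at hp1
      exact lt_irrefl _ hp1
    refine ⟨by omega, fun m hm ⟨q, hq⟩ => ?_⟩
    by_contra hm1
    have hm0 : m ≠ 0 := fun h => hp0 (by rw [hq, h, zero_mul])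
    have hq0 : q ≠ 0 := fun h => hp0 (by rw [hq, h, mul_zero])
    have hqp : q < p := by
      rw [hq]
      exact lt_mul_of_one_lt_left (Nat.pos_of_ne_zero hq0) (by omega)
    have : ‖(p : k)‖ = 1 := by
      rw [hq, Nat.cast_mul, norm_mul, hmin m hm hm0, hmin q hqp hq0, mul_one]
    exact hp1.ne this
  have := Fact.mk hpp
  refine ⟨‖(p : k)‖, norm_pos_iff.mpr (Nat.cast_ne_zero.mpr hp0), fun n => ?_⟩
  obtain ⟨m, hm⟩ := pow_padicValNat_dvd (p := p) (n := n.factorial)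
  have hcop : Nat.Coprime m p := by
    refine ((Nat.Prime.coprime_iff_not_dvd hpp).mpr fun ⟨q, hq⟩ => ?_).symm
    refine pow_succ_padicValNat_not_dvd (p := p) (Nat.factorial_ne_zero n) ⟨q, ?_⟩
    rw [pow_succ, mul_assoc, ← hq]
    exact hm
  have hle : padicValNat p n.factorial ≤ n := by
    have h1 := sub_one_mul_padicValNat_factorial (p := p) n
    have h2 : 1 ≤ p - 1 := by have := hpp.two_le; omega
    calc padicValNat p n.factorial ≤ (p - 1) * padicValNat p n.factorial :=
          Nat.le_mul_of_pos_left _ h2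
      _ ≤ n := by rw [h1]; exact Nat.sub_le _ _
  rw [hm, Nat.cast_mul, norm_mul, norm_natCast_eq_one_of_coprime hp1 hcop, mul_one, Nat.cast_pow,
    norm_pow]
  exact pow_le_pow_of_le_one (norm_nonneg _) hp1.le hle

namespace OpenDisc

variable {D : OpenDisc k}

/-- The Cauchy product of power series. -/
lemma hasSum_mul {f g : D.pts → k} {x : D.pts} {a b : ℕ → k} {z : D.pts}
    (ha : HasSum (fun n => a n * ((z : k) - x) ^ n) (f z))
    (hb : HasSum (fun n => b n * ((z : k) - x) ^ n) (g z)) :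
    HasSum (fun n => (∑ l ∈ Finset.range (n + 1), a l * b (n - l)) * ((z : k) - x) ^ n)
      (f z * g z) := by
  have : NonarchimedeanRing k :=
    { is_nonarchimedean := NonarchimedeanAddGroup.is_nonarchimedean }
  have h := ha.mul_of_nonarchimedean hb
  have h' := (Finset.HasAntidiagonal.sigmaAntidiagonalEquivProd (A := ℕ)).hasSum_iff.mpr h
  refine (h'.sigma (g := fun n => ∑ p ∈ Finset.HasAntidiagonal.antidiagonal n,
    a p.1 * ((z : k) - x) ^ p.1 * (b p.2 * ((z : k) - x) ^ p.2)) fun n => ?_).congr_fun fun n => ?_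
  · rw [← Finset.sum_attach]
    exact hasSum_fintype _
  · rw [Finset.Nat.sum_antidiagonal_eq_sum_range_succ_mk, Finset.sum_mul]
    refine Finset.sum_congr rfl fun l hl => ?_
    have hp : ((z : k) - x) ^ n = ((z : k) - x) ^ l * ((z : k) - x) ^ (n - l) := by
      rw [← pow_add, Nat.add_sub_of_le (Nat.lt_succ_iff.mp (Finset.mem_range.mp hl))]
    rw [hp]
    ring

/-- The derivative of a power series. -/
lemma hasSum_d {f : D.Fun} {x : D.pts} {a : ℕ → k}
    (ha : ∀ z : D.pts, HasSum (fun n => a n * ((z : k) - x) ^ n) (f.1 z)) (z : D.pts) :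
    HasSum (fun n : ℕ => ((n : k) + 1) * a (n + 1) * ((z : k) - x) ^ n) ((D.d f).1 z) := by
  have hz : ‖(z : k) - x‖ < D.radius := (OpenDisc.mem_pts_iff x z).mp z.2
  obtain ⟨u, hu, hu'⟩ := exists_norm_between (norm_nonneg _) hz _ rfl
  have hp := (D.hasFPowerSeriesOnBall ha ((norm_nonneg _).trans_lt hu) hu').fderiv
  have hs := hp.hasSum (y := (z : k) - x) (by simpa using hu)
  have hs' := (ContinuousLinearMap.apply k k (1 : k)).hasSum hs
  have e : (x : k) + ((z : k) - x) = z := by ring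
  rw [e] at hs'
  refine Eq.subst (motive := fun F => HasSum F _) (funext fun n => ?_) hs'
  have hc := (FormalMultilinearSeries.ofScalars k a).derivSeries_coeff_one n
  rw [FormalMultilinearSeries.coeff_ofScalars] at hc
  rw [FormalMultilinearSeries.apply_eq_pow_smul_coeff]
  simp [hc, mul_comm]

end OpenDisc

/-- The coefficients of the power series solution of `Y' + M Y = 0` with initial value `v`, where
`a l i j` is the coefficient of degree `l` of `M i j`. -/
def cauchySeries {n : ℕ} (a : ℕ → Fin n → Fin n → k) (v : Fin n → k) : ℕ → Fin n → k
  | 0 => v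
  | m + 1 => fun i => -((m + 1 : k)⁻¹ *
      ∑ l : Fin (m + 1), ∑ j, cauchySeries a v l j * a (m - l) i j)

lemma cauchySeries_succ [CharZero k] {n : ℕ} (a : ℕ → Fin n → Fin n → k) (v : Fin n → k) (m : ℕ) (i : Fin n) :
    (m + 1 : k) * cauchySeries a v (m + 1) i =
      -∑ j, ∑ l ∈ Finset.range (m + 1), cauchySeries a v l j * a (m - l) i j := by
  rw [cauchySeries, Finset.sum_comm, Finset.sum_range fun l =>
    ∑ j, cauchySeries a v l j * a (m - l) i j, mul_neg, mul_inv_cancel_left₀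
      (Nat.cast_add_one_ne_zero m)]

/-- Up to the factor `m!`, the coefficients of the solution grow at most exponentially. -/
lemma norm_cauchySeries_mul_le [CharZero k] {n : ℕ} {a : ℕ → Fin n → Fin n → k} {C B : ℝ}
    (hC : 0 ≤ C) (hCB : C ≤ B) (ha : ∀ l i j, ‖a l i j‖ ≤ C * B ^ l) (v : Fin n → k) (m : ℕ)
    (i : Fin n) : ‖cauchySeries a v m i‖ * ‖(m.factorial : k)‖ ≤ ‖v‖ * B ^ m := by
  have hB : 0 ≤ B := hC.trans hCB
  induction m using Nat.strong_induction_on generalizing i with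
  | _ m ih =>
    cases m with
    | zero => simpa [cauchySeries] using norm_le_pi_norm v i
    | succ m =>
      have h1 : ‖cauchySeries a v (m + 1) i‖ * ‖((m + 1).factorial : k)‖ =
          ‖∑ j, ∑ l ∈ Finset.range (m + 1), cauchySeries a v l j * a (m - l) i j‖ *
            ‖(m.factorial : k)‖ := by
        rw [← norm_neg (∑ j, _), ← cauchySeries_succ, norm_mul, Nat.factorial_succ, Nat.cast_mul,
          norm_mul]
        push_cast
        ring
      rw [h1, ← norm_mul, Finset.sum_mul]
      have h0 : 0 ≤ ‖v‖ * B ^ (m + 1) := by positivity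
      refine IsUltrametricDist.norm_sum_le_of_forall_le_of_nonneg h0 fun j _ => ?_
      rw [Finset.sum_mul]
      refine IsUltrametricDist.norm_sum_le_of_forall_le_of_nonneg h0 fun l hl => ?_
      have hlm : l ≤ m := Nat.lt_succ_iff.mp (Finset.mem_range.mp hl)
      have h2 : ‖(m.factorial : k)‖ ≤ ‖(l.factorial : k)‖ := by
        obtain ⟨q, hq⟩ := Nat.factorial_dvd_factorial hlm
        rw [hq, Nat.cast_mul, norm_mul]
        exact mul_le_of_le_one_right (norm_nonneg _) (IsUltrametricDist.norm_natCast_le_one k q)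
      rw [norm_mul, norm_mul]
      calc ‖cauchySeries a v l j‖ * ‖a (m - l) i j‖ * ‖(m.factorial : k)‖
          ≤ ‖cauchySeries a v l j‖ * (C * B ^ (m - l)) * ‖(l.factorial : k)‖ := by
            gcongr
            exact ha _ _ _
        _ = ‖cauchySeries a v l j‖ * ‖(l.factorial : k)‖ * (C * B ^ (m - l)) := by ring
        _ ≤ ‖v‖ * B ^ l * (B * B ^ (m - l)) :=
            mul_le_mul (ih l (by omega) j) (mul_le_mul_of_nonneg_right hCB (by positivity))
              (by positivity) (by positivity)
        _ = ‖v‖ * B ^ (m + 1) := by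
            rw [← pow_succ', mul_assoc, ← pow_add]
            congr 2
            omega

/-- Linear differential systems have solutions with arbitrary initial values on a small disc. -/
lemma exists_solution [CharZero k] {D : OpenDisc k} (z : D.pts) {n : ℕ}
    (M : Fin n → Fin n → D.Fun) :
    ∃ (s : ℝ) (hs : 0 < s) (hs1 : s ≤ 1), ∀ v : Fin n → k, ∃ Y : Fin n → (D.sub z s hs).Fun,
      (∀ i, (D.sub z s hs).d (Y i) + ∑ j, res (D.sub_subset z s hs hs1) (M i j) * Y j = 0) ∧
      ∀ i, (Y i).1 (D.subCenter z hs) = v i := by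
  have hρ := D.radius_pos
  choose a ha using fun i j => (M i j).2 z
  obtain ⟨u, hu0, hu⟩ := D.exists_radius
  -- a bound for the coefficients of `M`
  have hbd : ∀ i j, ∃ C, 0 ≤ C ∧ ∀ l, ‖a i j l‖ ≤ C * (‖u‖⁻¹) ^ l := by
    intro i j
    have hzu : (z : k) + u ∈ D.pts := by
      rw [mem_pts_iff z]
      simpa using hu
    have h1 := (ha i j ⟨_, hzu⟩).summable.tendsto_atTop_zero.norm.bddAbove_range
    obtain ⟨C, hC⟩ := h1
    have hC' : ∀ l, ‖a i j l‖ * ‖u‖ ^ l ≤ C := fun l => by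
      have := hC ⟨l, rfl⟩
      simpa using this
    refine ⟨C, (by positivity : (0 : ℝ) ≤ ‖a i j 0‖ * ‖u‖ ^ 0).trans (hC' 0), fun l => ?_⟩
    rw [inv_pow, ← div_eq_mul_inv, le_div_iff₀ (by positivity)]
    exact hC' l
  choose C hC0 hC using hbd
  set C' := ∑ i, ∑ j, C i j
  have hC'0 : 0 ≤ C' := Finset.sum_nonneg fun i _ => Finset.sum_nonneg fun j _ => hC0 i j
  have hCC' : ∀ i j, C i j ≤ C' := fun i j =>
    (Finset.single_le_sum (f := fun j => C i j) (fun j _ => hC0 i j) (Finset.mem_univ j)).trans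
      (Finset.single_le_sum (f := fun i => ∑ j, C i j)
        (fun i _ => Finset.sum_nonneg fun j _ => hC0 i j) (Finset.mem_univ i))
  set B := max C' ‖u‖⁻¹
  have hB : 0 < B := lt_max_of_lt_right (by positivity)
  have hA : ∀ l i j, ‖a i j l‖ ≤ C' * B ^ l := fun l i j => (hC i j l).trans (by
    have h1 := hCC' i j
    have h2 : ‖u‖⁻¹ ≤ B := le_max_right _ _
    gcongr)
  obtain ⟨c, hc, hcf⟩ := exists_pow_le_norm_factorial (k := k)
  set s := min 1 (c / (B * D.radius))
  have hs : 0 < s := lt_min one_pos (by positivity)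
  have hs1 : s ≤ 1 := min_le_left _ _
  refine ⟨s, hs, hs1, fun v => ?_⟩
  set y := cauchySeries (fun l i j => a i j l) v
  have hy : ∀ i (w : (D.sub z s hs).pts), Summable fun m => y m i * ((w : k) - z) ^ m := by
    intro i w
    refine NonarchimedeanAddGroup.summable_of_tendsto_cofinite_zero ?_
    rw [Nat.cofinite_eq_atTop]
    have hw : ‖(w : k) - z‖ < c / B := by
      refine ((mem_sub_iff hs).mp w.2).trans_le ?_
      calc s * D.radius ≤ c / (B * D.radius) * D.radius :=
            mul_le_mul_of_nonneg_right (min_le_right _ _) hρ.le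
        _ = c / B := by field_simp
    set θ := B / c * ‖(w : k) - z‖
    have hθ0 : 0 ≤ θ := by positivity
    have hθ1 : θ < 1 := by
      calc θ < B / c * (c / B) := mul_lt_mul_of_pos_left hw (by positivity)
        _ = 1 := by field_simp
    have h1 := (tendsto_pow_atTop_nhds_zero_of_lt_one hθ0 hθ1).const_mul ‖v‖
    rw [mul_zero] at h1
    refine squeeze_zero_norm (fun m => ?_) h1
    have h2 := norm_cauchySeries_mul_le hC'0 (le_max_left C' ‖u‖⁻¹) hA v m i
    have h3 : ‖y m i‖ ≤ ‖v‖ * (B / c) ^ m := by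
      rw [div_pow, ← mul_div_assoc, le_div_iff₀ (by positivity)]
      exact (mul_le_mul_of_nonneg_left (hcf m) (norm_nonneg _)).trans h2
    rw [norm_mul, norm_pow, mul_pow, ← mul_assoc]
    gcongr
  have hsum : ∀ i (w : (D.sub z s hs).pts), HasSum (fun m => y m i * ((w : k) - z) ^ m)
      (∑' m, y m i * ((w : k) - z) ^ m) := fun i w => (hy i w).hasSum
  let Y : Fin n → (D.sub z s hs).Fun := fun i =>
    ⟨fun w => ∑' m, y m i * ((w : k) - z) ^ m,
      isAnalytic_of_hasSum (z := D.subCenter z hs) (hsum i)⟩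
  refine ⟨Y, fun i => Fun.ext fun w => ?_, fun i => ?_⟩
  · have h1 := hasSum_d (f := Y i) (x := D.subCenter z hs) (hsum i) w
    have h2 : ∀ j, HasSum (fun m => (∑ l ∈ Finset.range (m + 1), y l j * a i j (m - l)) *
        ((w : k) - z) ^ m) ((Y j).1 w * (M i j).1 (D.incl z hs hs1 w)) := fun j =>
      hasSum_mul (f := (Y j).1) (g := (res (D.sub_subset z s hs hs1) (M i j)).1)
        (x := D.subCenter z hs) (hsum j w) (ha i j (D.incl z hs hs1 w))
    have h2' : HasSum (fun m => ∑ j, (∑ l ∈ Finset.range (m + 1), y l j * a i j (m - l)) *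
        ((w : k) - z) ^ m) (∑ j, (Y j).1 w * (M i j).1 (D.incl z hs hs1 w)) :=
      hasSum_sum fun j _ => h2 j
    have h3 := h1.add h2'
    have h4 : (fun m : ℕ => ((m : k) + 1) * y (m + 1) i * ((w : k) - D.subCenter z hs) ^ m +
        ∑ j, (∑ l ∈ Finset.range (m + 1), y l j * a i j (m - l)) * ((w : k) - z) ^ m) =
        fun _ => 0 := by
      funext m
      rw [cauchySeries_succ, ← Finset.sum_mul]
      change -_ * ((w : k) - z) ^ m + _ = 0
      ring
    rw [h4] at h3
    have h5 := h3.unique hasSum_zero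
    change evalHom w ((D.sub z s hs).d (Y i) +
      ∑ j, res (D.sub_subset z s hs hs1) (M i j) * Y j) = 0
    rw [map_add, map_sum]
    refine Eq.trans ?_ h5
    refine congrArg₂ (· + ·) rfl (Finset.sum_congr rfl fun j _ => ?_)
    rw [map_mul, mul_comm]
    rfl
  · have h1 := hasSum_single (f := fun m => y m i * ((D.subCenter z hs : k) - z) ^ m) 0
      (fun m hm => by
        have : (D.subCenter z hs : k) - z = 0 := sub_self _
        rw [this, zero_pow hm, mul_zero])
    refine ((hsum i _).unique h1).trans ?_
    rw [pow_zero, mul_one]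
    simp [y, cauchySeries]

namespace DiffEq

variable {D : OpenDisc k}

/-- On small discs, the dimension of the space of horizontal sections is the rank. -/
lemma exists_rank_le_dimH0 [CharZero k] (E : DiffEq.{u, v} D) (z : D.pts) :
    ∃ (s : ℝ) (hs : 0 < s) (hs1 : s ≤ 1), E.rank ≤ E.dimH0 z s hs hs1 := by
  obtain ⟨n, l, m, hlm⟩ := exists_dual_family D.Fun E.carrier
  obtain ⟨s, hs, hs1, hY⟩ := exists_solution z fun i j => l i (E.conn (m j))
  refine ⟨s, hs, hs1, ?_⟩
  set U := D.sub z s hs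
  have hU := D.sub_subset z s hs hs1
  set z' := D.subCenter z hs
  let iDU : Algebra D.Fun U.Fun := (res hU).toRingHom.toAlgebra
  let iUk : Algebra U.Fun k := (evalHom z').toRingHom.toAlgebra
  have hk : ∀ a : U.Fun, algebraMap U.Fun k a = a.1 z' := fun _ => rfl
  have hsurj : Function.Surjective (((E.restrict hU).fiberMap z' hk).comp (E.restrict hU).H0.subtype) := by
    -- the fibre is generated by the values of the `m j`
    have hgen : ∀ t : k ⊗[U.Fun] (U.Fun ⊗[D.Fun] E.carrier), ∃ v : Fin n → k,
        t = ∑ j, v j ⊗ₜ[U.Fun] ((1 : U.Fun) ⊗ₜ[D.Fun] m j) := by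
      intro t
      induction t using TensorProduct.induction_on with
      | zero => exact ⟨0, by simp⟩
      | add t t' ht ht' =>
        obtain ⟨v, hv⟩ := ht
        obtain ⟨v', hv'⟩ := ht'
        exact ⟨v + v', by simp [hv, hv', TensorProduct.add_tmul, Finset.sum_add_distrib]⟩
      | tmul c w =>
        induction w using TensorProduct.induction_on with
        | zero => exact ⟨0, by simp⟩
        | add t t' ht ht' =>
          obtain ⟨v, hv⟩ := ht
          obtain ⟨v', hv'⟩ := ht'
          exact ⟨v + v', by
            simp [hv, hv', TensorProduct.tmul_add, TensorProduct.add_tmul, Finset.sum_add_distrib]⟩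
        | tmul a e =>
          refine ⟨fun j => (a * algebraMap D.Fun U.Fun (l j e)) • c, ?_⟩
          conv_lhs => rw [hlm e]
          rw [TensorProduct.tmul_sum, TensorProduct.tmul_sum]
          refine Finset.sum_congr rfl fun j _ => ?_
          rw [TensorProduct.smul_tmul, TensorProduct.smul_tmul', ← TensorProduct.smul_tmul (l j e),
            smul_eq_mul, mul_one, Algebra.smul_def, mul_comm]
    intro t
    obtain ⟨v, rfl⟩ := hgen t
    obtain ⟨Y, hY1, hY2⟩ := hY v
    refine ⟨⟨∑ j, Y j ⊗ₜ[D.Fun] m j, ?_⟩, ?_⟩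
    · have h1 : ∀ j, (E.restrict hU).conn (Y j ⊗ₜ[D.Fun] m j) = U.d (Y j) ⊗ₜ[D.Fun] m j +
          ∑ i, (res hU (l i (E.conn (m j))) * Y j) ⊗ₜ[D.Fun] m i := by
        intro j
        have h2 : (E.restrict hU).conn (Y j ⊗ₜ[D.Fun] m j) = U.d (Y j) ⊗ₜ[D.Fun] m j +
          Y j ⊗ₜ[D.Fun] E.conn (m j) := rfl
        rw [h2]
        congr 1
        conv_lhs => rw [hlm (E.conn (m j))]
        rw [TensorProduct.tmul_sum]
        refine Finset.sum_congr rfl fun i _ => ?_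
        rw [← TensorProduct.smul_tmul, Algebra.smul_def]
        rfl
      change (E.restrict hU).conn (∑ j, Y j ⊗ₜ[D.Fun] m j) = 0
      have h3 : (E.restrict hU).conn (∑ j, Y j ⊗ₜ[D.Fun] m j) =
          ∑ j, (E.restrict hU).conn (Y j ⊗ₜ[D.Fun] m j) := map_sum (E.restrict hU).conn _ _
      refine h3.trans ?_
      rw [Finset.sum_congr rfl fun j _ => h1 j]
      refine (Finset.sum_add_distrib.trans (congrArg₂ (· + ·) rfl Finset.sum_comm)).trans ?_
      refine Finset.sum_add_distrib.symm.trans (Finset.sum_eq_zero fun i _ => ?_)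
      have h4 : (U.d (Y i) + ∑ j, res hU (l i (E.conn (m j))) * Y j) ⊗ₜ[D.Fun] m i =
          U.d (Y i) ⊗ₜ[D.Fun] m i + ∑ j, (res hU (l i (E.conn (m j))) * Y j) ⊗ₜ[D.Fun] m i := by
        rw [TensorProduct.add_tmul, TensorProduct.sum_tmul]
      exact h4.symm.trans
        ((congrArg (fun g : U.Fun => g ⊗ₜ[D.Fun] m i) (hY1 i)).trans (TensorProduct.zero_tmul _ _))
    · change (1 : k) ⊗ₜ[U.Fun] (∑ j, Y j ⊗ₜ[D.Fun] m j) = _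
      rw [TensorProduct.tmul_sum]
      refine Finset.sum_congr rfl fun j _ => ?_
      have h5 : Y j ⊗ₜ[D.Fun] m j = Y j • ((1 : U.Fun) ⊗ₜ[D.Fun] m j) := by
        rw [TensorProduct.smul_tmul', smul_eq_mul, mul_one]
      rw [h5, ← TensorProduct.smul_tmul, Algebra.smul_def, mul_one, hk, hY2]
  have h := LinearMap.rank_le_of_surjective _ hsurj
  rw [rank_fiber, rank_restrict] at h
  exact h

end DiffEq

end Cauchy

/-! ### Counting functions of multisets -/

section Counting

open Filter Topology

lemma countP_congr_of_iff {A : Multiset ℝ} {p q : ℝ → Prop} [DecidablePred p] [DecidablePred q]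
    (h : ∀ a ∈ A, p a ↔ q a) : A.countP p = A.countP q :=
  Multiset.countP_congr rfl fun a ha => propext (h a ha)

lemma countP_le_eq_count_add (A : Multiset ℝ) (b : ℝ) :
    A.countP (b ≤ ·) = A.count b + A.countP (b < ·) := by
  induction A using Multiset.induction_on with
  | empty => simp
  | cons a A ih =>
    rw [Multiset.countP_cons, Multiset.count_cons, Multiset.countP_cons, ih]
    rcases lt_trichotomy a b with h | rfl | h
    · simp [h.not_ge, h.not_gt, h.ne']
    · simp
      ring
    · simp [h.le, h, h.ne]
      ring

lemma eventually_countP_right (A : Multiset ℝ) (s : ℝ) :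
    ∀ᶠ s' in 𝓝[>] s, A.countP (s' < ·) = A.countP (s < ·) := by
  have h : ∀ᶠ s' in 𝓝[>] s, ∀ a ∈ A.toFinset, (s' < a ↔ s < a) := by
    refine (Filter.eventually_all_finset _).mpr fun a _ => ?_
    rcases le_or_gt a s with ha | ha
    · filter_upwards [self_mem_nhdsWithin] with s' hs'
      exact ⟨fun h => absurd (h.trans_le ha) (not_lt.mpr (le_of_lt hs')), fun h => absurd h ha.not_gt⟩
    · filter_upwards [Ioo_mem_nhdsGT ha] with s' hs'
      exact ⟨fun _ => ha, fun _ => hs'.2⟩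
  filter_upwards [h] with s' hs'
  exact countP_congr_of_iff fun a ha => hs' a (Multiset.mem_toFinset.mpr ha)

lemma eventually_countP_left (A : Multiset ℝ) (b : ℝ) :
    ∀ᶠ s in 𝓝[<] b, A.countP (s < ·) = A.countP (b ≤ ·) := by
  have h : ∀ᶠ s in 𝓝[<] b, ∀ a ∈ A.toFinset, (s < a ↔ b ≤ a) := by
    refine (Filter.eventually_all_finset _).mpr fun a _ => ?_
    rcases lt_or_ge a b with ha | ha
    · filter_upwards [Ioo_mem_nhdsLT ha] with s hs
      exact ⟨fun h => absurd h hs.1.not_gt, fun h => absurd h ha.not_ge⟩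
    · filter_upwards [self_mem_nhdsWithin] with s hs
      exact ⟨fun _ => ha, fun _ => lt_of_lt_of_le hs ha⟩
  filter_upwards [h] with s hs
  exact countP_congr_of_iff fun a ha => hs a (Multiset.mem_toFinset.mpr ha)

/-- A multiset in `(0, 1]` is determined by the number of its elements larger than `s`, for all but
finitely many `s ∈ (0, 1)`. -/
lemma multiset_eq_of_countP {A B : Multiset ℝ} (hA : ∀ a ∈ A, a ∈ Set.Ioc (0 : ℝ) 1)
    (hB : ∀ a ∈ B, a ∈ Set.Ioc (0 : ℝ) 1) {T : Set ℝ} (hT : T.Finite)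
    (h : ∀ s ∈ Set.Ioo (0 : ℝ) 1, s ∉ T → A.countP (s < ·) = B.countP (s < ·)) : A = B := by
  have h1 : ∀ s ∈ Set.Ico (0 : ℝ) 1, A.countP (s < ·) = B.countP (s < ·) := by
    intro s hs
    have h2 : ∀ᶠ s' in 𝓝[>] s, s' ∉ T := by
      have h3 : ∀ᶠ s' in 𝓝 s, s' ∉ T \ {s} :=
        (hT.sdiff.isClosed.isOpen_compl).mem_nhds fun h => h.2 rfl
      filter_upwards [mem_nhdsWithin_of_mem_nhds h3, self_mem_nhdsWithin] with s' h4 h5 h6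
      exact h4 ⟨h6, ne_of_gt h5⟩
    obtain ⟨s', h3, h4, h5, h6⟩ := ((eventually_countP_right A s).and
      ((eventually_countP_right B s).and (h2.and (Ioo_mem_nhdsGT hs.2)))).exists
    rw [← h3, ← h4]
    exact h s' ⟨hs.1.trans_lt h6.1, h6.2⟩ h5
  ext b
  by_cases hb : b ∈ Set.Ioc (0 : ℝ) 1
  · have h2 : A.countP (b ≤ ·) = B.countP (b ≤ ·) := by
      obtain ⟨s, h3, h4, h5⟩ := ((eventually_countP_left A b).and
        ((eventually_countP_left B b).and (Ioo_mem_nhdsLT hb.1))).exists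
      rw [← h3, ← h4]
      exact h1 s ⟨h5.1.le, h5.2.trans_le hb.2⟩
    have h3 : A.countP (b < ·) = B.countP (b < ·) := by
      rcases hb.2.lt_or_eq with h4 | rfl
      · exact h1 b ⟨hb.1.le, h4⟩
      · rw [Multiset.countP_eq_zero.mpr fun a ha => (hA a ha).2.not_gt,
          Multiset.countP_eq_zero.mpr fun a ha => (hB a ha).2.not_gt]
    rw [countP_le_eq_count_add, countP_le_eq_count_add, h3] at h2
    exact Nat.add_right_cancel h2
  · rw [Multiset.count_eq_zero_of_notMem fun h => hb (hA b h),
      Multiset.count_eq_zero_of_notMem fun h => hb (hB b h)]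

/-! ### Break sequences -/

lemma exists_isBreakSequence {N : ℝ → ℕ}
    (hfin : {t | t ∈ Set.Ioo (0 : ℝ) 1 ∧ ¬ ContinuousAt N t}.Finite) :
    ∃ n s, IsBreakSequence N n s := by
  classical
  set S : Finset ℝ := {0, 1} ∪ hfin.toFinset with hS
  have h0S : (0 : ℝ) ∈ S := by simp [hS]
  have h1S : (1 : ℝ) ∈ S := by simp [hS]
  have hS01 : ∀ t ∈ S, 0 ≤ t ∧ t ≤ 1 := by
    intro t ht
    simp only [hS, Finset.mem_union, Finset.mem_insert, Finset.mem_singleton,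
      Set.Finite.mem_toFinset, Set.mem_ofPred_eq] at ht
    rcases ht with (rfl | rfl) | ht
    · simp
    · simp
    · exact ⟨ht.1.1.le, ht.1.2.le⟩
  obtain ⟨n, hn⟩ : ∃ n, S.card = n + 1 :=
    Nat.exists_eq_succ_of_ne_zero (Finset.card_pos.mpr ⟨0, h0S⟩).ne'
  let g := S.orderEmbOfFin hn
  let s : ℕ → ℝ := fun i => if h : i < n + 1 then g ⟨i, h⟩ else 0
  have hs : ∀ i (h : i < n + 1), s i = g ⟨i, h⟩ := fun i h => dif_pos h
  have hrange : s '' Set.Iic n = (S : Set ℝ) := by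
    rw [← Finset.range_orderEmbOfFin S hn]
    ext t
    constructor
    · rintro ⟨i, hi, rfl⟩
      exact ⟨⟨i, Nat.lt_succ_of_le hi⟩, (hs i (Nat.lt_succ_of_le hi)).symm⟩
    · rintro ⟨i, rfl⟩
      exact ⟨i, Nat.lt_succ_iff.mp i.2, hs i i.2⟩
  refine ⟨n, s, fun i hi j hj hij => ?_, ?_, ?_, ?_⟩
  · rw [hs i (Nat.lt_succ_of_le hi), hs j (Nat.lt_succ_of_le hj)]
    exact g.strictMono hij
  · rw [hs 0 (Nat.succ_pos n)]
    refine (Finset.orderEmbOfFin_zero hn (Nat.succ_pos n)).trans ?_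
    exact le_antisymm (Finset.min'_le _ _ h0S) (hS01 _ (Finset.min'_mem _ _)).1
  · rw [hs n (Nat.lt_succ_self n)]
    refine (Finset.orderEmbOfFin_last hn (Nat.succ_pos n)).trans ?_
    exact le_antisymm (hS01 _ (Finset.max'_mem _ _)).2 (Finset.le_max' _ _ h1S)
  · rw [hrange, hS, Finset.coe_union, Set.Finite.coe_toFinset, Finset.coe_pair]

namespace IsBreakSequence

variable {N : ℝ → ℕ} {n : ℕ} {s : ℕ → ℝ}

lemma le_of_le (h : IsBreakSequence N n s) {i j : ℕ} (hij : i ≤ j) (hj : j ≤ n) : s i ≤ s j :=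
  h.1.monotoneOn (hij.trans hj) hj hij

lemma existsUnique_mem (h : IsBreakSequence N n s) {b : ℝ} (hb : b ∈ Set.Ioc (0 : ℝ) 1) :
    ∃! m : ℕ, m < n ∧ s m < b ∧ b ≤ s (m + 1) := by
  classical
  obtain ⟨-, h0, h1, -⟩ := id h
  have hex : ∃ j, b ≤ s j := ⟨n, by rw [h1]; exact hb.2⟩
  have hj := Nat.find_spec hex
  have hmin := fun m => Nat.find_min (m := m) hex
  have hjn : Nat.find hex ≤ n := Nat.find_min' hex (by rw [h1]; exact hb.2)
  set j := Nat.find hex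
  have hj0 : j ≠ 0 := fun h2 => by
    rw [h2, h0] at hj
    exact hb.1.not_ge hj
  refine ⟨j - 1, ⟨by omega, not_le.mp (hmin _ (by omega)), ?_⟩, ?_⟩
  · rwa [Nat.sub_add_cancel (Nat.pos_of_ne_zero hj0)]
  · rintro m ⟨hm1, hm2, hm3⟩
    have h2 : j ≤ m + 1 := Nat.find_min' hex hm3
    rcases h2.lt_or_eq with h3 | h3
    · have := h.le_of_le (Nat.lt_succ_iff.mp h3) hm1.le
      exact absurd (hj.trans this) hm2.not_ge
    · omega

/-- Between two breaks the function is constant. -/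
lemma eq_of_mem_Ioc (h : IsBreakSequence N n s)
    (hleft : ∀ t ∈ Set.Ioc (0 : ℝ) 1, ∀ᶠ t' in 𝓝[<] t, N t' = N t) {m : ℕ} (hm : m < n) {t : ℝ}
    (ht : t ∈ Set.Ioc (s m) (s (m + 1))) : N t = N (s (m + 1)) := by
  obtain ⟨hmono, h0, h1, himage⟩ := id h
  have hsm : 0 ≤ s m := h0 ▸ h.le_of_le (Nat.zero_le m) hm.le
  have hsm1 : s (m + 1) ≤ 1 := h1 ▸ h.le_of_le hm le_rfl
  have hlt : s m < s (m + 1) := ht.1.trans_le ht.2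
  have hcont : ContinuousOn N (Set.Ioo (s m) (s (m + 1))) := by
    intro t ht
    refine ContinuousAt.continuousWithinAt ?_
    by_contra hc
    have h2 : t ∈ s '' Set.Iic n := by
      rw [himage]
      exact Or.inr ⟨⟨hsm.trans_lt ht.1, ht.2.trans_le hsm1⟩, hc⟩
    obtain ⟨j, hj, rfl⟩ := h2
    have h3 : m < j := (hmono.lt_iff_lt (Set.mem_Iic.mpr hm.le) hj).mp ht.1
    have h4 : j < m + 1 := (hmono.lt_iff_lt hj (Set.mem_Iic.mpr hm)).mp ht.2
    omega
  rcases ht.2.lt_or_eq with h2 | h2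
  · obtain ⟨t', h3, h4⟩ := ((hleft (s (m + 1)) ⟨hsm.trans_lt hlt, hsm1⟩).and
      (Ioo_mem_nhdsLT hlt)).exists
    rw [← h3]
    exact isPreconnected_Ioo.constant hcont ⟨ht.1, h2⟩ h4
  · rw [h2]

lemma mem_Ioc_of_mem_breakFamily (h : IsBreakSequence N n s) {m : ℕ} (hm : m < n) {a b : ℝ}
    (hb : b ∈ Set.Ioc (0 : ℝ) 1) (ha : a ∈ breakFamily N s m b) : a ∈ Set.Ioc (0 : ℝ) 1 := by
  obtain ⟨hmono, h0, h1, -⟩ := id h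
  rw [breakFamily, Multiset.mem_add] at ha
  rcases ha with ha | ha
  · obtain ⟨j, hj, ha⟩ := Multiset.mem_sum.mp ha
    rw [Multiset.eq_of_mem_replicate ha]
    have hj' := Finset.mem_Icc.mp hj
    have hjn : j ≤ n := hj'.2.trans hm.le
    exact ⟨h0 ▸ hmono (Set.mem_Iic.mpr (Nat.zero_le n)) hjn hj'.1, h1 ▸ h.le_of_le hjn le_rfl⟩
  · rw [Multiset.eq_of_mem_replicate ha]
    exact hb

/-- The number of elements of a family `F_i` which are larger than `t`. -/
lemma countP_breakFamily (h : IsBreakSequence N n s)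
    (hanti : ∀ t t', 0 < t → t ≤ t' → t' ≤ 1 → N t' ≤ N t)
    (hleft : ∀ t ∈ Set.Ioc (0 : ℝ) 1, ∀ᶠ t' in 𝓝[<] t, N t' = N t) {m : ℕ} (hm : m < n) {b : ℝ}
    (hb : s m < b ∧ b ≤ s (m + 1)) {t : ℝ} (ht : t ∈ Set.Ioo (0 : ℝ) 1) (hts : t ∉ s '' Set.Iic n) :
    (breakFamily N s m b).countP (t < ·) = if t < b then N t else 0 := by
  obtain ⟨hmono, h0, h1, -⟩ := id h
  obtain ⟨l, ⟨hl, hlt, htl⟩, -⟩ := h.existsUnique_mem (b := t) ⟨ht.1, ht.2.le⟩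
  have htl' : t < s (l + 1) := lt_of_le_of_ne htl fun e => hts ⟨l + 1, hl, e.symm⟩
  have hNt := h.eq_of_mem_Ioc hleft hl ⟨hlt, htl⟩
  have hiff : ∀ j ≤ n, t < s j ↔ l < j := fun j hj => by
    constructor
    · intro h2
      exact (hmono.lt_iff_lt (Set.mem_Iic.mpr hl.le) hj).mp (hlt.trans h2)
    · intro h2
      exact htl'.trans_le (h.le_of_le h2 hj)
  have hcount : (breakFamily N s m b).countP (t < ·) =
      (∑ j ∈ Finset.Icc 1 m, if l < j then N (s j) - N (s (j + 1)) else 0) +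
        if t < b then N (s (m + 1)) else 0 := by
    have hrep : ∀ (c : ℕ) (a : ℝ),
        (Multiset.replicate c a).countP (t < ·) = if t < a then c else 0 := by
      intro c a
      split_ifs with h2
      · rw [Multiset.countP_eq_card.mpr fun a' ha' => by rwa [Multiset.eq_of_mem_replicate ha'],
          Multiset.card_replicate]
      · exact Multiset.countP_eq_zero.mpr fun a' ha' => by rwa [Multiset.eq_of_mem_replicate ha']
    rw [breakFamily, Multiset.countP_add, hrep, ← Multiset.coe_countPAddMonoidHom, map_sum]
    congr 1
    refine Finset.sum_congr rfl fun j hj => ?_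
    rw [Multiset.coe_countPAddMonoidHom, hrep]
    simp only [hiff j ((Finset.mem_Icc.mp hj).2.trans hm.le)]
  rw [hcount]
  by_cases htb : t < b
  · rw [if_pos htb, if_pos htb, hNt]
    have hlm : l ≤ m := by
      by_contra! h2
      have := h.le_of_le h2 hl.le
      exact absurd (hlt.trans htb) (hb.2.trans this).not_gt
    -- a telescoping sum
    have key : ∀ m, l ≤ m → m < n → (∑ j ∈ Finset.Icc 1 m,
        if l < j then N (s j) - N (s (j + 1)) else 0) + N (s (m + 1)) = N (s (l + 1)) := by
      intro m hlm
      induction m, hlm using Nat.le_induction with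
      | base =>
        intro _
        rw [Finset.sum_eq_zero, zero_add]
        intro j hj
        exact if_neg (not_lt.mpr (Finset.mem_Icc.mp hj).2)
      | succ m hlm ih =>
        intro hmn
        rw [Finset.sum_Icc_succ_top (by omega), if_pos (by omega), add_assoc, Nat.sub_add_cancel]
        · exact ih (by omega)
        · have h2 : 0 < s (m + 1) := h0 ▸ hmono (Set.mem_Iic.mpr (Nat.zero_le n))
            (Set.mem_Iic.mpr (by omega)) (Nat.succ_pos m)
          exact hanti _ _ h2 (h.le_of_le (by omega) hmn) (h1 ▸ h.le_of_le hmn le_rfl)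
    exact key m hlm hm
  · rw [if_neg htb, if_neg htb, add_zero]
    refine Finset.sum_eq_zero fun j hj => if_neg fun h2 => ?_
    have hj' := Finset.mem_Icc.mp hj
    have h3 := (hiff j (hj'.2.trans hm.le)).mpr h2
    exact htb (h3.trans_le ((h.le_of_le hj'.2 hm.le).trans hb.1.le))

end IsBreakSequence

end Counting

/-! ### The multiradius and the dimensions of the spaces of horizontal sections -/

section Multiradius

variable {k : Type u} [NontriviallyNormedField k] [IsUltrametricDist k] [CompleteSpace k]
  [IsAlgClosed k] [CharZero k] {D : OpenDisc k}

namespace DiffEq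

lemma exists_mem_multiradius (E : DiffEq.{u, v} D) (x : D.pts) (i : Fin E.rank) :
    ∃ s : ℝ, ∃ (hs : 0 < s) (hs1 : s < 1),
      ((E.rank - (i : ℕ) : ℕ) : Cardinal) ≤ E.dimH0 x s hs hs1.le := by
  obtain ⟨s, hs, hs1, h⟩ := E.exists_rank_le_dimH0 x
  refine ⟨s / 2, by positivity, by linarith, ?_⟩
  refine le_trans ?_ (h.trans (E.dimH0_antitone x (by positivity) (by linarith) hs1))
  exact Nat.cast_le.mpr (Nat.sub_le _ _)

lemma bddAbove_multiradius (E : DiffEq.{u, v} D) (x : D.pts) (i : Fin E.rank) :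
    BddAbove {s : ℝ | ∃ (hs : 0 < s) (hs1 : s < 1),
      ((E.rank - (i : ℕ) : ℕ) : Cardinal) ≤ E.dimH0 x s hs hs1.le} :=
  ⟨1, fun _ hs => hs.2.1.le⟩

lemma multiradius_mem_Ioc (E : DiffEq.{u, v} D) (x : D.pts) (i : Fin E.rank) :
    E.multiradius x i ∈ Set.Ioc (0 : ℝ) 1 := by
  obtain ⟨s, hs⟩ := E.exists_mem_multiradius x i
  exact ⟨hs.1.trans_le (le_csSup (E.bddAbove_multiradius x i) hs),
    csSup_le ⟨s, hs⟩ fun _ hs => hs.2.1.le⟩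

lemma multiradius_monotone (E : DiffEq.{u, v} D) (x : D.pts) : Monotone (E.multiradius x) := by
  intro i j hij
  refine csSup_le_csSup (E.bddAbove_multiradius x j) (E.exists_mem_multiradius x i) ?_
  rintro s ⟨hs, hs1, h⟩
  refine ⟨hs, hs1, le_trans ?_ h⟩
  exact Nat.cast_le.mpr (Nat.sub_le_sub_left hij _)

/-- The supremum which defines an entry of the multiradius is taken over an interval starting at `0`. -/
lemma le_dimH0_iff (E : DiffEq.{u, v} D) (x : D.pts) (i : Fin E.rank) {s : ℝ} (hs : 0 < s)
    (hs1 : s < 1) (hne : s ≠ E.multiradius x i) :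
    ((E.rank - (i : ℕ) : ℕ) : Cardinal) ≤ E.dimH0 x s hs hs1.le ↔ s < E.multiradius x i := by
  constructor
  · intro h
    exact lt_of_le_of_ne (le_csSup (E.bddAbove_multiradius x i) ⟨hs, hs1, h⟩) hne
  · intro h
    obtain ⟨s', ⟨hs', hs'1, h'⟩, hlt⟩ := exists_lt_of_lt_csSup (E.exists_mem_multiradius x i) h
    exact h'.trans (E.dimH0_antitone x hs hlt.le hs'1.le)

lemma card_filter_sub_le {r d : ℕ} (hd : d ≤ r) :
    (Finset.univ.filter fun i : Fin r => r - (i : ℕ) ≤ d).card = d := by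
  rw [Finset.card_filter, Fin.sum_univ_eq_sum_range (fun i => if r - i ≤ d then 1 else 0) r,
    ← Finset.card_filter]
  have : (Finset.range r).filter (fun i => r - i ≤ d) = Finset.Ico (r - d) r := by
    ext i
    simp only [Finset.mem_filter, Finset.mem_range, Finset.mem_Ico]
    omega
  rw [this, Nat.card_Ico]
  omega

/-- The multiradius determines the dimensions of the spaces of horizontal sections. -/
lemma dimH0_eq (E : DiffEq.{u, v} D) (x : D.pts) {s : ℝ} (hs : 0 < s) (hs1 : s < 1)
    (hne : ∀ i, s ≠ E.multiradius x i) :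
    E.dimH0 x s hs hs1.le =
      ((Finset.univ.filter fun i => s < E.multiradius x i).card : Cardinal) := by
  have hle := E.dimH0_le x hs hs1.le
  obtain ⟨d, hd⟩ := Cardinal.lt_aleph0.mp (hle.trans_lt (Cardinal.natCast_lt_aleph0))
  rw [hd] at hle
  have hdr : d ≤ E.rank := Nat.cast_le.mp hle
  have h1 : ∀ i : Fin E.rank, s < E.multiradius x i ↔ E.rank - (i : ℕ) ≤ d := fun i => by
    rw [← E.le_dimH0_iff x i hs hs1 (hne i), hd, Nat.cast_le]
  simp only [h1]
  rw [hd, card_filter_sub_le hdr]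

end DiffEq

end Multiradius

/-! ### The number of connected components as a function of the radius -/

section NumberOfComponents

open Filter Topology OpenDisc

variable {k : Type u} [NontriviallyNormedField k] [IsUltrametricDist k] [CompleteSpace k]
  [IsAlgClosed k]

lemma card_discsAround_le {D : OpenDisc k} {F : Finset D.pts} {R R' : ℝ} (hR : 0 < R)
    (hR' : 0 < R') (h : ∀ a ∈ F, ∀ b ∈ F, ‖(a : k) - b‖ < R → ‖(a : k) - b‖ < R') :
    (discsAround F R').card ≤ (discsAround F R).card := by
  classical
  have := D.nonempty_pts
  choose! rep hrepF hrep using (fun b hb => mem_discsAround.mp hb :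
    ∀ b ∈ discsAround F R, ∃ y ∈ F, Metric.ball (y : k) R = b)
  refine Finset.card_le_card_of_surjOn (fun b => Metric.ball (rep b : k) R') fun b hb => ?_
  obtain ⟨a, ha, rfl⟩ := mem_discsAround.mp hb
  have hb' : Metric.ball (a : k) R ∈ discsAround F R := mem_discsAround.mpr ⟨a, ha, rfl⟩
  refine ⟨_, hb', ?_⟩
  exact (ball_eq_iff hR' _ _).mpr (h _ (hrepF _ hb') a ha ((ball_eq_iff hR _ _).mp (hrep _ hb')))

namespace Morphism

variable {D₂ D₁ : OpenDisc k} {φ : Morphism D₂ D₁} {f : ℝ → ℝ}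

lemma IsFiniteEtale.N_le (hφ : φ.IsFiniteEtale) (hf : φ.IsRadialWithProfile f) (x : D₁.pts)
    {σ σ' : ℝ} (h0 : 0 < σ) (h1 : σ ≤ 1) (h0' : 0 < σ') (h1' : σ' ≤ 1)
    (h : ∀ a ∈ hφ.fiber x, ∀ b ∈ hφ.fiber x, ‖(a : k) - b‖ < σ * D₂.radius →
      ‖(a : k) - b‖ < σ' * D₂.radius) : φ.N x (f σ') ≤ φ.N x (f σ) := by
  rw [hφ.N_eq hf x h0 h1, hφ.N_eq hf x h0' h1']
  exact card_discsAround_le (mul_pos h0 D₂.radius_pos) (mul_pos h0' D₂.radius_pos) h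

lemma IsFiniteEtale.N_antitone (hφ : φ.IsFiniteEtale) (hf : φ.IsRadialWithProfile f) (x : D₁.pts)
    (t t' : ℝ) (ht : 0 < t) (htt : t ≤ t') (ht' : t' ≤ 1) : φ.N x t' ≤ φ.N x t := by
  obtain ⟨σ, hσ0, hσ1, rfl⟩ := hφ.exists_profile_eq hf x ht (htt.trans ht')
  obtain ⟨σ', hσ'0, hσ'1, rfl⟩ := hφ.exists_profile_eq hf x (ht.trans_le htt) ht'
  have hle : σ ≤ σ' :=
    ((hφ.profile_strictMonoOn hf x).le_iff_le ⟨hσ0.le, hσ1⟩ ⟨hσ'0.le, hσ'1⟩).mp htt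
  refine hφ.N_le hf x hσ0 hσ1 hσ'0 hσ'1 fun a _ b _ h => h.trans_le ?_
  exact mul_le_mul_of_nonneg_right hle D₂.radius_pos.le

/-- `N` is continuous from the left. -/
lemma IsFiniteEtale.eventually_N_left (hφ : φ.IsFiniteEtale) (hf : φ.IsRadialWithProfile f)
    (x : D₁.pts) (t : ℝ) (ht : t ∈ Set.Ioc (0 : ℝ) 1) : ∀ᶠ t' in 𝓝[<] t, φ.N x t' = φ.N x t := by
  have hρ := D₂.radius_pos
  have hmono := hφ.profile_strictMonoOn hf x
  obtain ⟨σ, hσ0, hσ1, rfl⟩ := hφ.exists_profile_eq hf x ht.1 ht.2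
  obtain ⟨τ, hτ, hτF⟩ := exists_lt_forall_le (hφ.fiber x ×ˢ hφ.fiber x)
    (fun p => ‖(p.1 : k) - p.2‖) (σ * D₂.radius)
  have hσ₀ : max 0 (τ / D₂.radius) < σ := max_lt hσ0 ((div_lt_iff₀ hρ).mpr hτ)
  set σ₀ := max 0 (τ / D₂.radius)
  have hσ₀m : σ₀ ∈ Set.Icc (0 : ℝ) 1 := ⟨le_max_left _ _, hσ₀.le.trans hσ1⟩
  filter_upwards [Ioo_mem_nhdsLT (hmono hσ₀m ⟨hσ0.le, hσ1⟩ hσ₀)] with t' ht'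
  have ht'0 : 0 < t' := by
    refine lt_of_le_of_lt ?_ ht'.1
    rw [← hφ.profile_zero hf x]
    exact hmono.monotoneOn (by simp) hσ₀m hσ₀m.1
  refine le_antisymm ?_ (hφ.N_antitone hf x t' _ ht'0 ht'.2.le ht.2)
  obtain ⟨σ', hσ'0, hσ'1, rfl⟩ := hφ.exists_profile_eq hf x ht'0 (ht'.2.le.trans ht.2)
  refine hφ.N_le hf x hσ0 hσ1 hσ'0 hσ'1 fun a ha b hb h => ?_
  have h1 : σ₀ < σ' := (hmono.lt_iff_lt hσ₀m ⟨hσ'0.le, hσ'1⟩).mp ht'.1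
  refine (hτF (a, b) (Finset.mk_mem_product ha hb) h).trans_lt ?_
  exact (div_lt_iff₀ hρ).mp ((le_max_right _ _).trans_lt h1)

/-- The points of discontinuity of `N` are values of the profile function at the distances between
points of the fibre. -/
lemma IsFiniteEtale.finite_not_continuousAt (hφ : φ.IsFiniteEtale) (hf : φ.IsRadialWithProfile f)
    (x : D₁.pts) : {t | t ∈ Set.Ioo (0 : ℝ) 1 ∧ ¬ ContinuousAt (φ.N x) t}.Finite := by
  classical
  have hρ := D₂.radius_pos
  have hmono := hφ.profile_strictMonoOn hf x
  refine ((hφ.fiber x ×ˢ hφ.fiber x).image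
    fun p => f (‖(p.1 : k) - p.2‖ / D₂.radius)).finite_toSet.subset ?_
  rintro t ⟨ht, hdisc⟩
  by_contra hmem
  refine hdisc ?_
  have hleft := hφ.eventually_N_left hf x t ⟨ht.1, ht.2.le⟩
  obtain ⟨σ, hσ0, hσ1, rfl⟩ := hφ.exists_profile_eq hf x ht.1 ht.2.le
  have hσlt : σ < 1 := by
    refine lt_of_le_of_ne hσ1 fun h => ?_
    rw [h, hφ.profile_one hf x] at ht
    exact lt_irrefl _ ht.2
  have hgen : ∀ a ∈ hφ.fiber x, ∀ b ∈ hφ.fiber x, ‖(a : k) - b‖ ≠ σ * D₂.radius := by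
    intro a ha b hb h
    refine hmem (Finset.mem_coe.mpr (Finset.mem_image.mpr
      ⟨(a, b), Finset.mk_mem_product ha hb, ?_⟩))
    simp only [h]
    rw [mul_div_cancel_right₀ _ hρ.ne']
  -- the function is also constant to the right of the given point
  have hright : ∀ᶠ t' in 𝓝[>] (f σ), φ.N x t' = φ.N x (f σ) := by
    obtain ⟨σ₁, hσ₁, hσ₁F⟩ : ∃ σ₁ ∈ Set.Ioo σ 1, ∀ p ∈ hφ.fiber x ×ˢ hφ.fiber x,
        σ * D₂.radius < ‖(p.1 : k) - p.2‖ → σ₁ * D₂.radius < ‖(p.1 : k) - p.2‖ := by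
      have h1 : ∀ᶠ σ₁ in 𝓝[>] σ, ∀ p ∈ hφ.fiber x ×ˢ hφ.fiber x,
          σ * D₂.radius < ‖(p.1 : k) - p.2‖ → σ₁ * D₂.radius < ‖(p.1 : k) - p.2‖ := by
        refine (Filter.eventually_all_finset _).mpr fun p _ => ?_
        by_cases h2 : σ * D₂.radius < ‖(p.1 : k) - p.2‖
        · filter_upwards [Ioo_mem_nhdsGT ((lt_div_iff₀ hρ).mpr h2)] with σ₁ h3 _
          exact (lt_div_iff₀ hρ).mp h3.2
        · exact Eventually.of_forall fun _ h => absurd h h2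
      obtain ⟨σ₁, h2, h3⟩ := (h1.and (Ioo_mem_nhdsGT hσlt)).exists
      exact ⟨σ₁, h3, h2⟩
    have hσ₁m : σ₁ ∈ Set.Icc (0 : ℝ) 1 := ⟨hσ0.le.trans hσ₁.1.le, hσ₁.2.le⟩
    filter_upwards [Ioo_mem_nhdsGT (hmono ⟨hσ0.le, hσ1⟩ hσ₁m hσ₁.1)] with t' ht'
    have ht'1 : t' ≤ 1 := by
      refine ht'.2.le.trans ?_
      rw [← hφ.profile_one hf x]
      exact hmono.monotoneOn hσ₁m (by simp) hσ₁.2.le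
    refine le_antisymm (hφ.N_antitone hf x _ t' ht.1 ht'.1.le ht'1) ?_
    obtain ⟨σ', hσ'0, hσ'1, rfl⟩ := hφ.exists_profile_eq hf x (ht.1.trans ht'.1) ht'1
    refine hφ.N_le hf x hσ'0 hσ'1 hσ0 hσ1 fun a ha b hb h => ?_
    have h1 : σ' < σ₁ := (hmono.lt_iff_lt ⟨hσ'0.le, hσ'1⟩ hσ₁m).mp ht'.2
    by_contra! h2
    have h3 := hσ₁F (a, b) (Finset.mk_mem_product ha hb) (lt_of_le_of_ne h2 (hgen a ha b hb).symm)
    exact absurd (h3.trans h) (mul_lt_mul_of_pos_right h1 hρ).not_gt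
  have hboth : ∀ᶠ t' in 𝓝 (f σ), φ.N x t' = φ.N x (f σ) := by
    rw [← nhdsNE_sup_pure, ← nhdsLT_sup_nhdsGT]
    exact eventually_sup.mpr ⟨eventually_sup.mpr ⟨hleft, hright⟩, eventually_pure.mpr rfl⟩
  exact tendsto_const_nhds.congr' (hboth.mono fun _ h => h.symm)

/-! ### The multiradius of the pushforward -/

/-- The dimension of the space of horizontal sections of the pushforward. -/
lemma IsFiniteEtale.dimH0_pushforward [CharZero k] (hφ : φ.IsFiniteEtale)
    (hf : φ.IsRadialWithProfile f) (E : DiffEq.{u, v} D₂) (x : D₁.pts) (R : Fin E.rank → ℝ)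
    (hR : ∀ y : D₂.pts, φ.toFun y = x → E.multiradius y = R) {σ : ℝ} (hσ0 : 0 < σ) (hσ1 : σ < 1)
    (hgen : ∀ y ∈ hφ.fiber x, ∀ y' ∈ hφ.fiber x, ‖(y : k) - y'‖ ≠ σ * D₂.radius)
    (hσR : ∀ i, σ ≠ R i) (hs : 0 < f σ) (hs1 : f σ ≤ 1) :
    (φ.pushforward hφ E).dimH0 x (f σ) hs hs1 =
      ((φ.N x (f σ) * (Finset.univ.filter fun i => σ < R i).card : ℕ) : Cardinal) := by
  obtain ⟨J, hJ, hsp, hcard⟩ := hφ.exists_splits hf x hσ0 hσ1 hgen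
  have h1 : ∀ y : J, E.dimH0 y.1 σ hsp.σ_pos hsp.σ_lt.le =
      ((Finset.univ.filter fun i => σ < R i).card : Cardinal) := by
    intro y
    have hy := hR y.1 (mem_fiber.mp (hJ y.2))
    rw [E.dimH0_eq y.1 hσ0 hσ1 (by rw [hy]; exact hσR), hy]
  rw [hsp.dimH0_pushforward hφ E]
  simp only [h1]
  rw [Cardinal.sum_const, Cardinal.mk_coe_finset, hcard]
  simp

end Morphism

end NumberOfComponents

section MultiradiusPushforward

open OpenDisc

variable {k : Type u} [NontriviallyNormedField k] [IsUltrametricDist k] [CompleteSpace k]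
  [IsAlgClosed k]

namespace Morphism

variable {D₂ D₁ : OpenDisc k} {φ : Morphism D₂ D₁} {f : ℝ → ℝ}

lemma IsFiniteEtale.profile_mem_Ioc (hφ : φ.IsFiniteEtale) (hf : φ.IsRadialWithProfile f)
    (x : D₁.pts) {σ : ℝ} (hσ : σ ∈ Set.Ioc (0 : ℝ) 1) : f σ ∈ Set.Ioc (0 : ℝ) 1 := by
  have hmono := hφ.profile_strictMonoOn hf x
  have hσm : σ ∈ Set.Icc (0 : ℝ) 1 := ⟨hσ.1.le, hσ.2⟩
  constructor
  · rw [← hφ.profile_zero hf x]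
    exact hmono (by simp) hσm hσ.1
  · rw [← hφ.profile_one hf x]
    exact hmono.monotoneOn hσm (by simp) hσ.2

/-- The multiradius of the pushforward is the sum of the families `F_i`: for all but finitely many `s`,
both have `N(s) · #{i | s < f(R_i)}` elements larger than `s`. -/
lemma IsFiniteEtale.multiradius_pushforward [CharZero k] (hφ : φ.IsFiniteEtale)
    (hf : φ.IsRadialWithProfile f) (E : DiffEq.{u, v} D₂) (x : D₁.pts) (R : Fin E.rank → ℝ)
    (hR : ∀ y : D₂.pts, φ.toFun y = x → E.multiradius y = R) {n : ℕ} {s : ℕ → ℝ}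
    (hs : IsBreakSequence (φ.N x) n s) (m : Fin E.rank → ℕ)
    (hm : ∀ i, m i < n ∧ s (m i) < f (R i) ∧ f (R i) ≤ s (m i + 1)) :
    ((List.ofFn ((φ.pushforward hφ E).multiradius x) : List ℝ) : Multiset ℝ) =
      ∑ i, breakFamily (φ.N x) s (m i) (f (R i)) := by
  classical
  have hmono := hφ.profile_strictMonoOn hf x
  have hR01 : ∀ i, R i ∈ Set.Ioc (0 : ℝ) 1 := fun i => by
    obtain ⟨y, hy⟩ := hφ.exists_toFun_eq x
    rw [← hR y hy]
    exact E.multiradius_mem_Ioc y i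
  set E' := φ.pushforward hφ E
  -- the finitely many radii which have to be avoided
  let T : Set ℝ := Set.range (E'.multiradius x) ∪ s '' Set.Iic n ∪ Set.range (fun i => f (R i)) ∪
    ((hφ.fiber x ×ˢ hφ.fiber x).image fun p => f (‖(p.1 : k) - p.2‖ / D₂.radius) : Finset ℝ)
  have hT : T.Finite := (((Set.finite_range _).union ((Set.finite_Iic n).image s)).union
    (Set.finite_range _)).union (Finset.finite_toSet _)
  rw [← Fin.univ_val_map]
  refine multiset_eq_of_countP (fun a ha => ?_) (fun a ha => ?_) hT fun t ht htT => ?_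
  · obtain ⟨i, -, rfl⟩ := Multiset.mem_map.mp ha
    exact E'.multiradius_mem_Ioc x i
  · obtain ⟨i, -, ha⟩ := Multiset.mem_sum.mp ha
    exact hs.mem_Ioc_of_mem_breakFamily (hm i).1 (hφ.profile_mem_Ioc hf x (hR01 i)) ha
  · simp only [T, Set.mem_union, not_or] at htT
    obtain ⟨⟨⟨ht1, ht2⟩, ht3⟩, ht4⟩ := htT
    have hleft : (Finset.univ.val.map (E'.multiradius x)).countP (t < ·) =
        (Finset.univ.filter fun i => t < E'.multiradius x i).card := by
      rw [Multiset.countP_map]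
      rfl
    have hright : (∑ i, breakFamily (φ.N x) s (m i) (f (R i))).countP (t < ·) =
        φ.N x t * (Finset.univ.filter fun i => t < f (R i)).card := by
      rw [← Multiset.coe_countPAddMonoidHom, map_sum, Finset.card_filter, Finset.mul_sum]
      refine Finset.sum_congr rfl fun i _ => ?_
      rw [Multiset.coe_countPAddMonoidHom, hs.countP_breakFamily (hφ.N_antitone hf x)
        (hφ.eventually_N_left hf x) (hm i).1 (hm i).2 ht ht2]
      simp
    rw [hleft, hright]
    have h1 := E'.dimH0_eq x ht.1 ht.2 fun i h => ht1 ⟨i, h.symm⟩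
    obtain ⟨σ, hσ0, hσ1, rfl⟩ := hφ.exists_profile_eq hf x ht.1 ht.2.le
    have hσlt : σ < 1 := by
      refine lt_of_le_of_ne hσ1 fun h => ?_
      rw [h, hφ.profile_one hf x] at ht
      exact lt_irrefl _ ht.2
    have h2 := hφ.dimH0_pushforward hf E x R hR hσ0 hσlt (fun a ha b hb h => ht4 ?_)
      (fun i h => ht3 ⟨i, by simp only [h]⟩) ht.1 ht.2.le
    · rw [h1, Nat.cast_inj] at h2
      rw [h2]
      congr 3
      ext i
      exact (hmono.lt_iff_lt ⟨hσ0.le, hσ1⟩ ⟨(hR01 i).1.le, (hR01 i).2⟩).symm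
    · refine Finset.mem_coe.mpr (Finset.mem_image.mpr
        ⟨(a, b), Finset.mk_mem_product ha hb, ?_⟩)
      simp only [h]
      rw [mul_div_cancel_right₀ _ D₂.radius_pos.ne']

end Morphism

end MultiradiusPushforward

end PadicDisc

theorem mainTheorem3 {k : Type u} [NontriviallyNormedField k] [IsUltrametricDist k]
    [CompleteSpace k] [IsAlgClosed k] [CharZero k]
    (D₂ D₁ : PadicDisc.OpenDisc k) (hD₂ : D₂.IsStrict) (hD₁ : D₁.IsStrict)
    (φ : PadicDisc.Morphism D₂ D₁) (hφ : φ.IsFiniteEtale)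
    (f : ℝ → ℝ) (hf : φ.IsRadialWithProfile f)
    (E : PadicDisc.DiffEq.{u, v} D₂) (x : D₁.pts) (R : Fin E.rank → ℝ)
    (hR : ∀ y : D₂.pts, φ.toFun y = x → E.multiradius y = R) :
    ∃ (n : ℕ) (s : ℕ → ℝ), PadicDisc.IsBreakSequence (φ.N x) n s ∧
      (∀ i, ∃! m : ℕ, m < n ∧ s m < f (R i) ∧ f (R i) ≤ s (m + 1)) ∧
      ∀ m : Fin E.rank → ℕ, (∀ i, m i < n ∧ s (m i) < f (R i) ∧ f (R i) ≤ s (m i + 1)) →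
        List.ofFn ((φ.pushforward hφ E).multiradius x) =
          (∑ i, PadicDisc.breakFamily (φ.N x) s (m i) (f (R i))).sort (· ≤ ·) := by
  have hR01 : ∀ i, R i ∈ Set.Ioc (0 : ℝ) 1 := fun i => by
    obtain ⟨y, hy⟩ := hφ.exists_toFun_eq x
    rw [← hR y hy]
    exact E.multiradius_mem_Ioc y i
  obtain ⟨n, s, hs⟩ := PadicDisc.exists_isBreakSequence (hφ.finite_not_continuousAt hf x)
  refine ⟨n, s, hs, fun i => hs.existsUnique_mem (hφ.profile_mem_Ioc hf x (hR01 i)),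
    fun m hm => ?_⟩
  refine List.Perm.eq_of_pairwise' (r := (· ≤ ·)) ?_ (Multiset.pairwise_sort _ _) ?_
  · exact (List.sortedLE_ofFn_iff.mpr
      ((φ.pushforward hφ E).multiradius_monotone x)).pairwise
  · rw [← Multiset.coe_eq_coe, Multiset.sort_eq]
    exact hφ.multiradius_pushforward hf E x R hR hs m hm
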